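/- Let $1<\alpha<2$, $T>0$, $d\in\{1,2,3\}$, and let $\Omega\subset\mathbb R^d$ be a convex $d$-polytope (the nonempty interior of the convex hull of finitely many points). **Spaces.** Let $\{\phi_n\}_{n\in\mathbb N}$ be an orthonormal basis of $L^2(\Omega)$ consisting of eigenfunctions of $-\Delta$ with homogeneous Dirichlet boundary values, $-\Delta\phi_n=\lambda_n\phi_n$, where $(\lambda_n)$ is positive, non-decreasing and tends to $\infty$. $\dot H^1(\Omega)$ is the space of $v=\sum_n c_n\phi_n$ with $\|v\|_{\dot H^1(\Omega)}^2:=\sum_n\lambda_nc_n^2<\infty$. Let ${}_0H^1(0,T)$ and ${}^0H^1(0,T)$ be the spaces of $v\in H^1(0,T)$ with $v(0)=0$, respectively $v(T)=0$, with norm $\|v'\|_{L^2(0,T)}$. For $0<s<1$ let ${}_0H^s(0,T)=[L^2(0,T),{}_0H^1(0,T)]_{s,2}$ and ${}^0H^s(0,T)=[L^2(0,T),{}^0H^1(0,T)]_{s,2}$ ($K$-method), and let ${}_0H^{-s}(0,T)$ be the dual space of ${}^0H^s(0,T)$. For an orthonormal basis $\{e_n\}_{n\in\mathbb N}$ of $L^2(\Omega)$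 and $\gamma\in\{s,-s\}$, ${}_0H^{\gamma}(0,T;L^2(\Omega))$ is the space of $\sum_n c_ne_n$ with $\big\|\sum_n c_ne_n\big\|^2:=\sum_n\|c_n\|_{{}_0H^{\gamma}(0,T)}^2<\infty$; an element $\sum_n c_ne_n$ of ${}_0H^{-s}(0,T;L^2(\Omega))$ acts on $\sum_n d_ne_n\in{}^0H^{s}(0,T;L^2(\Omega))$ (defined in the same way) by $\sum_n\langle c_n,d_n\rangle$. Let $D_{0+}^{-\beta}v(t)=\frac1{\Gamma(\beta)}\int_0^t(t-s)^{\beta-1}v(s)\,ds$ for $\beta>0$, $D_{0+}^0v=v$, and $D_{0+}^{\gamma}v=\frac{d^j}{dt^j}D_{0+}^{\gamma-j}v$ for $j-1<\gamma\le j$, $j\in\mathbb N_{>0}$, with the derivative in the sense of distributions. **Discretization.** Let $0=t_0<t_1<\dots<t_J=T$ be a partition of $[0,T]$ with intervals $I_j=(t_{j-1},t_j)$, and let $\mathcal K_h$ be a triangulation of $\Omega$ consisting of $d$-simplexes. Let $S_h=\{v\in H_0^1(\Omega):v|_K\in P_1(K)\ \forall K\in\mathcal K_h\}$, $\widehat W_\tau=\{w\in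 L^2(0,T):w|_{I_j}\in P_0(I_j)\ \forall j\}$ and $W_\tau=\{w\in H^1(0,T):w|_{I_j}\in P_1(I_j)\ \forall j\}$, and let $\widehat W_\tau\otimes S_h$ and $W_\tau\otimes S_h$ be the spans of the products $w\,v$ with $v\in S_h$ and $w\in\widehat W_\tau$, respectively $w\in W_\tau$. Given $u_0,u_1\in S_h^*$ and $f\in(\widehat W_\tau\otimes S_h)^*$, the discrete Petrov–Galerkin problem is to find $U\in W_\tau\otimes S_h$ with $U(0)=u_{0,h}$ and $$\langle D_{0+}^{\alpha-1}U',V\rangle_{\Omega\times(0,T)}+\langle\nabla U,\nabla V\rangle_{\Omega\times(0,T)}=\langle f,V\rangle_{\widehat W_\tau\otimes S_h}+\big\langle u_1,\langle D_{0+}^{\alpha}t,V\rangle_{(0,T)}\big\rangle_{S_h}\qquad\forall\,V\in\widehat W_\tau\otimes S_h,$$ where $u_{0,h}\in S_h$ is the Ritz projection of $u_0$ (that is, $\langle\nabla(u_0-u_{0,h}),\nabla v_h\rangle_\Omega=0$ for all $v_h\in S_h$) if $u_0\in H_0^1(\Omega)$, and the $L^2(\Omega)$-orthogonal projection of $u_0$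 onto $S_h$ (that is, $\langle u_{0,h},v_h\rangle_\Omega=\langle u_0,v_h\rangle_{S_h}$ for all $v_h\in S_h$) otherwise. **Theorem.** For all $u_0,u_1\in S_h^*$ and $f\in(\widehat W_\tau\otimes S_h)^*$ this problem has a unique solution $U$. Moreover, there is a constant $C=C_{\alpha,T}>0$, depending only on $\alpha$ and $T$, such that, if $u_0\in\dot H^1(\Omega)$, $u_1\in L^2(\Omega)$ and $f\in{}_0H^{(1-\alpha)/2}(0,T;L^2(\Omega))$ (with $u_1$ acting on $S_h$ by the $L^2(\Omega)$ inner product and $f$ acting on $\widehat W_\tau\otimes S_h$ by the duality pairing above, which is well defined there), then $U\in C([0,T];\dot H^1(\Omega))$ and $$\|U'\|_{{}_0H^{(\alpha-1)/2}(0,T;L^2(\Omega))}+\|U\|_{C([0,T];\dot H^1(\Omega))}\le C\big(\|u_0\|_{\dot H^1(\Omega)}+\|u_1\|_{L^2(\Omega)}+\|f\|_{{}_0H^{(1-\alpha)/2}(0,T;L^2(\Omega))}\big).$$ -/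

import Mathlib

open MeasureTheory Set Filter Topology
open scoped ENNReal ContDiff InnerProductSpace

noncomputable section

namespace FracWave

/-! ### The spatial domain and the space `H₀¹(Ω)` -/

/-- `ℝ^d` with its Euclidean norm. -/
abbrev Space (d : ℕ) : Type := EuclideanSpace ℝ (Fin d)

/-- An (open) convex `d`-polytope: the nonempty interior of the convex hull of finitely many
points. -/
def IsConvexPolytope {d : ℕ} (Ω : Set (Space d)) : Prop :=
  Ω.Nonempty ∧ ∃ P : Finset (Space d), Ω = interior (convexHull ℝ (P : Set (Space d)))

/-- `L²(Ω)`. -/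
abbrev L2 {d : ℕ} (Ω : Set (Space d)) : Type := Lp ℝ 2 (volume.restrict Ω)

/-- `L²(Ω; ℝ^d)`. -/
abbrev L2Vec {d : ℕ} (Ω : Set (Space d)) : Type := Lp (Space d) 2 (volume.restrict Ω)

/-- The pairs `(φ, ∇φ)` with `φ ∈ C_c^∞(Ω)`, as elements of `L²(Ω) × L²(Ω; ℝ^d)`. -/
def testPairs {d : ℕ} (Ω : Set (Space d)) : Set (L2 Ω × L2Vec Ω) :=
  {p | ∃ φ : Space d → ℝ, ContDiff ℝ ∞ φ ∧ HasCompactSupport φ ∧ tsupport φ ⊆ Ω ∧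
    p.1 =ᵐ[volume.restrict Ω] φ ∧ p.2 =ᵐ[volume.restrict Ω] fun x => gradient φ x}

/-- `H₀¹(Ω)`: the closure of `C_c^∞(Ω)` in the `H¹` norm. The element `v` is stored as the pair
`(v, ∇v)` of the function and its weak gradient, so that the `H¹` norm is (equivalent to) the norm
of `L²(Ω) × L²(Ω; ℝ^d)`. (The set `testPairs Ω` is already a linear subspace.) -/
def h01Pairs {d : ℕ} (Ω : Set (Space d)) : Submodule ℝ (L2 Ω × L2Vec Ω) :=
  (Submodule.span ℝ (testPairs Ω)).topologicalClosure

/-- The space `H₀¹(Ω)` as a type, with the norm and the vector space structure of `h01Pairs Ω`. -/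
def H01 {d : ℕ} (Ω : Set (Space d)) : Type := h01Pairs Ω

instance {d : ℕ} (Ω : Set (Space d)) : NormedAddCommGroup (H01 Ω) :=
  inferInstanceAs (NormedAddCommGroup (h01Pairs Ω))

instance {d : ℕ} (Ω : Set (Space d)) : NormedSpace ℝ (H01 Ω) :=
  inferInstanceAs (NormedSpace ℝ (h01Pairs Ω))

/-- The function in `L²(Ω)` underlying an element of `H₀¹(Ω)`. -/
def H01.val {d : ℕ} {Ω : Set (Space d)} : H01 Ω →L[ℝ] L2 Ω :=
  (ContinuousLinearMap.fst ℝ (L2 Ω) (L2Vec Ω)).comp (h01Pairs Ω).subtypeL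

/-- The weak gradient of an element of `H₀¹(Ω)`. -/
def H01.grad {d : ℕ} {Ω : Set (Space d)} : H01 Ω →L[ℝ] L2Vec Ω :=
  (ContinuousLinearMap.snd ℝ (L2 Ω) (L2Vec Ω)).comp (h01Pairs Ω).subtypeL

/-! ### The spaces `Ḣ^γ(Ω)` -/

/-- An orthonormal basis of `L²(Ω)` of (weak) eigenfunctions of `-Δ` with homogeneous Dirichlet
boundary values, with the positive non-decreasing sequence of the eigenvalues. -/
structure DirichletEigenbasis {d : ℕ} (Ω : Set (Space d)) where
  basis : HilbertBasis ℕ ℝ (L2 Ω)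
  eig : ℕ → ℝ
  eig_pos : ∀ n, 0 < eig n
  eig_mono : Monotone eig
  eig_tendsto : Tendsto eig atTop atTop
  isEigen : ∀ n, ∃ p : H01 Ω, H01.val p = basis n ∧
    ∀ q : H01 Ω, ⟪H01.grad p, H01.grad q⟫_ℝ = eig n * ⟪basis n, H01.val q⟫_ℝ

/-- The norm of `Ḣ^γ(Ω)`, `γ ≥ 0`: `‖∑ cₙ φₙ‖² = ∑ λₙ^γ cₙ²`. An element `v` of `L²(Ω)` belongs to
`Ḣ^γ(Ω)` iff the value is finite. -/
def dotHNorm {d : ℕ} {Ω : Set (Space d)} (Φ : DirichletEigenbasis Ω) (γ : ℝ) (v : L2 Ω) : ℝ≥0∞ :=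
  (∑' n, ENNReal.ofReal (Φ.eig n ^ γ * ⟪Φ.basis n, v⟫_ℝ ^ 2)) ^ (1 / 2 : ℝ)

/-! ### Functions of time -/

/-- Lebesgue measure on `(0, T)`. -/
abbrev timeMeasure (T : ℝ) : Measure ℝ := volume.restrict (Ioo 0 T)

/-- `L²(0, T; X)`. -/
abbrev L2Time (T : ℝ) (X : Type) [NormedAddCommGroup X] : Type := Lp X 2 (timeMeasure T)

/-- `w` is the (absolutely) continuous representative on `[0, T]` of an element of `H¹(0, T; X)`
with weak derivative `g ∈ L²(0, T; X)`. -/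
def IsPrimitive {X : Type} [NormedAddCommGroup X] [NormedSpace ℝ X] (T : ℝ) (w : ℝ → X)
    (g : L2Time T X) : Prop :=
  ∀ t ∈ Icc 0 T, w t = w 0 + ∫ s in (0 : ℝ)..t, g s

/-- `v ∈ H¹(0, T)`, `v' = g` and `v(p) = 0`. For `p = 0` this is `v ∈ ₀H¹(0, T)`, for `p = T` it is
`v ∈ ⁰H¹(0, T)`; the norm of `v` in this space is `‖g‖_{L²(0, T)}`. -/
def IsH1Vanishing (T p : ℝ) (v g : L2Time T ℝ) : Prop :=
  ∃ w : ℝ → ℝ, IsPrimitive T w g ∧ w p = 0 ∧ v =ᵐ[timeMeasure T] w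

/-- The `K`-functional of the pair `L²(0, T)`, `₀H¹(0, T)` (for `p = 0`), respectively
`L²(0, T)`, `⁰H¹(0, T)` (for `p = T`). -/
def kFunctional (T p : ℝ) (v : L2Time T ℝ) (r : ℝ) : ℝ≥0∞ :=
  ⨅ (v₁ : L2Time T ℝ) (g : L2Time T ℝ) (_ : IsH1Vanishing T p v₁ g),
    ‖v - v₁‖ₑ + ENNReal.ofReal r * ‖g‖ₑ

/-- The norm of `₀H^s(0, T) = [L²(0, T), ₀H¹(0, T)]_{s,2}` (for `p = 0`), respectively of
`⁰H^s(0, T) = [L²(0, T), ⁰H¹(0, T)]_{s,2}` (for `p = T`), where `0 < s < 1`. An element `v` of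
`L²(0, T)` belongs to the space iff the value is finite. -/
def fracNorm (T p s : ℝ) (v : L2Time T ℝ) : ℝ≥0∞ :=
  (∫⁻ r in Ioi (0 : ℝ), (ENNReal.ofReal (r ^ (-s)) * kFunctional T p v r) ^ 2 / ENNReal.ofReal r)
    ^ (1 / 2 : ℝ)

theorem IsPrimitive.add {T : ℝ} {w₁ w₂ : ℝ → ℝ} {g₁ g₂ : L2Time T ℝ} (h₁ : IsPrimitive T w₁ g₁)
    (h₂ : IsPrimitive T w₂ g₂) : IsPrimitive T (w₁ + w₂) (g₁ + g₂) := by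
  intro t ht
  have hint : ∀ g : L2Time T ℝ, IntervalIntegrable g volume 0 t := by
    intro g
    rw [intervalIntegrable_iff_integrableOn_Ioo_of_le ht.1]
    have hg : Integrable g (timeMeasure T) := (Lp.memLp g).integrable (by norm_num)
    exact IntegrableOn.mono_set hg (Ioo_subset_Ioo_right ht.2)
  have hae : ∀ᵐ s ∂(volume : Measure ℝ), s ∈ Ioo 0 T → (g₁ + g₂ : L2Time T ℝ) s = g₁ s + g₂ s :=
    (ae_restrict_iff' measurableSet_Ioo).1 (Lp.coeFn_add g₁ g₂)
  have hne : ∀ᵐ s ∂(volume : Measure ℝ), s ≠ T := by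
    simp [ae_iff]
  have : ∫ s in (0 : ℝ)..t, (g₁ + g₂ : L2Time T ℝ) s = ∫ s in (0 : ℝ)..t, (g₁ s + g₂ s) := by
    refine intervalIntegral.integral_congr_ae ?_
    filter_upwards [hae, hne] with s hs hsT hmem
    rw [uIoc_of_le ht.1] at hmem
    exact hs ⟨hmem.1, lt_of_le_of_ne (hmem.2.trans ht.2) hsT⟩
  rw [this, intervalIntegral.integral_add (hint g₁) (hint g₂)]
  simp only [Pi.add_apply]
  rw [h₁ t ht, h₂ t ht]
  ring

theorem IsPrimitive.smul {T : ℝ} {w : ℝ → ℝ} {g : L2Time T ℝ} (c : ℝ) (h : IsPrimitive T w g) :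
    IsPrimitive T (c • w) (c • g) := by
  intro t ht
  have hae : ∀ᵐ s ∂(volume : Measure ℝ), s ∈ Ioo 0 T → (c • g : L2Time T ℝ) s = c • g s :=
    (ae_restrict_iff' measurableSet_Ioo).1 (Lp.coeFn_smul c g)
  have hne : ∀ᵐ s ∂(volume : Measure ℝ), s ≠ T := by
    simp [ae_iff]
  have : ∫ s in (0 : ℝ)..t, (c • g : L2Time T ℝ) s = ∫ s in (0 : ℝ)..t, c • g s := by
    refine intervalIntegral.integral_congr_ae ?_
    filter_upwards [hae, hne] with s hs hsT hmem
    rw [uIoc_of_le ht.1] at hmem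
    exact hs ⟨hmem.1, lt_of_le_of_ne (hmem.2.trans ht.2) hsT⟩
  rw [this, intervalIntegral.integral_smul]
  simp only [Pi.smul_apply]
  rw [h t ht, smul_add]

theorem IsH1Vanishing.add {T p : ℝ} {v₁ v₂ g₁ g₂ : L2Time T ℝ} (h₁ : IsH1Vanishing T p v₁ g₁)
    (h₂ : IsH1Vanishing T p v₂ g₂) : IsH1Vanishing T p (v₁ + v₂) (g₁ + g₂) := by
  obtain ⟨w₁, a₁, b₁, c₁⟩ := h₁
  obtain ⟨w₂, a₂, b₂, c₂⟩ := h₂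
  refine ⟨w₁ + w₂, a₁.add a₂, by simp [b₁, b₂], ?_⟩
  exact (Lp.coeFn_add v₁ v₂).trans (c₁.add c₂)

theorem IsH1Vanishing.smul {T p : ℝ} {v g : L2Time T ℝ} (c : ℝ) (h : IsH1Vanishing T p v g) :
    IsH1Vanishing T p (c • v) (c • g) := by
  obtain ⟨w, h₁, h₂, h₃⟩ := h
  refine ⟨c • w, h₁.smul c, by simp [h₂], ?_⟩
  exact (Lp.coeFn_smul c v).trans (h₃.const_smul c)

theorem kFunctional_add_le (T p : ℝ) (v w : L2Time T ℝ) (r : ℝ) :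
    kFunctional T p (v + w) r ≤ kFunctional T p v r + kFunctional T p w r := by
  refine ENNReal.le_of_forall_pos_le_add fun ε hε hfin => ?_
  have hε2 : ((ε / 2 : NNReal) : ℝ≥0∞) ≠ 0 := by
    simpa using hε.ne'
  have hv : kFunctional T p v r < kFunctional T p v r + ((ε / 2 : NNReal) : ℝ≥0∞) :=
    ENNReal.lt_add_right (ne_top_of_le_ne_top hfin.ne le_self_add) hε2
  have hw : kFunctional T p w r < kFunctional T p w r + ((ε / 2 : NNReal) : ℝ≥0∞) :=
    ENNReal.lt_add_right (ne_top_of_le_ne_top hfin.ne le_add_self) hε2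
  conv_lhs at hv => unfold kFunctional
  conv_lhs at hw => unfold kFunctional
  simp only [iInf_lt_iff] at hv hw
  obtain ⟨v₁, g₁, h₁, hv⟩ := hv
  obtain ⟨w₁, g₂, h₂, hw⟩ := hw
  calc kFunctional T p (v + w) r
      ≤ ‖(v + w) - (v₁ + w₁)‖ₑ + ENNReal.ofReal r * ‖g₁ + g₂‖ₑ :=
        iInf_le_of_le (v₁ + w₁) (iInf_le_of_le (g₁ + g₂) (iInf_le _ (h₁.add h₂)))
    _ ≤ (‖v - v₁‖ₑ + ‖w - w₁‖ₑ) + ENNReal.ofReal r * (‖g₁‖ₑ + ‖g₂‖ₑ) := by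
        rw [add_sub_add_comm]
        gcongr
        · exact enorm_add_le _ _
        · exact enorm_add_le _ _
    _ = (‖v - v₁‖ₑ + ENNReal.ofReal r * ‖g₁‖ₑ) + (‖w - w₁‖ₑ + ENNReal.ofReal r * ‖g₂‖ₑ) := by
        ring
    _ ≤ (kFunctional T p v r + ((ε / 2 : NNReal) : ℝ≥0∞)) +
          (kFunctional T p w r + ((ε / 2 : NNReal) : ℝ≥0∞)) := add_le_add hv.le hw.le
    _ = kFunctional T p v r + kFunctional T p w r + ε := by
        rw [add_add_add_comm, ← ENNReal.coe_add, add_halves]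

theorem isH1Vanishing_zero (T p : ℝ) : IsH1Vanishing T p 0 0 := by
  refine ⟨0, ?_, rfl, Lp.coeFn_zero _ _ _⟩
  have h : IsPrimitive T ((0 : ℝ) • fun t => ∫ s in (0 : ℝ)..t, (0 : L2Time T ℝ) s)
      ((0 : ℝ) • (0 : L2Time T ℝ)) := by
    apply IsPrimitive.smul
    intro t _
    simp
  simpa using h

theorem kFunctional_smul_le (T p : ℝ) (c : ℝ) (v : L2Time T ℝ) (r : ℝ) :
    kFunctional T p (c • v) r ≤ ‖c‖ₑ * kFunctional T p v r := by
  by_cases hc : c = 0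
  · have h : kFunctional T p (c • v) r ≤ ‖c • v - 0‖ₑ + ENNReal.ofReal r * ‖(0 : L2Time T ℝ)‖ₑ :=
      iInf_le_of_le 0 (iInf_le_of_le 0 (iInf_le _ (isH1Vanishing_zero T p)))
    refine h.trans ?_
    simp [hc]
  · have hc0 : ‖c‖ₑ ≠ 0 := by simpa using hc
    conv_rhs => unfold kFunctional
    simp only [ENNReal.mul_iInf_of_ne hc0 enorm_ne_top]
    refine le_iInf fun v₁ => le_iInf fun g => le_iInf fun h => ?_
    refine (iInf_le_of_le (c • v₁) (iInf_le_of_le (c • g) (iInf_le _ (h.smul c)))).trans ?_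
    rw [← smul_sub, enorm_smul, enorm_smul, mul_add]
    exact le_of_eq (by ring)

theorem measurable_kFunctional (T p : ℝ) (v : L2Time T ℝ) : Measurable (kFunctional T p v) := by
  refine Monotone.measurable fun a b hab => ?_
  unfold kFunctional
  gcongr

theorem fracNorm_zero (T p s : ℝ) : fracNorm T p s 0 = 0 := by
  have h : ∀ r, kFunctional T p 0 r = 0 := fun r => by
    simpa using kFunctional_smul_le T p 0 0 r
  simp [fracNorm, h]

theorem fracNorm_smul_lt_top {T p s : ℝ} (c : ℝ) {v : L2Time T ℝ} (h : fracNorm T p s v < ⊤) :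
    fracNorm T p s (c • v) < ⊤ := by
  unfold fracNorm at h ⊢
  rw [ENNReal.rpow_lt_top_iff_of_pos (by norm_num)] at h ⊢
  refine lt_of_le_of_lt (lintegral_mono (g := fun r => ‖c‖ₑ ^ 2 *
    ((ENNReal.ofReal (r ^ (-s)) * kFunctional T p v r) ^ 2 / ENNReal.ofReal r)) fun r => ?_) ?_
  · calc _ ≤ (ENNReal.ofReal (r ^ (-s)) * (‖c‖ₑ * kFunctional T p v r)) ^ 2 / ENNReal.ofReal r := by
          gcongr
          exact kFunctional_smul_le T p c v r
      _ = _ := by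
          simp only [div_eq_mul_inv]
          ring
  · rw [lintegral_const_mul' _ _ (by finiteness)]
    exact ENNReal.mul_lt_top (by finiteness) h

theorem fracNorm_add_lt_top {T p s : ℝ} {v w : L2Time T ℝ} (hv : fracNorm T p s v < ⊤)
    (hw : fracNorm T p s w < ⊤) : fracNorm T p s (v + w) < ⊤ := by
  unfold fracNorm at hv hw ⊢
  rw [ENNReal.rpow_lt_top_iff_of_pos (by norm_num)] at hv hw ⊢
  refine lt_of_le_of_lt (lintegral_mono (g := fun r =>
    2 * ((ENNReal.ofReal (r ^ (-s)) * kFunctional T p v r) ^ 2 / ENNReal.ofReal r) +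
    2 * ((ENNReal.ofReal (r ^ (-s)) * kFunctional T p w r) ^ 2 / ENNReal.ofReal r))
    fun r => ?_) ?_
  · have key : ∀ a b : ℝ≥0∞, (a + b) ^ 2 ≤ 2 * a ^ 2 + 2 * b ^ 2 := fun a b => by
      have := ENNReal.rpow_add_le_mul_rpow_add_rpow a b (p := 2) (by norm_num)
      norm_num at this
      rwa [mul_add] at this
    calc _ ≤ (ENNReal.ofReal (r ^ (-s)) * (kFunctional T p v r + kFunctional T p w r)) ^ 2 /
            ENNReal.ofReal r := by
          gcongr
          exact kFunctional_add_le T p v w r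
      _ ≤ (2 * (ENNReal.ofReal (r ^ (-s)) * kFunctional T p v r) ^ 2 +
            2 * (ENNReal.ofReal (r ^ (-s)) * kFunctional T p w r) ^ 2) / ENNReal.ofReal r := by
          rw [mul_add]
          gcongr
          exact key _ _
      _ = _ := by
          simp only [div_eq_mul_inv]
          ring
  · have hm : Measurable fun r : ℝ =>
        2 * ((ENNReal.ofReal (r ^ (-s)) * kFunctional T p v r) ^ 2 / ENNReal.ofReal r) := by
      have := measurable_kFunctional T p v
      fun_prop
    rw [lintegral_add_left hm, lintegral_const_mul' _ _ (by finiteness),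
      lintegral_const_mul' _ _ (by finiteness)]
    exact ENNReal.add_lt_top.2 ⟨ENNReal.mul_lt_top (by finiteness) hv,
      ENNReal.mul_lt_top (by finiteness) hw⟩

/-- The space `₀H^s(0, T)` (for `p = 0`), respectively `⁰H^s(0, T)` (for `p = T`), `0 < s < 1`. -/
def fracSpace (T p s : ℝ) : Submodule ℝ (L2Time T ℝ) where
  carrier := {v | fracNorm T p s v < ⊤}
  add_mem' := fracNorm_add_lt_top
  zero_mem' := by simp [fracNorm_zero]
  smul_mem' := fun c _ h => fracNorm_smul_lt_top c h

/-- The norm of a linear functional on `⁰H^s(0, T)` in the dual space `₀H^{-s}(0, T)`, `0 < s < 1`;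
the functional is bounded iff the value is finite. -/
def dualNorm (T s : ℝ) (c : Module.Dual ℝ (fracSpace T T s)) : ℝ≥0∞ :=
  ⨆ (v : fracSpace T T s) (_ : fracNorm T T s v ≤ 1), ‖c v‖ₑ

/-! ### Functions of time with values in `L²(Ω)` -/

/-- The `n`-th coefficient `t ↦ (v(t), eₙ)` of `v ∈ L²(0, T; L²(Ω))` with respect to an orthonormal
basis `(eₙ)` of `L²(Ω)`. -/
def coeff {d : ℕ} {Ω : Set (Space d)} {T : ℝ} (e : HilbertBasis ℕ ℝ (L2 Ω))
    (v : L2Time T (L2 Ω)) (n : ℕ) : L2Time T ℝ :=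
  (innerSL ℝ (e n)).compLp v

/-- The norm of `₀H^s(0, T; L²(Ω))`, `0 < s < 1`: `‖∑ cₙ eₙ‖² = ∑ ‖cₙ‖²` with the norms of `cₙ` in
`₀H^s(0, T)`. -/
def fracNormL2 {d : ℕ} {Ω : Set (Space d)} {T : ℝ} (e : HilbertBasis ℕ ℝ (L2 Ω)) (s : ℝ)
    (v : L2Time T (L2 Ω)) : ℝ≥0∞ :=
  (∑' n, fracNorm T 0 s (coeff e v n) ^ 2) ^ (1 / 2 : ℝ)

/-- The norm of `∑ cₙ eₙ` in `₀H^{-s}(0, T; L²(Ω))`, `0 < s < 1`, where `cₙ` are functionals on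
`⁰H^s(0, T)`: `‖∑ cₙ eₙ‖² = ∑ ‖cₙ‖²`. The formal series is an element of the space iff the value
is finite. -/
def dualNormL2 {T s : ℝ} (c : ℕ → Module.Dual ℝ (fracSpace T T s)) : ℝ≥0∞ :=
  (∑' n, dualNorm T s (c n) ^ 2) ^ (1 / 2 : ℝ)

/-- `y` is the value `∑ ⟨cₙ, dₙ⟩` of the duality pairing between `∑ cₙ eₙ ∈ ₀H^{-s}(0, T; L²(Ω))` and
`v = ∑ dₙ eₙ ∈ ⁰H^s(0, T; L²(Ω))`. -/
def HasPairing {d : ℕ} {Ω : Set (Space d)} {T s : ℝ} (e : HilbertBasis ℕ ℝ (L2 Ω))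
    (c : ℕ → Module.Dual ℝ (fracSpace T T s)) (v : L2Time T (L2 Ω)) (y : ℝ) : Prop :=
  ∃ dn : ℕ → fracSpace T T s, (∀ n, (dn n : L2Time T ℝ) = coeff e v n) ∧
    HasSum (fun n => c n (dn n)) y

/-! ### Riemann–Liouville fractional calculus on `(0, T)` -/

/-- The fractional integral `D_{0+}^{-β} v`, `β ≥ 0`. -/
def rlIntegral {X : Type} [NormedAddCommGroup X] [NormedSpace ℝ X] (β : ℝ) (v : ℝ → X) (t : ℝ) : X :=
  if β = 0 then v t else (Real.Gamma β)⁻¹ • ∫ s in (0 : ℝ)..t, (t - s) ^ (β - 1) • v s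

/-- `G ∈ L¹(0, T; X)` is the Riemann–Liouville derivative `D_{0+}^γ v = D^j D_{0+}^{γ-j} v`, `γ > 0`,
with `j - 1 < γ ≤ j` and `D` the derivative in the sense of distributions on `(0, T)`. -/
def IsRLDeriv {X : Type} [NormedAddCommGroup X] [NormedSpace ℝ X] (T γ : ℝ) (v G : ℝ → X) : Prop :=
  IntegrableOn G (Ioo 0 T) ∧
  ∀ φ : ℝ → ℝ, ContDiff ℝ ∞ φ → HasCompactSupport φ → tsupport φ ⊆ Ioo 0 T →
    ∫ t in Ioo 0 T, iteratedDeriv ⌈γ⌉₊ φ t • rlIntegral ((⌈γ⌉₊ : ℝ) - γ) v t =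
      (-1 : ℝ) ^ ⌈γ⌉₊ • ∫ t in Ioo 0 T, φ t • G t

/-! ### The discretization -/

/-- `𝒦` is (the set of the vertex sets of the elements of) a conforming triangulation of the domain
`Ω ⊆ ℝ^d` consisting of `d`-simplexes. -/
def IsTriangulation {d : ℕ} (Ω : Set (Space d)) (𝒦 : Finset (Finset (Space d))) : Prop :=
  (∀ K ∈ 𝒦, K.card = d + 1 ∧ AffineIndependent ℝ (fun x : K => (x : Space d))) ∧
  (⋃ K ∈ 𝒦, convexHull ℝ (K : Set (Space d))) = closure Ω ∧
  ∀ K ∈ 𝒦, ∀ L ∈ 𝒦, convexHull ℝ (K : Set (Space d)) ∩ convexHull ℝ (L : Set (Space d)) =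
    convexHull ℝ ((K : Set (Space d)) ∩ (L : Set (Space d)))

/-- The finite element space `S_h = {v ∈ H₀¹(Ω) : v|_K ∈ P₁(K) for all K}`. -/
def femSpace {d : ℕ} (Ω : Set (Space d)) (𝒦 : Finset (Finset (Space d))) :
    Submodule ℝ (H01 Ω) where
  carrier := {v | ∀ K ∈ 𝒦, ∃ (a : ℝ) (b : Space d), ∀ᵐ x ∂(volume.restrict Ω),
    x ∈ convexHull ℝ (K : Set (Space d)) → H01.val v x = a + ⟪b, x⟫_ℝ}
  add_mem' := by
    intro v w hv hw K hK
    obtain ⟨a, b, h⟩ := hv K hK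
    obtain ⟨a', b', h'⟩ := hw K hK
    refine ⟨a + a', b + b', ?_⟩
    filter_upwards [h, h', Lp.coeFn_add (H01.val v) (H01.val w)] with x h₁ h₂ h₃ hx
    rw [map_add, h₃, Pi.add_apply, h₁ hx, h₂ hx, inner_add_left]
    ring
  zero_mem' := by
    intro K _
    refine ⟨0, 0, ?_⟩
    filter_upwards [Lp.coeFn_zero ℝ 2 (volume.restrict Ω)] with x h _
    rw [map_zero, h]
    simp
  smul_mem' := by
    intro c v hv K hK
    obtain ⟨a, b, h⟩ := hv K hK
    refine ⟨c * a, c • b, ?_⟩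
    filter_upwards [h, Lp.coeFn_smul c (H01.val v)] with x h₁ h₂ hx
    rw [map_smul, h₂, Pi.smul_apply, h₁ hx, inner_smul_left]
    simp [mul_add]

/-- The inclusion `S → L²(Ω)` of a subspace `S` of `H₀¹(Ω)`. -/
def toL2 {d : ℕ} {Ω : Set (Space d)} (S : Submodule ℝ (H01 Ω)) : S →L[ℝ] L2 Ω :=
  H01.val.comp S.subtypeL

/-- The inclusion `L²(0, T; S) → L²(0, T; L²(Ω))` for a subspace `S` of `H₀¹(Ω)`. -/
def timeToL2 {d : ℕ} {Ω : Set (Space d)} {T : ℝ} (S : Submodule ℝ (H01 Ω)) (V : L2Time T S) :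
    L2Time T (L2 Ω) :=
  (toL2 S).compLp V

/-- The gradient on a subspace `S` of `H₀¹(Ω)`. -/
def gradOn {d : ℕ} {Ω : Set (Space d)} (S : Submodule ℝ (H01 Ω)) : S →L[ℝ] L2Vec Ω :=
  H01.grad.comp S.subtypeL

/-- `0 = t₀ < t₁ < ⋯ < t_J = T`. -/
def IsPartition (T : ℝ) {J : ℕ} (t : Fin (J + 1) → ℝ) : Prop :=
  StrictMono t ∧ t 0 = 0 ∧ t (Fin.last J) = T

/-- `w ∈ W_τ`: `w ∈ H¹(0, T)` (given by its continuous representative on `[0, T]`) with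
`w|_{I_j} ∈ P₁(I_j)` for all `j`. -/
def MemTrial (T : ℝ) {J : ℕ} (t : Fin (J + 1) → ℝ) (w : ℝ → ℝ) : Prop :=
  (∃ g : L2Time T ℝ, IsPrimitive T w g) ∧
  ∀ j : Fin J, ∃ a b : ℝ, ∀ s ∈ Ioo (t j.castSucc) (t j.succ), w s = a + b * s

/-- `w ∈ Ŵ_τ`: `w ∈ L²(0, T)` with `w|_{I_j} ∈ P₀(I_j)` for all `j`. -/
def MemTest {T : ℝ} {J : ℕ} (t : Fin (J + 1) → ℝ) (w : L2Time T ℝ) : Prop :=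
  ∀ j : Fin J, ∃ a : ℝ, ∀ᵐ s ∂(volume.restrict (Ioo (t j.castSucc) (t j.succ))), w s = a

/-- `W_τ ⊗ S`, the span of the products `w v` with `w ∈ W_τ` and `v ∈ S`. Only the values of its
elements on `[0, T]` are relevant. -/
def trialSpace (T : ℝ) {J : ℕ} (t : Fin (J + 1) → ℝ) {d : ℕ} {Ω : Set (Space d)}
    (S : Submodule ℝ (H01 Ω)) : Submodule ℝ (ℝ → S) :=
  Submodule.span ℝ {U | ∃ (w : ℝ → ℝ) (v : S), MemTrial T t w ∧ U = fun s => w s • v}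

/-- `Ŵ_τ ⊗ S`, the span of the products `w v` with `w ∈ Ŵ_τ` and `v ∈ S`. -/
def testSpace (T : ℝ) {J : ℕ} (t : Fin (J + 1) → ℝ) {d : ℕ} {Ω : Set (Space d)}
    (S : Submodule ℝ (H01 Ω)) : Submodule ℝ (L2Time T S) :=
  Submodule.span ℝ {V | ∃ (w : L2Time T ℝ) (v : S), MemTest t w ∧
    V =ᵐ[timeMeasure T] fun s => w s • v}

/-- `w = R_h v` is the Ritz projection of `v ∈ H₀¹(Ω)` onto `S`. -/
def IsRitzProjection {d : ℕ} {Ω : Set (Space d)} (S : Submodule ℝ (H01 Ω)) (v : H01 Ω) (w : S) :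
    Prop :=
  ∀ z : S, ⟪H01.grad v - gradOn S w, gradOn S z⟫_ℝ = 0

/-- `w` is the `L²(Ω)`-orthogonal projection of `ℓ ∈ S*` onto `S`. -/
def IsL2Projection {d : ℕ} {Ω : Set (Space d)} (S : Submodule ℝ (H01 Ω)) (l : Module.Dual ℝ S)
    (w : S) : Prop :=
  ∀ z : S, ⟪toL2 S w, toL2 S z⟫_ℝ = l z

/-- The functional `z ↦ ∫_Ω u z` on `S` induced by `u ∈ L²(Ω)`. -/
def l2Functional {d : ℕ} {Ω : Set (Space d)} (S : Submodule ℝ (H01 Ω)) (u : L2 Ω) :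
    Module.Dual ℝ S :=
  ((innerSL ℝ u).comp (toL2 S)).toLinearMap

/-- `w` is the discrete initial value `u_{0,h}`. The datum `u₀` is a function in `L²(Ω)` or a
functional in `S*`. If it is a function in `H₀¹(Ω)`, then `u_{0,h}` is its Ritz projection, and
otherwise it is its `L²(Ω)`-orthogonal projection. -/
def IsDiscreteInitialValue {d : ℕ} {Ω : Set (Space d)} (S : Submodule ℝ (H01 Ω)) :
    L2 Ω ⊕ Module.Dual ℝ S → S → Prop
  | Sum.inl u, w =>
      (∃ v : H01 Ω, H01.val v = u ∧ IsRitzProjection S v w) ∨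
      ((¬ ∃ v : H01 Ω, H01.val v = u) ∧ IsL2Projection S (l2Functional S u) w)
  | Sum.inr l, w => IsL2Projection S l w

/-- `U` solves the Petrov–Galerkin problem with data `u₀`, `u₁ ∈ S*` and `f ∈ (Ŵ_τ ⊗ S)*`:
`U ∈ W_τ ⊗ S`, `U(0) = u_{0,h}` and, for all `V ∈ Ŵ_τ ⊗ S`,
`⟨D_{0+}^{α-1} U', V⟩ + ⟨∇U, ∇V⟩ = ⟨f, V⟩ + ⟨u₁, ⟨D_{0+}^α t, V⟩_{(0,T)}⟩`.
Here `U'`, `G` and `g` are `U'`, `D_{0+}^{α-1} U'` and `D_{0+}^α t`. -/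
def IsSolution {d : ℕ} {Ω : Set (Space d)} (α T : ℝ) {J : ℕ} (t : Fin (J + 1) → ℝ)
    (S : Submodule ℝ (H01 Ω)) (u₀ : L2 Ω ⊕ Module.Dual ℝ S) (u₁ : Module.Dual ℝ S)
    (f : Module.Dual ℝ (testSpace T t S)) (U : ℝ → S) : Prop :=
  U ∈ trialSpace T t S ∧ IsDiscreteInitialValue S u₀ (U 0) ∧
  ∃ (U' : L2Time T S) (G : ℝ → S) (g : ℝ → ℝ), IsPrimitive T U U' ∧
    IsRLDeriv T (α - 1) U' G ∧ IsRLDeriv T α (fun s => s) g ∧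
    ∀ V : testSpace T t S,
      (∫ s in Ioo 0 T, ⟪toL2 S (G s), toL2 S ((V : L2Time T S) s)⟫_ℝ) +
        (∫ s in Ioo 0 T, ⟪gradOn S (U s), gradOn S ((V : L2Time T S) s)⟫_ℝ) =
      f V + u₁ (∫ s in Ioo 0 T, g s • (V : L2Time T S) s)

/-- The norm of `U` in `C([0, T]; Ḣ¹(Ω))` for a continuous function `U`. -/
def supDotH1Norm {d : ℕ} {Ω : Set (Space d)} (Φ : DirichletEigenbasis Ω) (T : ℝ)
    (U : ℝ → L2 Ω) : ℝ≥0∞ :=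
  ⨆ s ∈ Icc 0 T, dotHNorm Φ 1 (U s)

/-- `U` is continuous on `[0, T]` with respect to the norm of `Ḣ¹(Ω)`, with values in `Ḣ¹(Ω)`. -/
def IsContinuousDotH1 {d : ℕ} {Ω : Set (Space d)} (Φ : DirichletEigenbasis Ω) (T : ℝ)
    (U : ℝ → L2 Ω) : Prop :=
  (∀ s ∈ Icc 0 T, dotHNorm Φ 1 (U s) < ⊤) ∧
  ∀ s ∈ Icc 0 T, Tendsto (fun r => dotHNorm Φ 1 (U r - U s)) (𝓝[Icc 0 T] s) (𝓝 0)

end FracWave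

end

open FracWave

/-!
The method is stable because testing with `V = U' χ_{(0, t_m)}`, which is an admissible piecewise
constant test function, produces a coercive quadratic form for every partition.

*Coercivity in time.* For a scalar step function `w` on `(0, T)`, the energy
`∫ (D_{0+}^{α-1} w) w` is *equal* to a multiple of the Gagliardo norm
`∫₀^∞ r^{-α} ∫_ℝ |w(t + r) - w(t)|² dt dr` of the extension of `w` by zero (`gagliardo_stepFun`).
Indeed, the energy is the quadratic form of second differences of `x ↦ x_+^{2-α}`, this function is a
superposition of the truncations `x ↦ min x_+ r` with the weight `r^{-α}`
(`integral_rpow_mul_posPart`), and the second differences of `x ↦ x_+` are the lengths of the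
overlaps of the intervals of the partition (`integral_indicator_mul_indicator`), which also
determine the inner integral (`transl_stepFun`). The Gagliardo norm with exponent `s = (α - 1) / 2`
in turn bounds

* the `K`-method norms of both `₀H^s(0, T)` and `⁰H^s(0, T)`, by using Steklov averages, backward or
  forward in time, as competitors in the `K`-functional (`kFunctional_sq_le`, `fracNorm_sq_le`);
* the `L²` norm of `w` with the weight `t^{1-α}`, by a Hardy inequality
  (`lintegral_rpow_mul_sq_le`); the weight is a multiple of `D_{0+}^α t`, so this controls the term
  with `u₁` (`sq_sum_rlKerPrim_le`).

Expansion in an orthonormal basis of `L²(Ω)` carries these bounds over to vector-valued functions.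

*The discrete problem.* In terms of the slopes `a` of `U`, the problem is a square linear system
(`isSolution_iff`). Since `D_{0+}^{α-1}` is causal and `∫ ⟨∇U, ∇U'⟩` telescopes, testing with
`U' χ_{(0, t_m)}` gives the energy identity `discreteForm_truncate`, hence a bound of the energy of
`U'` and of `‖∇U(t_m)‖` by the data (`energy_estimate`). With zero data, this shows that the system
is injective (`discreteForm_injective`), whence existence and uniqueness. In general it gives the
stability estimate (`stability`), since `‖∇U(t)‖` is largest at a node
(`norm_gradOn_stepPrim_le`).

*Space.* The pairs `(v, ∇v)` with `v ∈ H₀¹(Ω)` are determined by `v` (`H01.val_injective`) and by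
`∇v` (`H01.grad_injective`, from the Poincaré inequality), so that the two inner products on the
finite-dimensional space `S_h` are definite. The norm of `Ḣ¹(Ω)` is bounded by that of the gradient
by Bessel's inequality (`dotHNorm_le`), with the reverse bound for the initial value from the
eigenfunction expansion (`exists_H01_of_dotHNorm`).
-/

noncomputable section

namespace FracWave

/-! ### Translation moduli and the `K`-functional -/

theorem lintegral_Ioi_rpow_neg {p s : ℝ} (hp : 1 < p) (hs : 0 < s) :
    ∫⁻ r in Ioi s, ENNReal.ofReal (r ^ (-p)) = ENNReal.ofReal (s ^ (1 - p) / (p - 1)) := by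
  rw [← ofReal_integral_eq_lintegral_ofReal (integrableOn_Ioi_rpow_of_lt (by linarith) hs)]
  · rw [integral_Ioi_rpow_of_lt (by linarith) hs]
    congr 1
    rw [show -p + 1 = -(p - 1) by ring, show 1 - p = -(p - 1) by ring, neg_div_neg_eq]
  · filter_upwards [ae_restrict_mem measurableSet_Ioi] with r hr
    exact Real.rpow_nonneg (hs.le.trans (le_of_lt hr)) _

/-- Tonelli's theorem for the weight `r^{-p}` on the triangle `0 < s < r`. -/
theorem lintegral_rpow_mul_lintegral_Ioo {p : ℝ} (hp : 1 < p) {h : ℝ → ℝ≥0∞}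
    (hm : Measurable h) :
    ∫⁻ r in Ioi (0 : ℝ), ENNReal.ofReal (r ^ (-p)) * ∫⁻ s in Ioo 0 r, h s =
      ∫⁻ s in Ioi (0 : ℝ), ENNReal.ofReal (s ^ (1 - p) / (p - 1)) * h s := by
  set K : ℝ → ℝ → ℝ≥0∞ := fun r s =>
    {q : ℝ × ℝ | q.2 < q.1}.indicator (fun q => ENNReal.ofReal (q.1 ^ (-p)) * h q.2) (r, s)
  have hK : Measurable (Function.uncurry K) := by
    refine Measurable.indicator ?_ (measurableSet_lt measurable_snd measurable_fst)
    fun_prop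
  have h1 : ∀ r ∈ Ioi (0 : ℝ), ENNReal.ofReal (r ^ (-p)) * ∫⁻ s in Ioo 0 r, h s =
      ∫⁻ s in Ioi (0 : ℝ), K r s := by
    intro r hr
    rw [← lintegral_const_mul _ hm, ← Ioi_inter_Iio, inter_comm, ← Measure.restrict_restrict
      measurableSet_Iio, ← lintegral_indicator measurableSet_Iio]
    rfl
  have h2 : ∀ s ∈ Ioi (0 : ℝ), ∫⁻ r in Ioi (0 : ℝ), K r s =
      ENNReal.ofReal (s ^ (1 - p) / (p - 1)) * h s := by
    intro s hs
    rw [← lintegral_Ioi_rpow_neg hp hs, ← lintegral_mul_const _ (by fun_prop),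
      ← inter_eq_self_of_subset_left (Ioi_subset_Ioi (le_of_lt (mem_Ioi.1 hs))),
      ← Measure.restrict_restrict measurableSet_Ioi]
    exact lintegral_indicator measurableSet_Ioi _
  rw [setLIntegral_congr_fun measurableSet_Ioi h1, lintegral_lintegral_swap hK.aemeasurable,
    setLIntegral_congr_fun measurableSet_Ioi h2]

/-- The squared `L²` modulus of continuity `∫ |v(t + r) - v(t)|² dt` of a function on `ℝ`. -/
def transl (v : ℝ → ℝ) (r : ℝ) : ℝ≥0∞ := ∫⁻ t, ‖v (t + r) - v t‖ₑ ^ 2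

theorem measurable_transl {v : ℝ → ℝ} (hv : Measurable v) : Measurable (transl v) := by
  unfold transl
  refine Measurable.lintegral_prod_right' (f := fun q : ℝ × ℝ => ‖v (q.2 + q.1) - v q.2‖ₑ ^ 2) ?_
  fun_prop

theorem transl_neg (v : ℝ → ℝ) (r : ℝ) : transl v (-r) = transl v r := by
  unfold transl
  rw [← lintegral_add_right_eq_self _ r]
  refine lintegral_congr fun t => ?_
  rw [add_neg_cancel_right, ← enorm_neg, neg_sub]

/-- The Cauchy–Schwarz inequality against the constant function `1`. -/
theorem sq_lintegral_le {μ : Measure ℝ} {h : ℝ → ℝ≥0∞} (hm : Measurable h) :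
    (∫⁻ s, h s ∂μ) ^ 2 ≤ μ univ * ∫⁻ s, h s ^ 2 ∂μ := by
  have := ENNReal.lintegral_mul_le_Lp_mul_Lq μ Real.HolderConjugate.two_two
    (f := h) (g := fun _ => 1) hm.aemeasurable aemeasurable_const
  have h2 : (∫⁻ s, h s ∂μ) ≤ (∫⁻ s, h s ^ 2 ∂μ) ^ (1 / 2 : ℝ) * (μ univ) ^ (1 / 2 : ℝ) := by
    simpa using this
  calc (∫⁻ s, h s ∂μ) ^ 2 ≤ ((∫⁻ s, h s ^ 2 ∂μ) ^ (1 / 2 : ℝ) * (μ univ) ^ (1 / 2 : ℝ)) ^ 2 := by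
        gcongr
    _ = _ := by
        rw [mul_pow, ← ENNReal.rpow_natCast, ← ENNReal.rpow_natCast, ← ENNReal.rpow_mul,
          ← ENNReal.rpow_mul]
        norm_num
        rw [mul_comm]

theorem enorm_toLp_sq {μ : Measure ℝ} {f : ℝ → ℝ} (hf : MemLp f 2 μ) :
    ‖hf.toLp f‖ₑ ^ 2 = ∫⁻ t, ‖f t‖ₑ ^ 2 ∂μ := by
  rw [Lp.enorm_toLp, eLpNorm_eq_lintegral_rpow_enorm_toReal (by norm_num) (by norm_num),
    ← ENNReal.rpow_natCast, ← ENNReal.rpow_mul]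
  norm_num

/-- The Steklov average `(1/r) ∫₀ʳ v(t + σ s) ds`, `σ = ±1`, written through the primitive of
`v`. -/
def steklov (v : ℝ → ℝ) (σ r t : ℝ) : ℝ := σ / r * ∫ s in t..(t + σ * r), v s

theorem steklov_eq {v : ℝ → ℝ} {σ r : ℝ} (hσ : σ = 1 ∨ σ = -1) (t : ℝ) :
    steklov v σ r t = 1 / r * ∫ s in (0 : ℝ)..r, v (t + σ * s) := by
  have h0 : σ ≠ 0 := by rcases hσ with h | h <;> simp [h]
  have h1 : σ * σ = 1 := by rcases hσ with h | h <;> simp [h]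
  rw [intervalIntegral.integral_comp_add_mul (fun s => v s) h0, steklov]
  simp only [mul_zero, add_zero, smul_eq_mul]
  have : σ⁻¹ = σ := by field_simp; nlinarith
  rw [this]; ring

/-- The Steklov average is absolutely continuous, with the difference quotient of `v` as its
derivative. -/
theorem steklov_sub {v : ℝ → ℝ} (hv : Integrable v) (σ r t : ℝ) :
    steklov v σ r t = steklov v σ r 0 + ∫ s in (0 : ℝ)..t, σ / r * (v (s + σ * r) - v s) := by
  have hi : ∀ a b, IntervalIntegrable v volume a b := fun a b => hv.intervalIntegrable
  have hi' : IntervalIntegrable (fun s => v (s + σ * r)) volume 0 t :=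
    (hv.comp_add_right (σ * r)).intervalIntegrable
  rw [intervalIntegral.integral_const_mul, intervalIntegral.integral_sub hi' (hi _ _),
    intervalIntegral.integral_comp_add_right (fun s => v s), steklov, steklov]
  rw [← mul_add]
  congr 1
  have := intervalIntegral.integral_interval_sub_interval_comm (hi 0 (0 + σ * r))
    (hi t (t + σ * r)) (hi 0 t)
  linarith

theorem measurable_steklov {v : ℝ → ℝ} (hv : Integrable v) (σ r : ℝ) :
    Measurable (steklov v σ r) := by
  have : Continuous fun t => ∫ s in (0:ℝ)..t, v s :=
    intervalIntegral.continuous_primitive (fun a b => hv.intervalIntegrable) 0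
  have h2 : steklov v σ r = fun t => σ / r *
      ((∫ s in (0:ℝ)..(t + σ * r), v s) - ∫ s in (0:ℝ)..t, v s) := by
    ext t
    rw [intervalIntegral.integral_interval_sub_left] <;> first | rfl | exact hv.intervalIntegrable
  rw [h2]
  have h3 : Continuous fun t => ∫ s in (0:ℝ)..(t + σ * r), v s := this.comp (by fun_prop)
  exact (continuous_const.mul (h3.sub this)).measurable

theorem lintegral_sub_steklov_le {v : ℝ → ℝ} (hm : Measurable v) (hv : Integrable v)
    {σ r : ℝ} (hσ : σ = 1 ∨ σ = -1) (hr : 0 < r) :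
    ∫⁻ t, ‖v t - steklov v σ r t‖ₑ ^ 2 ≤
      (ENNReal.ofReal r)⁻¹ * ∫⁻ s in Ioo 0 r, transl v s := by
  have hr0 : ENNReal.ofReal r ≠ 0 := by simpa using hr
  have hrt : ENNReal.ofReal r ≠ ⊤ := ENNReal.ofReal_ne_top
  have h1 : ∀ t, ‖v t - steklov v σ r t‖ₑ ^ 2 ≤
      (ENNReal.ofReal r)⁻¹ * ∫⁻ s in Ioo 0 r, ‖v (t + σ * s) - v t‖ₑ ^ 2 := by
    intro t
    have h0 : σ ≠ 0 := by rcases hσ with h | h <;> simp [h]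
    have hi : IntervalIntegrable (fun s => v (t + σ * s)) volume 0 r :=
      ((hv.comp_add_left t).comp_mul_left' h0).intervalIntegrable
    have e : v t - steklov v σ r t = -(1 / r * ∫ s in (0 : ℝ)..r, (v (t + σ * s) - v t)) := by
      rw [steklov_eq hσ, intervalIntegral.integral_sub hi (by simp)]
      simp
      field_simp
      ring
    rw [e, enorm_neg, enorm_mul, mul_pow]
    have e1 : ‖1 / r‖ₑ = (ENNReal.ofReal r)⁻¹ := by
      rw [Real.enorm_eq_ofReal (by positivity), one_div, ENNReal.ofReal_inv_of_pos hr]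
    have e2 : ‖∫ s in (0 : ℝ)..r, (v (t + σ * s) - v t)‖ₑ ^ 2 ≤
        ENNReal.ofReal r * ∫⁻ s in Ioo 0 r, ‖v (t + σ * s) - v t‖ₑ ^ 2 := by
      rw [intervalIntegral.integral_of_le hr.le, integral_Ioc_eq_integral_Ioo]
      calc _ ≤ (∫⁻ s in Ioo 0 r, ‖v (t + σ * s) - v t‖ₑ) ^ 2 := by
            gcongr; exact enorm_integral_le_lintegral_enorm _
        _ ≤ _ := by
            have := sq_lintegral_le (μ := volume.restrict (Ioo 0 r))
              (h := fun s => ‖v (t + σ * s) - v t‖ₑ) (by fun_prop)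
            simpa using this
    calc _ ≤ (ENNReal.ofReal r)⁻¹ ^ 2 * (ENNReal.ofReal r * _) := by
          rw [e1]; gcongr
      _ = _ := by
          rw [sq, ← mul_assoc, mul_assoc _ _ (ENNReal.ofReal r), ENNReal.inv_mul_cancel hr0 hrt,
            mul_one]
  calc _ ≤ ∫⁻ t, (ENNReal.ofReal r)⁻¹ * ∫⁻ s in Ioo 0 r, ‖v (t + σ * s) - v t‖ₑ ^ 2 :=
        lintegral_mono h1
    _ = (ENNReal.ofReal r)⁻¹ * ∫⁻ t, ∫⁻ s in Ioo 0 r, ‖v (t + σ * s) - v t‖ₑ ^ 2 := by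
        rw [lintegral_const_mul' _ _ (by simpa using hr)]
    _ = (ENNReal.ofReal r)⁻¹ * ∫⁻ s in Ioo 0 r, transl v s := by
        rw [lintegral_lintegral_swap (by fun_prop)]
        congr 1
        refine lintegral_congr fun s => ?_
        rcases hσ with h | h
        · subst h; simp [transl]
        · subst h; rw [← transl_neg]; simp [transl]

/-- The `K`-functional is controlled by the translation moduli, the Steklov average of the extension
by zero being the competitor: its forward average vanishes at `T`, and its backward average at
`0`. -/
theorem kFunctional_sq_le {T p σ r : ℝ} (hT : 0 < T) (hσ : σ = 1 ∧ p = T ∨ σ = -1 ∧ p = 0)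
    (hr : 0 < r) {v : ℝ → ℝ} (hm : Measurable v) (hv : Integrable v) (hv2 : MemLp v 2)
    (hsupp : ∀ s ∉ Ioo 0 T, v s = 0) {V : L2Time T ℝ} (hV : V =ᵐ[timeMeasure T] v) :
    kFunctional T p V r ^ 2 ≤
      2 * ((ENNReal.ofReal r)⁻¹ * ∫⁻ s in Ioo 0 r, transl v s) + 2 * transl v r := by
  have hσ' : σ = 1 ∨ σ = -1 := hσ.imp And.left And.left
  have hσσ : σ * σ = 1 := by rcases hσ' with h | h <;> simp [h]
  have hvr : MemLp (fun t => v (t + σ * r)) 2 volume :=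
    hv2.comp_measurePreserving (measurePreserving_add_right _ _)
  have hg : MemLp (fun t => σ / r * (v (t + σ * r) - v t)) 2 (timeMeasure T) :=
    ((hvr.sub hv2).const_mul _).restrict _
  have hfin : ∀ s, transl v s ≤ 4 * eLpNorm v 2 volume ^ 2 := by
    intro s
    have h1 : MemLp (fun t => v (t + s)) 2 volume :=
      hv2.comp_measurePreserving (measurePreserving_add_right _ _)
    have h2 : transl v s = eLpNorm (fun t => v (t + s) - v t) 2 volume ^ 2 := by
      have := enorm_toLp_sq (h1.sub hv2)
      rw [Lp.enorm_toLp] at this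
      exact this.symm
    have h3 : eLpNorm (fun t => v (t + s)) 2 volume = eLpNorm v 2 volume :=
      eLpNorm_comp_measurePreserving (f := fun t => t + s) hv2.1
        (measurePreserving_add_right _ _)
    rw [h2]
    calc _ ≤ (eLpNorm (fun t => v (t + s)) 2 volume + eLpNorm v 2 volume) ^ 2 := by
          gcongr; exact eLpNorm_sub_le h1.1 hv2.1 (by norm_num)
      _ = _ := by rw [h3]; ring
  have hd : MemLp (fun t => v t - steklov v σ r t) 2 volume := by
    refine ⟨(hm.sub (measurable_steklov hv σ r)).aestronglyMeasurable, ?_⟩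
    rw [eLpNorm_eq_lintegral_rpow_enorm_toReal (by norm_num) (by norm_num)]
    refine ENNReal.rpow_lt_top_of_nonneg (by norm_num) ?_
    simp only [ENNReal.toReal_ofNat, ENNReal.rpow_ofNat]
    refine ne_top_of_le_ne_top ?_ (lintegral_sub_steklov_le hm hv hσ' hr)
    refine ENNReal.mul_ne_top (by simpa using hr) ?_
    refine ne_top_of_le_ne_top ?_ (lintegral_mono fun s => hfin s)
    simp only [lintegral_const, MeasurableSet.univ, Measure.restrict_apply, univ_inter,
      Real.volume_Ioo]
    have := hv2.2
    finiteness
  have hw : MemLp (steklov v σ r) 2 (timeMeasure T) := by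
    have := (hv2.sub hd).restrict (Ioo 0 T)
    refine this.congr_norm (measurable_steklov hv σ r).aestronglyMeasurable (ae_of_all _ fun t => ?_)
    simp
  have hvan : IsH1Vanishing T p (hw.toLp _) (hg.toLp _) := by
    refine ⟨steklov v σ r, ?_, ?_, hw.coeFn_toLp⟩
    · intro t ht
      rw [steklov_sub hv]
      congr 1
      rw [intervalIntegral.integral_of_le ht.1, intervalIntegral.integral_of_le ht.1,
        integral_Ioc_eq_integral_Ioo, integral_Ioc_eq_integral_Ioo]
      refine integral_congr_ae ?_
      exact Filter.EventuallyEq.symm (ae_restrict_of_ae_restrict_of_subset (Ioo_subset_Ioo_right ht.2)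
        hg.coeFn_toLp)
    · rw [steklov, intervalIntegral.integral_zero_ae, mul_zero]
      refine ae_of_all _ fun s hs => hsupp s fun h => ?_
      rcases hσ with ⟨h1, h2⟩ | ⟨h1, h2⟩
      · subst h1 h2
        rw [uIoc_of_le (by linarith)] at hs
        exact absurd hs.1 (not_lt.2 h.2.le)
      · subst h1 h2
        rw [uIoc_of_ge (by linarith)] at hs
        exact absurd hs.2 (not_le.2 h.1)
  have hK : kFunctional T p V r ≤ ‖V - hw.toLp _‖ₑ + ENNReal.ofReal r * ‖hg.toLp _‖ₑ :=
    iInf_le_of_le _ (iInf_le_of_le _ (iInf_le _ hvan))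
  have e1 : ‖V - hw.toLp _‖ₑ ^ 2 ≤ (ENNReal.ofReal r)⁻¹ * ∫⁻ s in Ioo 0 r, transl v s := by
    have : V - hw.toLp _ = (hd.restrict (Ioo 0 T)).toLp _ := by
      refine Lp.ext ?_
      filter_upwards [Lp.coeFn_sub V (hw.toLp _), hV, hw.coeFn_toLp,
        (hd.restrict (Ioo 0 T)).coeFn_toLp] with t h1 h2 h3 h4
      rw [h1, h4, Pi.sub_apply, h2, h3]
    rw [this, enorm_toLp_sq]
    exact (lintegral_mono' Measure.restrict_le_self le_rfl).trans
      (lintegral_sub_steklov_le hm hv hσ' hr)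
  have e2 : (ENNReal.ofReal r * ‖hg.toLp _‖ₑ) ^ 2 ≤ transl v r := by
    rw [mul_pow, enorm_toLp_sq, ← lintegral_const_mul' _ _ (by finiteness)]
    refine (lintegral_mono' Measure.restrict_le_self le_rfl).trans (le_of_eq ?_)
    have : transl v r = transl v (σ * r) := by
      rcases hσ' with h | h
      · simp [h]
      · simp [h, transl_neg]
    rw [this]
    refine lintegral_congr fun t => ?_
    rw [← mul_pow, ← Real.enorm_eq_ofReal hr.le, ← enorm_mul]
    have : r * (σ / r * (v (t + σ * r) - v t)) = σ * (v (t + σ * r) - v t) := by field_simp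
    rw [this, enorm_mul]
    have : ‖σ‖ₑ = 1 := by rcases hσ' with h | h <;> simp [h]
    rw [this, one_mul]
  have key : ∀ a b : ℝ≥0∞, (a + b) ^ 2 ≤ 2 * a ^ 2 + 2 * b ^ 2 := fun a b => by
    have := ENNReal.rpow_add_le_mul_rpow_add_rpow a b (p := 2) (by norm_num)
    norm_num at this
    rwa [mul_add] at this
  calc _ ≤ (‖V - hw.toLp _‖ₑ + ENNReal.ofReal r * ‖hg.toLp _‖ₑ) ^ 2 := by gcongr
    _ ≤ _ := key _ _
    _ ≤ _ := by gcongr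

/-- The squared (homogeneous) Gagliardo norm `∫₀^∞ r^{-1-2s} ∫ |v(t + r) - v(t)|² dt dr`. -/
def gagliardo (s : ℝ) (v : ℝ → ℝ) : ℝ≥0∞ :=
  ∫⁻ r in Ioi (0 : ℝ), ENNReal.ofReal (r ^ (-(1 + 2 * s))) * transl v r

/-- The Gagliardo norm of the extension by zero dominates the interpolation norms for both boundary
conditions. -/
theorem fracNorm_sq_le {T p s : ℝ} (hT : 0 < T) (hp : p = T ∨ p = 0) (hs : 0 < s)
    {v : ℝ → ℝ} (hm : Measurable v) (hv : Integrable v) (hv2 : MemLp v 2)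
    (hsupp : ∀ s ∉ Ioo 0 T, v s = 0) {V : L2Time T ℝ} (hV : V =ᵐ[timeMeasure T] v) :
    fracNorm T p s V ^ 2 ≤ 4 * gagliardo s v := by
  obtain ⟨σ, hσ⟩ : ∃ σ : ℝ, σ = 1 ∧ p = T ∨ σ = -1 ∧ p = 0 := by
    rcases hp with h | h
    · exact ⟨1, Or.inl ⟨rfl, h⟩⟩
    · exact ⟨-1, Or.inr ⟨rfl, h⟩⟩
  have h0 : fracNorm T p s V ^ 2 = ∫⁻ r in Ioi (0 : ℝ),
      (ENNReal.ofReal (r ^ (-s)) * kFunctional T p V r) ^ 2 / ENNReal.ofReal r := by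
    rw [fracNorm, ← ENNReal.rpow_natCast, ← ENNReal.rpow_mul]; norm_num
  have hmt := measurable_transl hm
  rw [h0]
  calc _ ≤ ∫⁻ r in Ioi (0 : ℝ), (2 * (ENNReal.ofReal (r ^ (-(2 + 2 * s))) *
            ∫⁻ s in Ioo 0 r, transl v s) +
          2 * (ENNReal.ofReal (r ^ (-(1 + 2 * s))) * transl v r)) := by
        refine setLIntegral_mono' measurableSet_Ioi fun r hr => ?_
        have hr : 0 < r := hr
        have e1 : ENNReal.ofReal (r ^ (-s)) ^ 2 / ENNReal.ofReal r =
            ENNReal.ofReal (r ^ (-(1 + 2 * s))) := by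
          rw [← ENNReal.ofReal_pow (by positivity), ← ENNReal.ofReal_div_of_pos hr,
            ← Real.rpow_natCast, ← Real.rpow_mul hr.le, ← Real.rpow_sub_one hr.ne']
          congr 2; push_cast; ring
        have e2 : ENNReal.ofReal (r ^ (-(1 + 2 * s))) * (ENNReal.ofReal r)⁻¹ =
            ENNReal.ofReal (r ^ (-(2 + 2 * s))) := by
          rw [← ENNReal.ofReal_inv_of_pos hr, ← ENNReal.ofReal_mul (by positivity), ← div_eq_mul_inv,
            ← Real.rpow_sub_one hr.ne']
          congr 2; ring
        rw [mul_pow, ENNReal.mul_div_right_comm, e1]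
        calc _ ≤ ENNReal.ofReal (r ^ (-(1 + 2 * s))) * (2 * ((ENNReal.ofReal r)⁻¹ *
              ∫⁻ s in Ioo 0 r, transl v s) + 2 * transl v r) := by
              gcongr
              exact kFunctional_sq_le hT hσ hr hm hv hv2 hsupp hV
          _ = _ := by
              rw [← e2]; ring
    _ = 2 * (∫⁻ r in Ioi (0 : ℝ), ENNReal.ofReal (r ^ (-(2 + 2 * s))) *
            ∫⁻ s in Ioo 0 r, transl v s) + 2 * gagliardo s v := by
        rw [lintegral_add_right _ (by fun_prop), lintegral_const_mul' _ _ (by norm_num),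
          lintegral_const_mul' _ _ (by norm_num), gagliardo]
    _ ≤ 2 * gagliardo s v + 2 * gagliardo s v := by
        gcongr
        rw [lintegral_rpow_mul_lintegral_Ioo (by linarith) hmt]
        refine setLIntegral_mono' measurableSet_Ioi fun r hr => ?_
        have hr : 0 < r := hr
        gcongr
        rw [show 1 - (2 + 2 * s) = -(1 + 2 * s) by ring]
        exact div_le_self (by positivity) (by linarith)
    _ = _ := by ring

/-- A Hardy inequality. For `t < r` the translate `v (t - r)` vanishes, so that the modulus of
continuity at `r` is at least `∫₀ʳ v²`. -/
theorem lintegral_rpow_mul_sq_le {s : ℝ} (hs : 0 < s) {v : ℝ → ℝ} (hm : Measurable v)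
    (hsupp : ∀ t ≤ 0, v t = 0) :
    ∫⁻ t in Ioi (0 : ℝ), ENNReal.ofReal (t ^ (-(2 * s)) / (2 * s)) * ‖v t‖ₑ ^ 2 ≤
      gagliardo s v := by
  have := lintegral_rpow_mul_lintegral_Ioo (p := 1 + 2 * s) (by linarith)
    (h := fun t => ‖v t‖ₑ ^ 2) (by fun_prop)
  rw [show 1 - (1 + 2 * s) = -(2 * s) by ring, show 1 + 2 * s - 1 = 2 * s by ring] at this
  rw [← this, gagliardo]
  refine lintegral_mono fun r => ?_
  gcongr
  rw [← transl_neg, transl]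
  refine (setLIntegral_mono' measurableSet_Ioo fun t ht => ?_).trans
    (lintegral_mono' Measure.restrict_le_self le_rfl)
  rw [hsupp (t + -r) (by linarith [ht.2]), zero_sub, enorm_neg]

/-! ### The kernel of the fractional integral -/

/-- The kernel `t_+^{1-α} / Γ(2-α)` of the fractional integral of order `2 - α`. At `t ≤ 0` it
vanishes, since `0 ^ (1 - α) = 0` for `α ≠ 1`. -/
def rlKer (α x : ℝ) : ℝ := max x 0 ^ (1 - α) / Real.Gamma (2 - α)

/-- The primitive `t_+^{2-α} / Γ(3-α)` of `rlKer α`. -/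
def rlKerPrim (α x : ℝ) : ℝ := max x 0 ^ (2 - α) / Real.Gamma (3 - α)

theorem rlKer_of_nonpos {α x : ℝ} (hα : 1 < α) (hx : x ≤ 0) : rlKer α x = 0 := by
  rw [rlKer, max_eq_right hx, Real.zero_rpow (by linarith), zero_div]

theorem rlKer_of_pos {α x : ℝ} (hx : 0 < x) :
    rlKer α x = x ^ (1 - α) / Real.Gamma (2 - α) := by
  rw [rlKer, max_eq_left hx.le]

theorem rlKer_nonneg {α : ℝ} (hα : α < 2) (x : ℝ) : 0 ≤ rlKer α x :=
  div_nonneg (Real.rpow_nonneg (le_max_right _ _) _) (Real.Gamma_nonneg_of_nonneg (by linarith))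

theorem rlKerPrim_of_nonpos {α x : ℝ} (hα : α < 2) (hx : x ≤ 0) : rlKerPrim α x = 0 := by
  rw [rlKerPrim, max_eq_right hx, Real.zero_rpow (by linarith), zero_div]

theorem rlKerPrim_pos {α x : ℝ} (hα : α < 2) (hx : 0 < x) : 0 < rlKerPrim α x := by
  rw [rlKerPrim, max_eq_left hx.le]
  exact div_pos (Real.rpow_pos_of_pos hx _) (Real.Gamma_pos_of_pos (by linarith))

theorem Gamma_three_sub {α : ℝ} (hα : α < 2) :
    Real.Gamma (3 - α) = (2 - α) * Real.Gamma (2 - α) := by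
  rw [show 3 - α = (2 - α) + 1 by ring, Real.Gamma_add_one (by linarith)]

theorem continuous_rlKerPrim {α : ℝ} (hα : α < 2) : Continuous (rlKerPrim α) := by
  unfold rlKerPrim
  refine Continuous.div_const ?_ _
  exact (continuous_id.max continuous_const).rpow_const fun x => Or.inr (by linarith)

theorem measurable_rlKer (α : ℝ) : Measurable (rlKer α) := by
  unfold rlKer
  fun_prop

theorem hasDerivAt_rlKerPrim {α x : ℝ} (hα₁ : 1 < α) (hα₂ : α < 2) (hx : x ≠ 0) :
    HasDerivAt (rlKerPrim α) (rlKer α x) x := by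
  rcases lt_or_gt_of_ne hx with h | h
  · rw [rlKer_of_nonpos hα₁ h.le]
    refine (hasDerivAt_const x (0 : ℝ)).congr_of_eventuallyEq ?_
    filter_upwards [Iio_mem_nhds h] with y hy
    exact rlKerPrim_of_nonpos hα₂ (le_of_lt hy)
  · rw [rlKer_of_pos h]
    have h1 : HasDerivAt (fun y : ℝ => y ^ (2 - α) / Real.Gamma (3 - α))
        ((2 - α) * x ^ (2 - α - 1) / Real.Gamma (3 - α)) x :=
      (Real.hasDerivAt_rpow_const (Or.inl hx)).div_const _
    have h2 : (2 - α) * x ^ (2 - α - 1) / Real.Gamma (3 - α) =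
        x ^ (1 - α) / Real.Gamma (2 - α) := by
      rw [Gamma_three_sub hα₂, mul_div_mul_left _ _ (by linarith)]
      congr 2; ring
    rw [← h2]
    refine h1.congr_of_eventuallyEq ?_
    filter_upwards [Ioi_mem_nhds h] with y hy
    rw [rlKerPrim, max_eq_left (le_of_lt hy)]

theorem intervalIntegrable_rlKer {α : ℝ} (hα₁ : 1 < α) (hα₂ : α < 2) (a b : ℝ) :
    IntervalIntegrable (rlKer α) volume a b := by
  have h : IntervalIntegrable (fun x : ℝ => (Ioi (0 : ℝ)).indicator
      (fun x => x ^ (1 - α) / Real.Gamma (2 - α)) x) volume a b := by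
    have h1 : IntervalIntegrable (fun x : ℝ => x ^ (1 - α) / Real.Gamma (2 - α)) volume a b :=
      (intervalIntegral.intervalIntegrable_rpow' (by linarith)).div_const _
    exact ⟨h1.1.indicator measurableSet_Ioi, h1.2.indicator measurableSet_Ioi⟩
  convert h using 2 with x
  rcases le_or_gt x 0 with hx | hx
  · rw [rlKer_of_nonpos hα₁ hx, indicator_of_notMem (by simpa using hx)]
  · rw [rlKer_of_pos hx, indicator_of_mem (by simpa using hx)]

theorem intervalIntegrable_rlKer_sub {α : ℝ} (hα₁ : 1 < α) (hα₂ : α < 2) (c a b : ℝ) :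
    IntervalIntegrable (fun s => rlKer α (s - c)) volume a b := by
  simpa using (intervalIntegrable_rlKer hα₁ hα₂ (a - c) (b - c)).comp_sub_right c

theorem integral_rlKer {α : ℝ} (hα₁ : 1 < α) (hα₂ : α < 2) (a b : ℝ) :
    ∫ s in a..b, rlKer α s = rlKerPrim α b - rlKerPrim α a :=
  integral_eq_of_hasDerivAt_off_countable _ _ (countable_singleton (0 : ℝ))
    (continuous_rlKerPrim hα₂).continuousOn
    (fun _ hx => hasDerivAt_rlKerPrim hα₁ hα₂ hx.2) (intervalIntegrable_rlKer hα₁ hα₂ a b)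

theorem integral_rlKer_sub {α : ℝ} (hα₁ : 1 < α) (hα₂ : α < 2) (a b c : ℝ) :
    ∫ s in a..b, rlKer α (s - c) = rlKerPrim α (b - c) - rlKerPrim α (a - c) := by
  rw [intervalIntegral.integral_comp_sub_right (fun s => rlKer α s), integral_rlKer hα₁ hα₂]

/-- `rlKerPrim α` is a superposition of the truncations `r ↦ min x_+ r = x_+ - (x - r)_+`. -/
theorem integral_rpow_mul_posPart {α : ℝ} (hα₁ : 1 < α) (hα₂ : α < 2) (x : ℝ) :
    IntegrableOn (fun r => r ^ (-α) * (max x 0 - max (x - r) 0)) (Ioi 0) ∧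
    ∫ r in Ioi (0 : ℝ), r ^ (-α) * (max x 0 - max (x - r) 0) =
      Real.Gamma (2 - α) / (α - 1) * rlKerPrim α x := by
  rcases le_or_gt x 0 with hx | hx
  · have h : ∀ r ∈ Ioi (0 : ℝ), r ^ (-α) * (max x 0 - max (x - r) 0) = 0 := by
      intro r hr
      rw [max_eq_right hx, max_eq_right (by linarith [mem_Ioi.1 hr]), sub_zero, mul_zero]
    refine ⟨(integrableOn_congr_fun h measurableSet_Ioi).2 (by simp), ?_⟩
    rw [setIntegral_congr_fun measurableSet_Ioi h, rlKerPrim_of_nonpos hα₂ hx]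
    simp
  · have h1 : ∀ r ∈ Ioc 0 x, r ^ (-α) * (max x 0 - max (x - r) 0) = r ^ (1 - α) := by
      intro r hr
      rw [max_eq_left hx.le, max_eq_left (by linarith [hr.2]), sub_sub_cancel,
        ← Real.rpow_add_one hr.1.ne']
      congr 1; ring
    have h2 : ∀ r ∈ Ioi x, r ^ (-α) * (max x 0 - max (x - r) 0) = x * r ^ (-α) := by
      intro r hr
      rw [max_eq_left hx.le, max_eq_right (by linarith [mem_Ioi.1 hr])]
      ring
    have i1 : IntegrableOn (fun r => r ^ (-α) * (max x 0 - max (x - r) 0)) (Ioc 0 x) := by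
      refine (integrableOn_congr_fun h1 measurableSet_Ioc).2 ?_
      exact (intervalIntegral.intervalIntegrable_rpow' (by linarith)).1
    have i2 : IntegrableOn (fun r => r ^ (-α) * (max x 0 - max (x - r) 0)) (Ioi x) := by
      refine (integrableOn_congr_fun h2 measurableSet_Ioi).2 ?_
      exact (integrableOn_Ioi_rpow_of_lt (by linarith) hx).const_mul _
    rw [← Ioc_union_Ioi_eq_Ioi hx.le]
    refine ⟨i1.union i2, ?_⟩
    rw [setIntegral_union (by simp) measurableSet_Ioi i1 i2,
      setIntegral_congr_fun measurableSet_Ioc h1, setIntegral_congr_fun measurableSet_Ioi h2,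
      integral_const_mul, integral_Ioi_rpow_of_lt (by linarith) hx,
      ← intervalIntegral.integral_of_le hx.le, integral_rpow (Or.inl (by linarith)),
      rlKerPrim, max_eq_left hx.le, Gamma_three_sub hα₂, Real.zero_rpow (by linarith),
      show 1 - α + 1 = 2 - α by ring]
    have e : x ^ (2 - α) = x * x ^ (-α + 1) := by
      rw [mul_comm, ← Real.rpow_add_one hx.ne']; congr 1; ring
    have hG : Real.Gamma (2 - α) ≠ 0 := (Real.Gamma_pos_of_pos (by linarith)).ne'
    have a1 : (2 - α) ≠ 0 := by linarith
    have a2 : (α - 1) ≠ 0 := by linarith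
    have a3 : (-α + 1) ≠ 0 := by linarith
    rw [e]
    field_simp
    ring

/-! ### Step functions -/

/-- The step function with value `a j` on the `j`-th interval of the partition `t`, and zero
elsewhere. -/
def stepFun {X : Type} [AddCommGroup X] {J : ℕ} (t : Fin (J + 1) → ℝ) (a : Fin J → X) (s : ℝ) : X :=
  ∑ j, (Ioo (t j.castSucc) (t j.succ)).indicator (fun _ => a j) s

/-- The length of the intersection of `(a, b)` and `(c, d)` is a second difference of the positive
part. -/
theorem integral_indicator_mul_indicator {a b c d : ℝ} (hab : a ≤ b) (hcd : c ≤ d) :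
    Integrable (fun s => (Ioo a b).indicator (fun _ => (1 : ℝ)) s *
      (Ioo c d).indicator (fun _ => (1 : ℝ)) s) ∧
    ∫ s, (Ioo a b).indicator (fun _ => (1 : ℝ)) s * (Ioo c d).indicator (fun _ => (1 : ℝ)) s =
      max (b - c) 0 - max (b - d) 0 - max (a - c) 0 + max (a - d) 0 := by
  have h : (fun s => (Ioo a b).indicator (fun _ => (1 : ℝ)) s *
      (Ioo c d).indicator (fun _ => (1 : ℝ)) s) =
      (Ioo (max a c) (min b d)).indicator (fun _ => (1 : ℝ)) := by
    ext s
    rw [← Ioo_inter_Ioo]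
    simp only [indicator_apply, mem_inter_iff]
    split_ifs <;> simp_all
  rw [h]
  constructor
  · exact (integrable_indicator_iff measurableSet_Ioo).2 (by simp)
  · rw [integral_indicator measurableSet_Ioo]
    simp only [integral_const, MeasurableSet.univ, measureReal_restrict_apply, univ_inter,
      Real.volume_real_Ioo, smul_eq_mul, mul_one]
    grind

/-- The matrix `∫_{I_i} D_{0+}^{α-1} χ_{I_j}` of the fractional derivative in the basis of the
indicator functions of the intervals of a partition. -/
def stepMat (α : ℝ) {J : ℕ} (t : Fin (J + 1) → ℝ) (i j : Fin J) : ℝ :=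
  rlKerPrim α (t i.succ - t j.castSucc) - rlKerPrim α (t i.succ - t j.succ) -
    rlKerPrim α (t i.castSucc - t j.castSucc) + rlKerPrim α (t i.castSucc - t j.succ)

/-- The quadratic form `∫ (D_{0+}^{α-1} w) w` on step functions `w`. -/
def stepForm (α : ℝ) {J : ℕ} (t : Fin (J + 1) → ℝ) (b : Fin J → ℝ) : ℝ :=
  ∑ i, ∑ j, stepMat α t i j * (b j * b i)

/-- Causality: a step function has no influence on its fractional derivative at earlier times. -/
theorem stepMat_eq_zero {α : ℝ} (hα : α < 2) {J : ℕ} {t : Fin (J + 1) → ℝ} (ht : Monotone t)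
    {i j : Fin J} (hij : i < j) : stepMat α t i j = 0 := by
  have h1 : t i.succ ≤ t j.castSucc := ht (by
    rw [Fin.le_def]; simpa using hij)
  have h2 : t i.castSucc ≤ t i.succ := ht (Fin.castSucc_lt_succ).le
  have h3 : t j.castSucc ≤ t j.succ := ht (Fin.castSucc_lt_succ).le
  rw [stepMat, rlKerPrim_of_nonpos hα (by linarith), rlKerPrim_of_nonpos hα (by linarith),
    rlKerPrim_of_nonpos hα (by linarith), rlKerPrim_of_nonpos hα (by linarith)]
  simp

theorem stepFun_apply_of_mem {X : Type} [AddCommGroup X] {J : ℕ} {t : Fin (J + 1) → ℝ}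
    (ht : Monotone t) (a : Fin J → X) {i : Fin J} {s : ℝ} (hs : s ∈ Ioo (t i.castSucc) (t i.succ)) :
    stepFun t a s = a i := by
  rw [stepFun, Finset.sum_eq_single i, indicator_of_mem hs]
  · intro j _ hj
    refine indicator_of_notMem (fun h => ?_) _
    rcases lt_or_gt_of_ne hj with h' | h'
    · have : t j.succ ≤ t i.castSucc := ht (by rw [Fin.le_def]; simpa using h')
      linarith [h.2, hs.1]
    · have : t i.succ ≤ t j.castSucc := ht (by rw [Fin.le_def]; simpa using h')
      linarith [h.1, hs.2]
  · simp

theorem stepFun_apply_of_notMem {X : Type} [AddCommGroup X] {T : ℝ} {J : ℕ} {t : Fin (J + 1) → ℝ}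
    (ht : IsPartition T t) (a : Fin J → X) {s : ℝ} (hs : s ∉ Ioo 0 T) :
    stepFun t a s = 0 := by
  refine Finset.sum_eq_zero fun j _ => indicator_of_notMem (fun h => hs ⟨?_, ?_⟩) _
  · refine lt_of_le_of_lt ?_ h.1
    rw [← ht.2.1]; exact ht.1.monotone (Fin.zero_le _)
  · refine lt_of_lt_of_le h.2 ?_
    rw [← ht.2.2]; exact ht.1.monotone (Fin.le_last _)

theorem memLp_stepFun {X : Type} [NormedAddCommGroup X] {J : ℕ} (t : Fin (J + 1) → ℝ)
    (a : Fin J → X) (p : ℝ≥0∞) : MemLp (stepFun t a) p volume := by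
  unfold stepFun
  refine memLp_finsetSum _ fun j _ => ?_
  exact memLp_indicator_const p measurableSet_Ioo (a j) (Or.inr (by simp))

theorem measurable_stepFun {J : ℕ} (t : Fin (J + 1) → ℝ) (b : Fin J → ℝ) :
    Measurable (stepFun t b) := by
  unfold stepFun
  exact Finset.measurable_fun_sum _ fun j _ => measurable_const.indicator measurableSet_Ioo

theorem integrable_stepFun {X : Type} [NormedAddCommGroup X] {J : ℕ} (t : Fin (J + 1) → ℝ)
    (a : Fin J → X) : Integrable (stepFun t a) :=
  memLp_one_iff_integrable.1 (memLp_stepFun t a 1)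

theorem integral_sub_sub_add {μ : Measure ℝ} {f g h k : ℝ → ℝ} (hf : Integrable f μ)
    (hg : Integrable g μ) (hh : Integrable h μ) (hk : Integrable k μ) :
    ∫ s, (f s - g s - h s + k s) ∂μ =
      ∫ s, f s ∂μ - ∫ s, g s ∂μ - ∫ s, h s ∂μ + ∫ s, k s ∂μ := by
  have h1 : Integrable (fun s => f s - g s) μ := hf.sub hg
  have h2 : Integrable (fun s => f s - g s - h s) μ := h1.sub hh
  rw [integral_add h2 hk, integral_sub h1 hh, integral_sub hf hg]

/-- The modulus of continuity of a step function, in terms of the truncated positive parts. -/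
theorem transl_stepFun {J : ℕ} {t : Fin (J + 1) → ℝ} (ht : Monotone t) (b : Fin J → ℝ) {r : ℝ} :
    let m := fun x => max x 0 - max (x - r) 0
    0 ≤ ∑ i, ∑ j, (m (t i.succ - t j.castSucc) - m (t i.succ - t j.succ) -
      m (t i.castSucc - t j.castSucc) + m (t i.castSucc - t j.succ)) * (b j * b i) ∧
    transl (stepFun t b) r = ENNReal.ofReal (2 * ∑ i, ∑ j,
      (m (t i.succ - t j.castSucc) - m (t i.succ - t j.succ) -
      m (t i.castSucc - t j.castSucc) + m (t i.castSucc - t j.succ)) * (b j * b i)) := by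
  intro m
  have hle : ∀ j : Fin J, t j.castSucc ≤ t j.succ := fun j => ht (Fin.castSucc_lt_succ).le
  set χ : Fin J → ℝ → ℝ → ℝ := fun j q s =>
    (Ioo (t j.castSucc - q) (t j.succ - q)).indicator (fun _ => (1 : ℝ)) s with hχ
  have hw : ∀ q s, stepFun t b (s + q) = ∑ j, χ j q s * b j := by
    intro q s
    refine Finset.sum_congr rfl fun j _ => ?_
    simp only [hχ, indicator_apply, mem_Ioo, sub_lt_iff_lt_add, lt_sub_iff_add_lt]
    split_ifs <;> simp
  have hO : ∀ q q' i j, Integrable (fun s => χ i q s * χ j q' s) ∧ ∫ s, χ i q s * χ j q' s =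
      max (t i.succ - t j.castSucc - (q - q')) 0 - max (t i.succ - t j.succ - (q - q')) 0 -
      max (t i.castSucc - t j.castSucc - (q - q')) 0 +
      max (t i.castSucc - t j.succ - (q - q')) 0 := by
    intro q q' i j
    have := integral_indicator_mul_indicator (a := t i.castSucc - q) (b := t i.succ - q)
      (c := t j.castSucc - q') (d := t j.succ - q') (by linarith [hle i]) (by linarith [hle j])
    refine ⟨this.1, this.2.trans ?_⟩
    have hx : ∀ x y, x - q - (y - q') = x - y - (q - q') := fun x y => by ring
    rw [hx, hx, hx, hx]
  -- the correlation of `w(· + q)` and `w(· + q')`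
  have hR : ∀ q q', Integrable (fun s => stepFun t b (s + q) * stepFun t b (s + q')) ∧
      ∫ s, stepFun t b (s + q) * stepFun t b (s + q') =
      ∑ i, ∑ j, (∫ s, χ i q s * χ j q' s) * (b j * b i) := by
    intro q q'
    have e : (fun s => stepFun t b (s + q) * stepFun t b (s + q')) =
        fun s => ∑ i, ∑ j, (χ i q s * χ j q' s) * (b j * b i) := by
      ext s
      rw [hw, hw, Finset.sum_mul_sum]
      exact Finset.sum_congr rfl fun i _ => Finset.sum_congr rfl fun j _ => by ring
    have hi : ∀ i j, Integrable (fun s => (χ i q s * χ j q' s) * (b j * b i)) :=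
      fun i j => (hO q q' i j).1.mul_const _
    rw [e]
    refine ⟨integrable_finsetSum _ fun i _ => integrable_finsetSum _ fun j _ => hi i j, ?_⟩
    rw [integral_finsetSum _ fun i _ => integrable_finsetSum _ fun j _ => hi i j]
    refine Finset.sum_congr rfl fun i _ => ?_
    rw [integral_finsetSum _ fun j _ => hi i j]
    exact Finset.sum_congr rfl fun j _ => integral_mul_const _ _
  have e1 : (fun s => (stepFun t b (s + r) - stepFun t b s) ^ 2) = fun s =>
      stepFun t b (s + r) * stepFun t b (s + r) - 2 * (stepFun t b (s + r) * stepFun t b (s + 0)) +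
        stepFun t b (s + 0) * stepFun t b (s + 0) := by
    ext s; rw [add_zero]; ring
  have i1 : Integrable (fun s => (stepFun t b (s + r) - stepFun t b s) ^ 2) := by
    rw [e1]
    exact ((hR r r).1.sub ((hR r 0).1.const_mul 2)).add (hR 0 0).1
  have e2 : ∫ s, (stepFun t b (s + r) - stepFun t b s) ^ 2 = 2 * ∑ i, ∑ j,
      (m (t i.succ - t j.castSucc) - m (t i.succ - t j.succ) -
      m (t i.castSucc - t j.castSucc) + m (t i.castSucc - t j.succ)) * (b j * b i) := by
    have h3 := integral_sub_sub_add (hR r r).1 ((hR r 0).1.const_mul 2) (integrable_zero _ _ _)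
      (hR 0 0).1
    simp only [sub_zero, integral_zero, Pi.zero_apply] at h3
    rw [e1, h3, integral_const_mul, (hR _ _).2, (hR _ _).2, (hR _ _).2]
    simp only [Finset.mul_sum, ← Finset.sum_sub_distrib, ← Finset.sum_add_distrib]
    refine Finset.sum_congr rfl fun i _ => Finset.sum_congr rfl fun j _ => ?_
    rw [(hO _ _ _ _).2, (hO _ _ _ _).2, (hO _ _ _ _).2]
    simp only [sub_self, sub_zero, m]
    ring
  have h0 : 0 ≤ ∫ s, (stepFun t b (s + r) - stepFun t b s) ^ 2 :=
    integral_nonneg fun s => sq_nonneg _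
  refine ⟨by linarith [e2 ▸ h0], ?_⟩
  rw [← e2, ofReal_integral_eq_lintegral_ofReal i1 (ae_of_all _ fun s => sq_nonneg _), transl]
  refine lintegral_congr fun s => ?_
  rw [← sq_abs, ENNReal.ofReal_pow (abs_nonneg _), Real.enorm_eq_ofReal_abs]

/-- On step functions, the energy `∫ (D_{0+}^{α-1} w) w` is a multiple of the squared Gagliardo
norm of the extension of `w` by zero. -/
theorem gagliardo_stepFun {α : ℝ} (hα₁ : 1 < α) (hα₂ : α < 2) {J : ℕ} {t : Fin (J + 1) → ℝ}
    (ht : Monotone t) (b : Fin J → ℝ) :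
    0 ≤ stepForm α t b ∧ gagliardo ((α - 1) / 2) (stepFun t b) =
      ENNReal.ofReal (2 * (Real.Gamma (2 - α) / (α - 1)) * stepForm α t b) := by
  set m : ℝ → ℝ → ℝ := fun r x => max x 0 - max (x - r) 0 with hm
  set S : ℝ → ℝ := fun r => ∑ i, ∑ j,
      (m r (t i.succ - t j.castSucc) - m r (t i.succ - t j.succ) -
      m r (t i.castSucc - t j.castSucc) + m r (t i.castSucc - t j.succ)) * (b j * b i) with hS
  have hc : 0 < Real.Gamma (2 - α) / (α - 1) :=
    div_pos (Real.Gamma_pos_of_pos (by linarith)) (by linarith)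
  have hSr : (fun r => r ^ (-α) * S r) = fun r => ∑ i, ∑ j,
      (r ^ (-α) * m r (t i.succ - t j.castSucc) - r ^ (-α) * m r (t i.succ - t j.succ) -
      r ^ (-α) * m r (t i.castSucc - t j.castSucc) + r ^ (-α) * m r (t i.castSucc - t j.succ)) *
        (b j * b i) := by
    ext r
    simp only [hS, Finset.mul_sum]
    exact Finset.sum_congr rfl fun i _ => Finset.sum_congr rfl fun j _ => by ring
  have hI := integral_rpow_mul_posPart hα₁ hα₂
  have hij : ∀ i j : Fin J, IntegrableOn (fun r => (r ^ (-α) * m r (t i.succ - t j.castSucc) -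
      r ^ (-α) * m r (t i.succ - t j.succ) -
      r ^ (-α) * m r (t i.castSucc - t j.castSucc) + r ^ (-α) * m r (t i.castSucc - t j.succ)) *
        (b j * b i)) (Ioi 0) := fun i j =>
    ((((hI _).1.sub (hI _).1).sub (hI _).1).add (hI _).1).mul_const _
  have hint : IntegrableOn (fun r => r ^ (-α) * S r) (Ioi 0) := by
    rw [hSr]
    exact integrable_finsetSum _ fun i _ => integrable_finsetSum _ fun j _ => hij i j
  have hval : ∫ r in Ioi (0 : ℝ), r ^ (-α) * S r =
      Real.Gamma (2 - α) / (α - 1) * stepForm α t b := by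
    rw [hSr, integral_finsetSum _ fun i _ => integrable_finsetSum _ fun j _ => hij i j, stepForm,
      Finset.mul_sum]
    refine Finset.sum_congr rfl fun i _ => ?_
    rw [integral_finsetSum _ fun j _ => hij i j, Finset.mul_sum]
    refine Finset.sum_congr rfl fun j _ => ?_
    rw [integral_mul_const, integral_sub_sub_add (hI _).1 (hI _).1 (hI _).1 (hI _).1,
      (hI _).2, (hI _).2, (hI _).2, (hI _).2, stepMat]
    ring
  have hnn : ∀ r ∈ Ioi (0 : ℝ), 0 ≤ r ^ (-α) * S r := fun r hr =>
    mul_nonneg (Real.rpow_nonneg (le_of_lt hr) _) (transl_stepFun ht b).1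
  constructor
  · have : 0 ≤ ∫ r in Ioi (0 : ℝ), r ^ (-α) * S r := setIntegral_nonneg measurableSet_Ioi hnn
    rw [hval] at this
    exact nonneg_of_mul_nonneg_right this hc
  · have h1 : gagliardo ((α - 1) / 2) (stepFun t b) =
        ∫⁻ r in Ioi (0 : ℝ), ENNReal.ofReal (2 * (r ^ (-α) * S r)) := by
      refine setLIntegral_congr_fun measurableSet_Ioi fun r hr => ?_
      rw [(transl_stepFun ht b).2, ← ENNReal.ofReal_mul (Real.rpow_nonneg (le_of_lt hr) _)]
      congr 1
      rw [show -(1 + 2 * ((α - 1) / 2)) = -α by ring]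
      ring
    rw [h1, ← ofReal_integral_eq_lintegral_ofReal (hint.const_mul 2), integral_const_mul, hval]
    · congr 1; ring
    · filter_upwards [ae_restrict_mem measurableSet_Ioi] with r hr
      exact mul_nonneg (by norm_num) (hnn r hr)

theorem integral_smul_stepFun {X : Type} [NormedAddCommGroup X] [NormedSpace ℝ X] [CompleteSpace X]
    {T : ℝ} {J : ℕ} {t : Fin (J + 1) → ℝ} (ht : IsPartition T t) (a : Fin J → X) {k : ℝ → ℝ}
    (hk : IntegrableOn k (Ioo 0 T)) :
    ∫ s in Ioo 0 T, k s • stepFun t a s =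
      ∑ j, (∫ s in (t j.castSucc)..(t j.succ), k s) • a j := by
  have hle : ∀ j : Fin J, t j.castSucc ≤ t j.succ :=
    fun j => ht.1.monotone (Fin.castSucc_lt_succ).le
  have hsub : ∀ j : Fin J, Ioo (t j.castSucc) (t j.succ) ⊆ Ioo 0 T := by
    intro j
    rw [← ht.2.1, ← ht.2.2]
    exact Ioo_subset_Ioo (ht.1.monotone (Fin.zero_le _)) (ht.1.monotone (Fin.le_last _))
  have e : ∀ j s, k s • (Ioo (t j.castSucc) (t j.succ)).indicator (fun _ => a j) s =
      (Ioo (t j.castSucc) (t j.succ)).indicator (fun s => k s • a j) s := by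
    intro j s
    by_cases h : s ∈ Ioo (t j.castSucc) (t j.succ)
    · rw [indicator_of_mem h, indicator_of_mem h]
    · rw [indicator_of_notMem h, indicator_of_notMem h, smul_zero]
  simp only [stepFun, Finset.smul_sum, e]
  rw [integral_finsetSum _ fun j _ => ?_]
  · refine Finset.sum_congr rfl fun j _ => ?_
    rw [integral_indicator measurableSet_Ioo, Measure.restrict_restrict measurableSet_Ioo,
      inter_eq_self_of_subset_left (hsub j), integral_smul_const,
      intervalIntegral.integral_of_le (hle j), integral_Ioc_eq_integral_Ioo]
  · refine Integrable.indicator ?_ measurableSet_Ioo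
    exact Integrable.smul_const hk _

/-- A Hardy inequality for the weight `rlKer α` on step functions. -/
theorem sq_sum_rlKerPrim_le {α T : ℝ} (hα₁ : 1 < α) (hα₂ : α < 2) (hT : 0 < T) {J : ℕ}
    {t : Fin (J + 1) → ℝ} (ht : IsPartition T t) (b : Fin J → ℝ) :
    (∑ j, (rlKerPrim α (t j.succ) - rlKerPrim α (t j.castSucc)) * b j) ^ 2 ≤
      2 * rlKerPrim α T * stepForm α t b := by
  have hG : 0 < Real.Gamma (2 - α) := Real.Gamma_pos_of_pos (by linarith)
  have hk : IntegrableOn (rlKer α) (Ioo 0 T) :=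
    (intervalIntegrable_rlKer hα₁ hα₂ 0 T).1.mono_set Ioo_subset_Ioc_self
  have h1 : ∑ j, (rlKerPrim α (t j.succ) - rlKerPrim α (t j.castSucc)) * b j =
      ∫ s in Ioo 0 T, rlKer α s * stepFun t b s := by
    have := integral_smul_stepFun ht b hk
    simp only [smul_eq_mul, integral_rlKer hα₁ hα₂] at this
    exact this.symm
  -- Cauchy–Schwarz with respect to the measure `rlKer α s ds`
  set μ : Measure ℝ := (volume.restrict (Ioo 0 T)).withDensity fun s => ENNReal.ofReal (rlKer α s)
  have hkm : Measurable fun s => ENNReal.ofReal (rlKer α s) :=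
    (measurable_rlKer α).ennreal_ofReal
  have hwm := measurable_stepFun t b
  have h2 : ‖∫ s in Ioo 0 T, rlKer α s * stepFun t b s‖ₑ ≤ ∫⁻ s, ‖stepFun t b s‖ₑ ∂μ := by
    refine (enorm_integral_le_lintegral_enorm _).trans (le_of_eq ?_)
    rw [lintegral_withDensity_eq_lintegral_mul _ hkm (by fun_prop)]
    refine lintegral_congr fun s => ?_
    rw [enorm_mul, Real.enorm_eq_ofReal (rlKer_nonneg hα₂ s)]
    rfl
  have h3 : μ univ = ENNReal.ofReal (rlKerPrim α T) := by
    rw [withDensity_apply _ MeasurableSet.univ, Measure.restrict_univ,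
      ← ofReal_integral_eq_lintegral_ofReal hk (ae_of_all _ fun s => rlKer_nonneg hα₂ s),
      ← integral_Ioc_eq_integral_Ioo, ← intervalIntegral.integral_of_le hT.le,
      integral_rlKer hα₁ hα₂, rlKerPrim_of_nonpos hα₂ le_rfl, sub_zero]
  have h4 : ∫⁻ s, ‖stepFun t b s‖ₑ ^ 2 ∂μ ≤ ENNReal.ofReal (2 * stepForm α t b) := by
    have hh := lintegral_rpow_mul_sq_le (s := (α - 1) / 2) (by linarith) hwm
      (fun s hs => stepFun_apply_of_notMem ht b fun h => absurd h.1 (not_lt.2 hs))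
    rw [(gagliardo_stepFun hα₁ hα₂ ht.1.monotone b).2] at hh
    have hc : 0 < (α - 1) / Real.Gamma (2 - α) := div_pos (by linarith) hG
    calc ∫⁻ s, ‖stepFun t b s‖ₑ ^ 2 ∂μ
        = ∫⁻ s in Ioo 0 T, ENNReal.ofReal (rlKer α s) * ‖stepFun t b s‖ₑ ^ 2 := by
          rw [lintegral_withDensity_eq_lintegral_mul _ hkm (by fun_prop)]
          rfl
      _ ≤ ∫⁻ s in Ioi 0, ENNReal.ofReal (rlKer α s) * ‖stepFun t b s‖ₑ ^ 2 :=
          lintegral_mono_set Ioo_subset_Ioi_self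
      _ = ∫⁻ s in Ioi 0, ENNReal.ofReal ((α - 1) / Real.Gamma (2 - α)) *
            (ENNReal.ofReal (s ^ (-(2 * ((α - 1) / 2))) / (2 * ((α - 1) / 2))) *
              ‖stepFun t b s‖ₑ ^ 2) := by
          refine setLIntegral_congr_fun measurableSet_Ioi fun s hs => ?_
          have hs : 0 < s := hs
          rw [← mul_assoc, ← ENNReal.ofReal_mul hc.le, rlKer_of_pos hs]
          congr 2
          rw [show -(2 * ((α - 1) / 2)) = 1 - α by ring, show 2 * ((α - 1) / 2) = α - 1 by ring]
          have : α - 1 ≠ 0 := by linarith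
          field_simp
      _ ≤ ENNReal.ofReal ((α - 1) / Real.Gamma (2 - α)) *
            ENNReal.ofReal (2 * (Real.Gamma (2 - α) / (α - 1)) * stepForm α t b) := by
          rw [lintegral_const_mul' _ _ ENNReal.ofReal_ne_top]
          gcongr
      _ = _ := by
          rw [← ENNReal.ofReal_mul hc.le]
          congr 1
          have : α - 1 ≠ 0 := by linarith
          field_simp
  have hS := (gagliardo_stepFun hα₁ hα₂ ht.1.monotone b).1
  have hP := (rlKerPrim_pos hα₂ hT).le
  have h5 : ‖∫ s in Ioo 0 T, rlKer α s * stepFun t b s‖ₑ ^ 2 ≤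
      ENNReal.ofReal (2 * rlKerPrim α T * stepForm α t b) := by
    calc _ ≤ (∫⁻ s, ‖stepFun t b s‖ₑ ∂μ) ^ 2 := by gcongr
      _ ≤ μ univ * ∫⁻ s, ‖stepFun t b s‖ₑ ^ 2 ∂μ := sq_lintegral_le (by fun_prop)
      _ ≤ ENNReal.ofReal (rlKerPrim α T) * ENNReal.ofReal (2 * stepForm α t b) := by
          rw [h3]; gcongr
      _ = _ := by rw [← ENNReal.ofReal_mul hP]; congr 1; ring
  rw [h1]
  rw [Real.enorm_eq_ofReal_abs, ← ENNReal.ofReal_pow (abs_nonneg _), sq_abs] at h5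
  exact (ENNReal.ofReal_le_ofReal_iff (by positivity)).1 h5

theorem fracNorm_stepFun_sq_le {α T p : ℝ} (hα₁ : 1 < α) (hα₂ : α < 2) (hT : 0 < T)
    (hp : p = T ∨ p = 0) {J : ℕ} {t : Fin (J + 1) → ℝ} (ht : IsPartition T t) (b : Fin J → ℝ)
    {V : L2Time T ℝ} (hV : V =ᵐ[timeMeasure T] stepFun t b) :
    fracNorm T p ((α - 1) / 2) V ^ 2 ≤
      ENNReal.ofReal (8 * (Real.Gamma (2 - α) / (α - 1)) * stepForm α t b) := by
  have := fracNorm_sq_le hT hp (by linarith : 0 < (α - 1) / 2) (measurable_stepFun t b)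
    (integrable_stepFun t b) (memLp_stepFun t b 2)
    (fun s hs => stepFun_apply_of_notMem ht b hs) hV
  rw [(gagliardo_stepFun hα₁ hα₂ ht.1.monotone b).2] at this
  refine this.trans (le_of_eq ?_)
  rw [← ENNReal.ofReal_ofNat, ← ENNReal.ofReal_mul (by norm_num)]
  congr 1; ring

/-! ### Riemann–Liouville derivatives of step functions -/

/-- Integration by parts against a test function, for a continuous function that is differentiable
off a countable set. -/
theorem integral_deriv_mul_eq_neg {T : ℝ} (hT : 0 < T) {φ P p : ℝ → ℝ} (hφ : ContDiff ℝ ∞ φ)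
    (hsupp : tsupport φ ⊆ Ioo 0 T) (hP : ContinuousOn P (Icc 0 T)) {s : Set ℝ} (hs : s.Countable)
    (hd : ∀ x ∈ Ioo 0 T \ s, HasDerivAt P (p x) x) (hp : IntervalIntegrable p volume 0 T) :
    ∫ x in Ioo 0 T, deriv φ x * P x = -∫ x in Ioo 0 T, φ x * p x := by
  have hφ0 : φ 0 = 0 := image_eq_zero_of_notMem_tsupport fun h => (hsupp h).1.ne rfl
  have hφT : φ T = 0 := image_eq_zero_of_notMem_tsupport fun h => (hsupp h).2.ne rfl
  have hφd : Differentiable ℝ φ := hφ.differentiable (by simp)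
  have hφ' : Continuous (deriv φ) := hφ.continuous_deriv (by simp)
  have i1 : IntervalIntegrable (fun x => deriv φ x * P x) volume 0 T := by
    refine ContinuousOn.intervalIntegrable ?_
    rw [uIcc_of_le hT.le]
    exact hφ'.continuousOn.mul hP
  have i2 : IntervalIntegrable (fun x => φ x * p x) volume 0 T :=
    hp.continuousOn_mul hφ.continuous.continuousOn
  have h := integral_eq_of_hasDerivAt_off_countable (fun x => φ x * P x)
    (fun x => deriv φ x * P x + φ x * p x) (a := 0) (b := T) hs
    (by rw [uIcc_of_le hT.le]; exact hφ.continuous.continuousOn.mul hP)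
    (fun x hx => (hφd x).hasDerivAt.mul (hd x (by
      rw [min_eq_left hT.le, max_eq_right hT.le] at hx; exact hx))) (i1.add i2)
  rw [intervalIntegral.integral_add i1 i2, hφ0, hφT] at h
  rw [← integral_Ioc_eq_integral_Ioo, ← integral_Ioc_eq_integral_Ioo,
    ← intervalIntegral.integral_of_le hT.le, ← intervalIntegral.integral_of_le hT.le]
  linarith

theorem rlIntegral_eq {X : Type} [NormedAddCommGroup X] [NormedSpace ℝ X] {α : ℝ} (hα₂ : α < 2)
    (v : ℝ → X) {x : ℝ} (hx : 0 ≤ x) :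
    rlIntegral (2 - α) v x = ∫ s in Ioo 0 x, rlKer α (x - s) • v s := by
  rw [rlIntegral, if_neg (by linarith), intervalIntegral.integral_of_le hx,
    integral_Ioc_eq_integral_Ioo, ← integral_smul]
  refine setIntegral_congr_fun measurableSet_Ioo fun s hs => ?_
  rw [rlKer_of_pos (by linarith [hs.2]), smul_smul, show 2 - α - 1 = 1 - α by ring,
    div_eq_inv_mul]

theorem rlIntegral_stepFun {X : Type} [NormedAddCommGroup X] [NormedSpace ℝ X] [CompleteSpace X]
    {α T : ℝ} (hα₁ : 1 < α) (hα₂ : α < 2) {J : ℕ} {t : Fin (J + 1) → ℝ}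
    (ht : IsPartition T t) (a : Fin J → X) {v : ℝ → X} (hv : v =ᵐ[timeMeasure T] stepFun t a)
    {x : ℝ} (hx : x ∈ Ioo 0 T) :
    rlIntegral (2 - α) v x =
      ∑ j, (rlKerPrim α (x - t j.castSucc) - rlKerPrim α (x - t j.succ)) • a j := by
  have hk : ∀ a b, IntervalIntegrable (fun s => rlKer α (x - s)) volume a b := by
    intro a b
    simpa using (intervalIntegrable_rlKer hα₁ hα₂ (x - a) (x - b)).comp_sub_left x
  have hT : 0 < T := hx.1.trans hx.2
  rw [rlIntegral_eq hα₂ v hx.1.le]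
  calc ∫ s in Ioo 0 x, rlKer α (x - s) • v s
      = ∫ s in Ioo 0 x, rlKer α (x - s) • stepFun t a s := by
        refine integral_congr_ae ?_
        filter_upwards [ae_restrict_of_ae_restrict_of_subset (Ioo_subset_Ioo_right hx.2.le) hv]
          with s hs
        rw [hs]
    _ = ∫ s in Ioo 0 T, rlKer α (x - s) • stepFun t a s := by
        refine (setIntegral_eq_of_subset_of_forall_sdiff_eq_zero measurableSet_Ioo
          (Ioo_subset_Ioo_right hx.2.le) fun s hs => ?_).symm
        rw [rlKer_of_nonpos hα₁, zero_smul]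
        by_contra h
        exact hs.2 ⟨hs.1.1, by linarith⟩
    _ = _ := by
        rw [integral_smul_stepFun ht a ((hk 0 T).1.mono_set Ioo_subset_Ioc_self)]
        refine Finset.sum_congr rfl fun j _ => ?_
        rw [intervalIntegral.integral_comp_sub_left (fun s => rlKer α s), integral_rlKer hα₁ hα₂]

/-- The Riemann–Liouville derivative of order `α - 1` of a step function. -/
def rlStep {X : Type} [NormedAddCommGroup X] [NormedSpace ℝ X] (α : ℝ) {J : ℕ}
    (t : Fin (J + 1) → ℝ) (a : Fin J → X) (s : ℝ) : X :=
  ∑ j, (rlKer α (s - t j.castSucc) - rlKer α (s - t j.succ)) • a j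

theorem intervalIntegrable_rlKer_sub_sub {α : ℝ} (hα₁ : 1 < α) (hα₂ : α < 2) (c d a b : ℝ) :
    IntervalIntegrable (fun s => rlKer α (s - c) - rlKer α (s - d)) volume a b :=
  (intervalIntegrable_rlKer_sub hα₁ hα₂ c a b).sub (intervalIntegrable_rlKer_sub hα₁ hα₂ d a b)

theorem isRLDeriv_stepFun {X : Type} [NormedAddCommGroup X] [NormedSpace ℝ X] [CompleteSpace X]
    {α T : ℝ} (hα₁ : 1 < α) (hα₂ : α < 2) (hT : 0 < T) {J : ℕ} {t : Fin (J + 1) → ℝ}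
    (ht : IsPartition T t) (a : Fin J → X) {v : ℝ → X} (hv : v =ᵐ[timeMeasure T] stepFun t a) :
    IsRLDeriv T (α - 1) v (rlStep α t a) := by
  have hceil : ⌈α - 1⌉₊ = 1 := by
    rw [Nat.ceil_eq_iff (by norm_num)]; constructor <;> norm_num <;> linarith
  have hI : ∀ j : Fin J, IntervalIntegrable
      (fun s => rlKer α (s - t j.castSucc) - rlKer α (s - t j.succ)) volume 0 T := fun j =>
    intervalIntegrable_rlKer_sub_sub hα₁ hα₂ _ _ _ _
  have hC : ∀ j : Fin J, Continuous
      (fun s => rlKerPrim α (s - t j.castSucc) - rlKerPrim α (s - t j.succ)) := fun j =>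
    ((continuous_rlKerPrim hα₂).comp (by fun_prop)).sub
      ((continuous_rlKerPrim hα₂).comp (by fun_prop))
  refine ⟨?_, fun φ hφ _ hsupp => ?_⟩
  · unfold rlStep
    exact integrable_finsetSum _ fun j _ =>
      ((hI j).1.mono_set Ioo_subset_Ioc_self).smul_const _
  · rw [hceil]
    have e1 : ∫ s in Ioo 0 T, iteratedDeriv 1 φ s • rlIntegral (((1 : ℕ) : ℝ) - (α - 1)) v s =
        ∫ s in Ioo 0 T, ∑ j, (deriv φ s *
          (rlKerPrim α (s - t j.castSucc) - rlKerPrim α (s - t j.succ))) • a j := by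
      refine setIntegral_congr_fun measurableSet_Ioo fun s hs => ?_
      simp only [iteratedDeriv_one, Nat.cast_one]
      rw [show (1 : ℝ) - (α - 1) = 2 - α by ring, rlIntegral_stepFun hα₁ hα₂ ht a hv hs,
        Finset.smul_sum]
      exact Finset.sum_congr rfl fun j _ => smul_smul _ _ _
    have e2 : ∫ s in Ioo 0 T, φ s • rlStep α t a s =
        ∫ s in Ioo 0 T, ∑ j, (φ s *
          (rlKer α (s - t j.castSucc) - rlKer α (s - t j.succ))) • a j := by
      refine setIntegral_congr_fun measurableSet_Ioo fun s _ => ?_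
      simp only [rlStep, Finset.smul_sum, smul_smul]
    have hφ' : Continuous (deriv φ) := hφ.continuous_deriv (by simp)
    have i1 : ∀ j : Fin J, IntegrableOn (fun s => deriv φ s *
        (rlKerPrim α (s - t j.castSucc) - rlKerPrim α (s - t j.succ))) (Ioo 0 T) := fun j =>
      ((hφ'.mul (hC j)).continuousOn.integrableOn_Icc).mono_set Ioo_subset_Icc_self
    have i2 : ∀ j : Fin J, IntegrableOn (fun s => φ s *
        (rlKer α (s - t j.castSucc) - rlKer α (s - t j.succ))) (Ioo 0 T) := fun j =>
      ((hI j).continuousOn_mul hφ.continuous.continuousOn).1.mono_set Ioo_subset_Ioc_self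
    rw [e1, e2, integral_finsetSum _ fun j _ => (i1 j).smul_const _,
      integral_finsetSum _ fun j _ => (i2 j).smul_const _, Finset.smul_sum]
    refine Finset.sum_congr rfl fun j _ => ?_
    rw [integral_smul_const, integral_smul_const, integral_deriv_mul_eq_neg hT hφ hsupp
      (hC j).continuousOn (s := {t j.castSucc, t j.succ}) (Set.toFinite _).countable
      (fun x hx => ?_) (hI j)]
    · simp
    · have h1 : x - t j.castSucc ≠ 0 := fun h => hx.2 (Or.inl (by linarith))
      have h2 : x - t j.succ ≠ 0 := fun h => hx.2 (Or.inr (by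
        rw [mem_singleton_iff]; linarith))
      exact ((hasDerivAt_rlKerPrim hα₁ hα₂ h1).comp_sub_const x _).sub
        ((hasDerivAt_rlKerPrim hα₁ hα₂ h2).comp_sub_const x _)

theorem hasDerivAt_rpow_div_Gamma {α x : ℝ} (hα₂ : α < 2) (hx : 0 < x) :
    HasDerivAt (fun y : ℝ => y ^ (3 - α) / Real.Gamma (4 - α)) (rlKerPrim α x) x := by
  have h1 := (Real.hasDerivAt_rpow_const (p := 3 - α) (Or.inl hx.ne')).div_const
    (Real.Gamma (4 - α))
  refine h1.congr_deriv ?_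
  rw [show rlKerPrim α x = x ^ (2 - α) / Real.Gamma (3 - α) by rw [rlKerPrim, max_eq_left hx.le],
    show 4 - α = (3 - α) + 1 by ring,
    Real.Gamma_add_one (by linarith), mul_div_mul_left _ _ (by linarith)]
  congr 2; ring

theorem rlIntegral_id {α x : ℝ} (hα₁ : 1 < α) (hα₂ : α < 2) (hx : 0 < x) :
    rlIntegral (2 - α) (fun s => s) x = x ^ (3 - α) / Real.Gamma (4 - α) := by
  have hk : IntervalIntegrable (rlKer α) volume 0 x := intervalIntegrable_rlKer hα₁ hα₂ 0 x
  rw [rlIntegral_eq hα₂ _ hx.le, ← integral_Ioc_eq_integral_Ioo,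
    ← intervalIntegral.integral_of_le hx.le]
  have e : ∫ s in (0 : ℝ)..x, rlKer α (x - s) • s =
      ∫ u in (0 : ℝ)..x, rlKer α u * (x - u) := by
    have := intervalIntegral.integral_comp_sub_left (fun u => rlKer α u * (x - u)) x (a := 0)
      (b := x)
    simpa using this
  have hc : ContinuousOn (fun y : ℝ => y ^ (3 - α) / Real.Gamma (4 - α)) (Icc 0 x) :=
    (continuousOn_id.rpow_const fun y _ => Or.inr (by linarith)).div_const _
  rw [e, integral_eq_of_hasDerivAt_off_countable
    (fun u => rlKerPrim α u * (x - u) + u ^ (3 - α) / Real.Gamma (4 - α))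
    (fun u => rlKer α u * (x - u))
    (countable_empty) (by
      rw [uIcc_of_le hx.le]
      exact ((continuous_rlKerPrim hα₂).mul (by fun_prop)).continuousOn.add hc)
    (fun u hu => ?_) (hk.mul_continuousOn (by fun_prop))]
  · rw [rlKerPrim_of_nonpos hα₂ le_rfl, Real.zero_rpow (by linarith)]
    ring
  · have hu : 0 < u := by
      have := hu.1.1
      rwa [min_eq_left hx.le] at this
    have h1 : HasDerivAt (fun u => x - u) (-1) u := by
      simpa using (hasDerivAt_id u).const_sub x
    have := ((hasDerivAt_rlKerPrim hα₁ hα₂ hu.ne').mul h1).add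
      (hasDerivAt_rpow_div_Gamma hα₂ hu)
    exact this.congr_deriv (by ring)

/-- `D_{0+}^α t = t^{1-α} / Γ(2-α)`. -/
theorem isRLDeriv_id {α T : ℝ} (hα₁ : 1 < α) (hα₂ : α < 2) (hT : 0 < T) :
    IsRLDeriv T α (fun s => s) (rlKer α) := by
  have hceil : ⌈α⌉₊ = 2 := by
    rw [Nat.ceil_eq_iff (by norm_num)]; constructor <;> norm_num <;> linarith
  have hk := intervalIntegrable_rlKer hα₁ hα₂ 0 T
  refine ⟨hk.1.mono_set Ioo_subset_Ioc_self, fun φ hφ hφc hsupp => ?_⟩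
  have hφ' : ContDiff ℝ ∞ (deriv φ) := by
    exact (contDiff_infty_iff_deriv.1 hφ).2
  rw [hceil]
  have e1 : ∫ s in Ioo 0 T, iteratedDeriv 2 φ s • rlIntegral (((2 : ℕ) : ℝ) - α)
      (fun s => s) s = ∫ s in Ioo 0 T, deriv (deriv φ) s * (s ^ (3 - α) / Real.Gamma (4 - α)) := by
    refine setIntegral_congr_fun measurableSet_Ioo fun s hs => ?_
    simp only [iteratedDeriv_succ, iteratedDeriv_zero, Nat.cast_ofNat]
    rw [rlIntegral_id hα₁ hα₂ hs.1, smul_eq_mul]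
  rw [e1, integral_deriv_mul_eq_neg hT hφ' (tsupport_deriv_subset.trans hsupp)
    (P := fun s : ℝ => s ^ (3 - α) / Real.Gamma (4 - α))
    ((continuousOn_id.rpow_const fun y _ => Or.inr (by linarith)).div_const _) countable_empty
    (fun x hx => hasDerivAt_rpow_div_Gamma hα₂ hx.1.1)
    ((continuous_rlKerPrim hα₂).intervalIntegrable _ _),
    integral_deriv_mul_eq_neg hT hφ hsupp (continuous_rlKerPrim hα₂).continuousOn
      countable_empty (fun x hx => hasDerivAt_rlKerPrim hα₁ hα₂ hx.1.1.ne') hk]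
  simp

/-- The distributional derivative is unique, by the fundamental lemma of the calculus of
variations. -/
theorem IsRLDeriv.ae_eq {X : Type} [NormedAddCommGroup X] [NormedSpace ℝ X] [CompleteSpace X]
    {T γ : ℝ} {v G₁ G₂ : ℝ → X} (h₁ : IsRLDeriv T γ v G₁) (h₂ : IsRLDeriv T γ v G₂) :
    G₁ =ᵐ[timeMeasure T] G₂ := by
  have h := isOpen_Ioo.ae_eq_zero_of_integral_contDiff_smul_eq_zero (U := Ioo 0 T)
    (f := fun s => G₁ s - G₂ s) (μ := volume) (h₁.1.sub h₂.1).locallyIntegrableOn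
    (fun φ hφ hc hsupp => ?_)
  · rw [Filter.EventuallyEq, ae_restrict_iff' measurableSet_Ioo]
    filter_upwards [h] with s hs hmem
    exact sub_eq_zero.1 (hs hmem)
  · have h0 : ∀ G : ℝ → X, IntegrableOn G (Ioo 0 T) → IntegrableOn (fun s => φ s • G s) (Ioo 0 T) := by
      intro G hG
      obtain ⟨C, hC⟩ := hc.exists_bound_of_continuous hφ.continuous
      exact hG.bdd_smul C hφ.continuous.aestronglyMeasurable (ae_of_all _ hC)
    rw [← setIntegral_eq_integral_of_forall_compl_eq_zero (s := Ioo 0 T)]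
    · simp only [smul_sub]
      rw [integral_sub (h0 _ h₁.1) (h0 _ h₂.1), sub_eq_zero]
      have := (h₁.2 φ hφ hc hsupp).symm.trans (h₂.2 φ hφ hc hsupp)
      have hne : ((-1 : ℝ) ^ ⌈γ⌉₊) ≠ 0 := by positivity
      exact smul_right_injective X hne this
    · intro s hs
      rw [image_eq_zero_of_notMem_tsupport fun h => hs (hsupp h), zero_smul]

/-! ### Test functions, the gradient and the Poincaré inequality -/

theorem testPairs_add {d : ℕ} {Ω : Set (Space d)} {p q : L2 Ω × L2Vec Ω} (hp : p ∈ testPairs Ω)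
    (hq : q ∈ testPairs Ω) : p + q ∈ testPairs Ω := by
  obtain ⟨φ, h1, h2, h3, h4, h5⟩ := hp
  obtain ⟨ψ, k1, k2, k3, k4, k5⟩ := hq
  refine ⟨φ + ψ, h1.add k1, h2.add k2, (tsupport_add φ ψ).trans (union_subset h3 k3), ?_, ?_⟩
  · exact (Lp.coeFn_add _ _).trans (h4.add k4)
  · filter_upwards [Lp.coeFn_add p.2 q.2, h5, k5] with x a b c
    rw [Prod.snd_add, a, Pi.add_apply, b, c, gradient, gradient, gradient,
      fderiv_add (h1.differentiable (by simp) x) (k1.differentiable (by simp) x), map_add]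

theorem testPairs_smul {d : ℕ} {Ω : Set (Space d)} {p : L2 Ω × L2Vec Ω} (c : ℝ)
    (hp : p ∈ testPairs Ω) : c • p ∈ testPairs Ω := by
  obtain ⟨φ, h1, h2, h3, h4, h5⟩ := hp
  refine ⟨c • φ, contDiff_const.smul h1, h2.smul_left (f := fun _ => c),
    (tsupport_smul_subset_right (fun _ => c) φ).trans h3, ?_, ?_⟩
  · exact (Lp.coeFn_smul _ _).trans (h4.const_smul c)
  · filter_upwards [Lp.coeFn_smul c p.2, h5] with x a b
    rw [Prod.smul_snd, a, Pi.smul_apply, b, gradient, gradient,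
      fderiv_const_smul (h1.differentiable (by simp) x) c, map_smul]

theorem testPairs_zero {d : ℕ} {Ω : Set (Space d)} : (0 : L2 Ω × L2Vec Ω) ∈ testPairs Ω := by
  refine ⟨0, contDiff_const, HasCompactSupport.zero, by simp, Lp.coeFn_zero _ _ _, ?_⟩
  filter_upwards [Lp.coeFn_zero (Space d) 2 (volume.restrict Ω)] with x h
  rw [Prod.snd_zero, h, gradient, show (0 : Space d → ℝ) = fun _ => 0 from rfl]
  simp

/-- The pairs `(φ, ∇φ)` of smooth compactly supported functions form a subspace already. -/
theorem span_testPairs {d : ℕ} {Ω : Set (Space d)} {p : L2 Ω × L2Vec Ω}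
    (hp : p ∈ Submodule.span ℝ (testPairs Ω)) : p ∈ testPairs Ω := by
  induction hp using Submodule.span_induction with
  | mem x h => exact h
  | zero => exact testPairs_zero
  | add x y _ _ hx hy => exact testPairs_add hx hy
  | smul c x _ hx => exact testPairs_smul c hx

/-- A closed condition that holds for smooth compactly supported functions holds on `H₀¹(Ω)`. -/
theorem h01Pairs_induction {d : ℕ} {Ω : Set (Space d)} {P : L2 Ω × L2Vec Ω → Prop}
    (hc : IsClosed {p | P p}) (h : ∀ p ∈ testPairs Ω, P p) : ∀ p ∈ h01Pairs Ω, P p := by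
  intro p hp
  have : ((Submodule.span ℝ (testPairs Ω)).topologicalClosure : Set (L2 Ω × L2Vec Ω)) ⊆
      {p | P p} := by
    rw [Submodule.topologicalClosure_coe]
    exact closure_minimal (fun q hq => h q (span_testPairs hq)) hc
  exact this hp

/-- The defining relation of the weak gradient. -/
theorem h01Pairs_weak {d : ℕ} {Ω : Set (Space d)} {ψ : Space d → ℝ}
    (hψ : ContDiff ℝ ∞ ψ) (hψc : HasCompactSupport ψ) (e : Space d) :
    ∀ p ∈ h01Pairs Ω, (∫ x in Ω, fderiv ℝ ψ x e * p.1 x) + ∫ x in Ω, ψ x * ⟪e, p.2 x⟫_ℝ = 0 := by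
  have hψ' : Continuous fun x => fderiv ℝ ψ x e :=
    (hψ.continuous_fderiv (by simp)).clm_apply continuous_const
  have mA : MemLp (fun x => fderiv ℝ ψ x e) 2 (volume.restrict Ω) :=
    hψ'.memLp_of_hasCompactSupport (hψc.fderiv_apply ℝ e)
  have mB : MemLp (fun x => ψ x • e) 2 (volume.restrict Ω) :=
    (hψ.continuous.smul continuous_const).memLp_of_hasCompactSupport (hψc.smul_right)
  have e1 : ∀ p : L2 Ω × L2Vec Ω, (∫ x in Ω, fderiv ℝ ψ x e * p.1 x) +
      ∫ x in Ω, ψ x * ⟪e, p.2 x⟫_ℝ = ⟪mA.toLp _, p.1⟫_ℝ + ⟪mB.toLp _, p.2⟫_ℝ := by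
    intro p
    rw [L2.inner_def, L2.inner_def]
    congr 1
    · refine integral_congr_ae ?_
      filter_upwards [mA.coeFn_toLp] with x hx
      rw [hx]; simp [mul_comm]
    · refine integral_congr_ae ?_
      filter_upwards [mB.coeFn_toLp] with x hx
      rw [hx, real_inner_smul_left]
  refine h01Pairs_induction ?_ ?_
  · simp only [e1]
    exact isClosed_eq (by fun_prop) continuous_const
  · rintro p ⟨φ, hφ, hφc, hφs, h1, h2⟩
    have hφ' : Continuous fun x => fderiv ℝ φ x e :=
      (hφ.continuous_fderiv (by simp)).clm_apply continuous_const
    have f1 : ∫ x in Ω, fderiv ℝ ψ x e * p.1 x = ∫ x, φ x * fderiv ℝ ψ x e := by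
      refine Eq.trans (integral_congr_ae ?_) (setIntegral_eq_integral_of_forall_compl_eq_zero
        (s := Ω) fun x hx => by
          rw [image_eq_zero_of_notMem_tsupport fun h => hx (hφs h), zero_mul])
      filter_upwards [h1] with x hx
      rw [hx, mul_comm]
    have f2 : ∫ x in Ω, ψ x * ⟪e, p.2 x⟫_ℝ = ∫ x, fderiv ℝ φ x e * ψ x := by
      refine Eq.trans (integral_congr_ae ?_) (setIntegral_eq_integral_of_forall_compl_eq_zero
        (s := Ω) fun x hx => by
          rw [show fderiv ℝ φ x = 0 from image_eq_zero_of_notMem_tsupport fun h =>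
            hx (hφs (tsupport_fderiv_subset ℝ h))]; simp)
      filter_upwards [h2] with x hx
      rw [hx, real_inner_comm, inner_gradient_left, mul_comm]
    rw [f1, f2, integral_mul_fderiv_eq_neg_fderiv_mul_of_integrable]
    · simp
    · exact (hφ'.mul hψ.continuous).integrable_of_hasCompactSupport hψc.mul_left
    · exact (hφ.continuous.mul hψ').integrable_of_hasCompactSupport hφc.mul_right
    · exact (hφ.continuous.mul hψ.continuous).integrable_of_hasCompactSupport hφc.mul_right
    · exact fun x _ => hφ.differentiable (by simp) x
    · exact fun x _ => hψ.differentiable (by simp) x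

/-- The weak gradient is determined by the function. -/
theorem H01.val_injective {d : ℕ} {Ω : Set (Space d)} (hΩ : IsOpen Ω)
    (hb : Bornology.IsBounded Ω) : Function.Injective (H01.val : H01 Ω →L[ℝ] L2 Ω) := by
  have : IsFiniteMeasure (volume.restrict Ω) := ⟨by
    rw [Measure.restrict_apply_univ]; exact hb.measure_lt_top⟩
  rw [injective_iff_map_eq_zero]
  intro v hv
  have hv1 : v.1.1 = 0 := hv
  have hint : Integrable (fun x => v.1.2 x) (volume.restrict Ω) :=
    (Lp.memLp v.1.2).integrable (by norm_num)
  have hv2 : v.1.2 = 0 := by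
    have := hΩ.ae_eq_zero_of_integral_contDiff_smul_eq_zero (μ := volume)
      (IntegrableOn.locallyIntegrableOn hint) (fun ψ hψ hψc hψs => ?_)
    · refine Lp.ext ?_
      filter_upwards [(ae_restrict_iff' hΩ.measurableSet).2 this,
        Lp.coeFn_zero (Space d) 2 (volume.restrict Ω)] with x h1 h2
      rw [h1, h2]; rfl
    · obtain ⟨C, hC⟩ := hψc.exists_bound_of_continuous hψ.continuous
      have hi : Integrable (fun x => ψ x • v.1.2 x) (volume.restrict Ω) :=
        hint.bdd_smul C hψ.continuous.aestronglyMeasurable (ae_of_all _ hC)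
      rw [← setIntegral_eq_integral_of_forall_compl_eq_zero (s := Ω) fun x hx => by
        rw [image_eq_zero_of_notMem_tsupport fun h => hx (hψs h), zero_smul]]
      refine ext_inner_left ℝ fun e => ?_
      have hw := h01Pairs_weak hψ hψc e v.1 v.2
      have h0 : ∫ x in Ω, fderiv ℝ ψ x e * v.1.1 x = 0 := by
        rw [hv1]
        refine integral_eq_zero_of_ae ?_
        filter_upwards [Lp.coeFn_zero ℝ 2 (volume.restrict Ω)] with x hx
        rw [hx]; simp
      rw [h0, zero_add] at hw
      rw [← integral_inner hi, inner_zero_right, ← hw]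
      simp only [real_inner_smul_right]
  exact Subtype.ext (Prod.ext hv1 hv2)

/-- The Poincaré inequality, from `∫ φ² = -2 ∫ x₁ φ ∂₁φ`. -/
theorem h01Pairs_poincare {d : ℕ} (hd : 1 ≤ d) {Ω : Set (Space d)} (hΩ : MeasurableSet Ω)
    (hb : Bornology.IsBounded Ω) : ∃ C : ℝ, ∀ p ∈ h01Pairs Ω, ‖p.1‖ ≤ C * ‖p.2‖ := by
  obtain ⟨R, hR0, hR⟩ := hb.exists_pos_norm_le
  set e : Space d := EuclideanSpace.single ⟨0, hd⟩ 1 with he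
  have hee : ‖e‖ = 1 := by simp [he]
  refine ⟨2 * R, h01Pairs_induction (isClosed_le (by fun_prop) (by fun_prop)) ?_⟩
  rintro p ⟨φ, hφ, hφc, hφs, h1, h2⟩
  have hφ' : Continuous fun x => fderiv ℝ φ x e :=
    (hφ.continuous_fderiv (by simp)).clm_apply continuous_const
  have hφd := hφ.differentiable (by simp)
  have hbound : ∀ᵐ x ∂(volume.restrict Ω), ‖-2 * ⟪e, x⟫_ℝ * ⟪e, p.2 x⟫_ℝ‖ ≤ 2 * R * ‖p.2 x‖ := by
    filter_upwards [ae_restrict_mem hΩ] with x hx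
    rw [norm_mul, norm_mul]
    have a1 : ‖⟪e, x⟫_ℝ‖ ≤ R := (norm_inner_le_norm _ _).trans (by rw [hee, one_mul]; exact hR x hx)
    have a2 : ‖⟪e, p.2 x⟫_ℝ‖ ≤ ‖p.2 x‖ := (norm_inner_le_norm _ _).trans (by rw [hee, one_mul])
    have : ‖(-2 : ℝ)‖ = 2 := by norm_num
    rw [this]
    gcongr
  have mh : MemLp (fun x => -2 * ⟪e, x⟫_ℝ * ⟪e, p.2 x⟫_ℝ) 2 (volume.restrict Ω) := by
    refine MemLp.of_le_mul (Lp.memLp p.2) ?_ hbound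
    exact (by fun_prop : Continuous fun x : Space d => -2 * ⟪e, x⟫_ℝ).aestronglyMeasurable.mul
      (aestronglyMeasurable_const.inner (Lp.memLp p.2).1)
  have hnorm : ‖mh.toLp _‖ ≤ 2 * R * ‖p.2‖ := by
    refine Lp.norm_le_mul_norm_of_ae_le_mul ?_
    filter_upwards [hbound, mh.coeFn_toLp] with x hx hx'
    rw [hx']; exact hx
  have key : ⟪p.1, p.1⟫_ℝ = ⟪mh.toLp _, p.1⟫_ℝ := by
    -- `φ²` times the derivative `1` of `x₁`, to be integrated by parts
    have f1 : ⟪p.1, p.1⟫_ℝ = ∫ x, fderiv ℝ (fun x => ⟪e, x⟫_ℝ) x e * (φ x * φ x) := by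
      have h3 : ∀ x, fderiv ℝ (fun x => ⟪e, x⟫_ℝ) x e = 1 := by
        intro x
        have : HasFDerivAt (fun x => ⟪e, x⟫_ℝ) (innerSL ℝ e) x := (innerSL ℝ e).hasFDerivAt
        rw [this.fderiv]; simp [hee]
      rw [L2.inner_def]
      refine Eq.trans (integral_congr_ae ?_) (setIntegral_eq_integral_of_forall_compl_eq_zero
        (s := Ω) fun x hx => by
          rw [image_eq_zero_of_notMem_tsupport fun h => hx (hφs h)]; simp)
      filter_upwards [h1] with x hx
      rw [hx, h3]; simp [sq]
    have f2 : ⟪mh.toLp _, p.1⟫_ℝ = - ∫ x, ⟪e, x⟫_ℝ * fderiv ℝ (fun x => φ x * φ x) x e := by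
      rw [← integral_neg, L2.inner_def]
      refine Eq.trans (integral_congr_ae ?_) (setIntegral_eq_integral_of_forall_compl_eq_zero
        (s := Ω) fun x hx => by
          rw [fderiv_fun_mul (hφd x) (hφd x),
            image_eq_zero_of_notMem_tsupport fun h => hx (hφs h)]; simp)
      filter_upwards [h1, h2, mh.coeFn_toLp] with x hx hx2 hx3
      rw [hx3, hx, hx2, fderiv_fun_mul (hφd x) (hφd x), real_inner_comm (gradient φ x) e,
        inner_gradient_left]
      simp
      ring
    have hl : Continuous fun x => fderiv ℝ (fun x => ⟪e, x⟫_ℝ) x e := by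
      have : ContDiff ℝ ∞ fun x : Space d => ⟪e, x⟫_ℝ := contDiff_const.inner ℝ contDiff_id
      exact (this.continuous_fderiv (by simp)).clm_apply continuous_const
    have hsq : ContDiff ℝ ∞ fun x => φ x * φ x := hφ.mul hφ
    have hsqc : HasCompactSupport fun x => φ x * φ x := hφc.mul_left
    have hsq' : Continuous fun x => fderiv ℝ (fun x => φ x * φ x) x e :=
      (hsq.continuous_fderiv (by simp)).clm_apply continuous_const
    rw [f1, f2, integral_mul_fderiv_eq_neg_fderiv_mul_of_integrable, neg_neg]
    · exact (hl.mul hsq.continuous).integrable_of_hasCompactSupport hsqc.mul_left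
    · exact ((by fun_prop : Continuous fun x : Space d => ⟪e, x⟫_ℝ).mul
        hsq').integrable_of_hasCompactSupport (hsqc.fderiv_apply ℝ e).mul_left
    · exact ((by fun_prop : Continuous fun x : Space d => ⟪e, x⟫_ℝ).mul
        hsq.continuous).integrable_of_hasCompactSupport hsqc.mul_left
    · exact fun x _ => (innerSL ℝ e).differentiableAt
    · exact fun x _ => hsq.differentiable (by simp) x
  have h3 : ‖p.1‖ * ‖p.1‖ ≤ 2 * R * ‖p.2‖ * ‖p.1‖ := by
    rw [← real_inner_self_eq_norm_mul_norm, key]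
    exact (real_inner_le_norm _ _).trans (by gcongr)
  rcases (norm_nonneg p.1).eq_or_lt with h | h
  · rw [← h]
    exact (norm_nonneg _).trans hnorm
  · exact le_of_mul_le_mul_right h3 h

theorem H01.grad_injective {d : ℕ} (hd : 1 ≤ d) {Ω : Set (Space d)} (hΩ : MeasurableSet Ω)
    (hb : Bornology.IsBounded Ω) : Function.Injective (H01.grad : H01 Ω →L[ℝ] L2Vec Ω) := by
  obtain ⟨C, hC⟩ := h01Pairs_poincare hd hΩ hb
  rw [injective_iff_map_eq_zero]
  intro v hv
  have hv2 : v.1.2 = 0 := hv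
  have hv1 : v.1.1 = 0 := by
    have := hC v.1 v.2
    rw [hv2, norm_zero, mul_zero] at this
    exact norm_le_zero_iff.1 this
  exact Subtype.ext (Prod.ext hv1 hv2)

/-! ### `Ḣ¹(Ω)` and `H₀¹(Ω)` -/

/-- The gradients of the eigenfunctions, scaled by `λ_n^{-1/2}`, are orthonormal, and the
coefficients of `∇v` with respect to them are those of `v`, scaled by `λ_n^{1/2}`. -/
theorem DirichletEigenbasis.exists_orthonormal {d : ℕ} {Ω : Set (Space d)}
    (Φ : DirichletEigenbasis Ω) : ∃ p : ℕ → H01 Ω, (∀ n, H01.val (p n) = Φ.basis n) ∧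
      Orthonormal ℝ (fun n => (√(Φ.eig n))⁻¹ • H01.grad (p n)) ∧
      ∀ n (v : H01 Ω), ⟪(√(Φ.eig n))⁻¹ • H01.grad (p n), H01.grad v⟫_ℝ =
        √(Φ.eig n) * ⟪Φ.basis n, H01.val v⟫_ℝ := by
  choose p hp hp' using Φ.isEigen
  have h1 : ∀ n (v : H01 Ω), ⟪(√(Φ.eig n))⁻¹ • H01.grad (p n), H01.grad v⟫_ℝ =
        √(Φ.eig n) * ⟪Φ.basis n, H01.val v⟫_ℝ := by
    intro n v
    have h := Real.sqrt_pos.2 (Φ.eig_pos n)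
    rw [real_inner_smul_left, hp', ← mul_assoc]
    congr 1
    rw [inv_mul_eq_div, Real.div_sqrt]
  refine ⟨p, hp, ?_, h1⟩
  rw [orthonormal_iff_ite]
  intro i j
  rw [real_inner_smul_right, h1, hp, orthonormal_iff_ite.1 Φ.basis.orthonormal]
  have h := Real.sqrt_pos.2 (Φ.eig_pos i)
  split_ifs with hij
  · subst hij; field_simp
  · simp

/-- Bessel's inequality: the norm of `Ḣ¹(Ω)` is bounded by the norm of the gradient. -/
theorem dotHNorm_le {d : ℕ} {Ω : Set (Space d)} (Φ : DirichletEigenbasis Ω) (v : H01 Ω) :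
    dotHNorm Φ 1 (H01.val v) ≤ ‖H01.grad v‖ₑ := by
  obtain ⟨p, _, ho, h⟩ := Φ.exists_orthonormal
  have e : ∀ n, Φ.eig n ^ (1 : ℝ) * ⟪Φ.basis n, H01.val v⟫_ℝ ^ 2 =
      ‖⟪(√(Φ.eig n))⁻¹ • H01.grad (p n), H01.grad v⟫_ℝ‖ ^ 2 := by
    intro n
    rw [h, Real.norm_eq_abs, sq_abs, mul_pow, Real.sq_sqrt (Φ.eig_pos n).le, Real.rpow_one]
  rw [dotHNorm]
  simp only [e]
  rw [← ENNReal.ofReal_tsum_of_nonneg (fun n => by positivity)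
    (ho.inner_products_summable (H01.grad v)),
    ENNReal.ofReal_rpow_of_nonneg (tsum_nonneg fun n => by positivity) (by norm_num),
    ← ofReal_norm, ← Real.sqrt_eq_rpow]
  exact ENNReal.ofReal_le_ofReal (Real.sqrt_le_iff.2
    ⟨norm_nonneg _, ho.tsum_inner_products_le _⟩)

/-- Conversely, `Ḣ¹(Ω)` is contained in `H₀¹(Ω)`: the partial sums of the eigenfunction expansion
converge in `H₀¹(Ω)`. -/
theorem exists_H01_of_dotHNorm {d : ℕ} {Ω : Set (Space d)} (Φ : DirichletEigenbasis Ω) (u : L2 Ω)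
    (hu : dotHNorm Φ 1 u < ⊤) :
    ∃ v : H01 Ω, H01.val v = u ∧ ‖H01.grad v‖ₑ ≤ dotHNorm Φ 1 u := by
  obtain ⟨p, hp, ho, -⟩ := Φ.exists_orthonormal
  set c : ℕ → ℝ := fun n => ⟪Φ.basis n, u⟫_ℝ with hc
  set x : ℕ → ℝ := fun n => √(Φ.eig n) * c n with hx
  have e : ∀ n, Φ.eig n ^ (1 : ℝ) * ⟪Φ.basis n, u⟫_ℝ ^ 2 = ‖x n‖ ^ 2 := by
    intro n
    rw [Real.norm_eq_abs, sq_abs, mul_pow, Real.sq_sqrt (Φ.eig_pos n).le, Real.rpow_one]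
  have hsum : Summable fun n => ‖x n‖ ^ 2 := by
    rw [dotHNorm, ENNReal.rpow_lt_top_iff_of_pos (by norm_num)] at hu
    simp only [e] at hu
    have := ENNReal.summable_toReal hu.ne
    simpa only [ENNReal.toReal_ofReal (sq_nonneg _)] using this
  have hd : dotHNorm Φ 1 u = ENNReal.ofReal √(∑' n, ‖x n‖ ^ 2) := by
    rw [dotHNorm]
    simp only [e]
    rw [← ENNReal.ofReal_tsum_of_nonneg (fun n => by positivity) hsum,
      ENNReal.ofReal_rpow_of_nonneg (tsum_nonneg fun n => by positivity) (by norm_num),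
      ← Real.sqrt_eq_rpow]
  have hterm : ∀ n, x n • ((√(Φ.eig n))⁻¹ • H01.grad (p n)) = c n • H01.grad (p n) := by
    intro n
    have h := (Real.sqrt_pos.2 (Φ.eig_pos n)).ne'
    rw [smul_smul, hx]
    congr 1
    field_simp
  have hs : Summable fun n => c n • H01.grad (p n) := by
    have := (ho.orthogonalFamily.summable_iff_norm_sq_summable x).2 hsum
    simpa only [LinearIsometry.toSpanSingleton_apply, hterm] using this
  obtain ⟨g, hg⟩ := hs
  have hu' : HasSum (fun n => c n • Φ.basis n) u := by
    have := Φ.basis.hasSum_repr u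
    simpa only [Φ.basis.repr_apply_apply] using this
  have hmem' : ∀ n, (Φ.basis n, H01.grad (p n)) ∈ h01Pairs Ω := by
    intro n
    rw [← hp]
    exact (p n).2
  have hmem : (u, g) ∈ h01Pairs Ω := by
    refine IsClosed.mem_of_tendsto (Submodule.isClosed_topologicalClosure _) (hu'.prodMk hg)
      (Eventually.of_forall fun s => ?_)
    refine Submodule.sum_mem _ fun n _ => ?_
    exact Submodule.smul_mem _ (c n) (hmem' n)
  refine ⟨⟨(u, g), hmem⟩, rfl, ?_⟩
  change ‖g‖ₑ ≤ _
  rw [hd, ← ofReal_norm]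
  refine ENNReal.ofReal_le_ofReal (Real.le_sqrt_of_sq_le ?_)
  refine le_of_tendsto (hg.norm.pow 2) (Eventually.of_forall fun s => ?_)
  have := ho.orthogonalFamily.norm_sum x s
  simp only [LinearIsometry.toSpanSingleton_apply, hterm] at this
  rw [this]
  exact hsum.sum_le_tsum s fun n _ => by positivity

/-! ### The finite element space and the discrete initial value -/

theorem IsConvexPolytope.isOpen {d : ℕ} {Ω : Set (Space d)} (h : IsConvexPolytope Ω) :
    IsOpen Ω := by
  obtain ⟨-, P, rfl⟩ := h
  exact isOpen_interior

theorem IsConvexPolytope.isBounded {d : ℕ} {Ω : Set (Space d)} (h : IsConvexPolytope Ω) :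
    Bornology.IsBounded Ω := by
  obtain ⟨-, P, rfl⟩ := h
  exact (isBounded_convexHull.2 P.finite_toSet.isBounded).subset interior_subset

/-- The affine functions, modulo equality almost everywhere with respect to `μ`. -/
def affineAE {d : ℕ} (μ : Measure (Space d)) : ℝ × Space d →ₗ[ℝ] (Space d →ₘ[μ] ℝ) where
  toFun q := AEEqFun.mk (fun x => q.1 + ⟪q.2, x⟫_ℝ)
    (by fun_prop : Continuous fun x : Space d => q.1 + ⟪q.2, x⟫_ℝ).aestronglyMeasurable
  map_add' q r := by
    rw [AEEqFun.mk_add_mk, AEEqFun.mk_eq_mk]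
    refine ae_of_all _ fun x => ?_
    simp only [Prod.fst_add, Prod.snd_add, inner_add_left, Pi.add_apply]
    ring
  map_smul' c q := by
    rw [RingHom.id_apply, AEEqFun.smul_mk, AEEqFun.mk_eq_mk]
    refine ae_of_all _ fun x => ?_
    simp only [Prod.smul_fst, Prod.smul_snd, real_inner_smul_left, Pi.smul_apply, smul_eq_mul]
    ring

/-- The restriction of a function in `L²(Ω)` to a set `s`, modulo equality almost everywhere. -/
def restrictAE {d : ℕ} {Ω : Set (Space d)} (s : Set (Space d)) :
    L2 Ω →ₗ[ℝ] (Space d →ₘ[(volume.restrict Ω).restrict s] ℝ) where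
  toFun v := AEEqFun.mk v (Lp.aestronglyMeasurable v).restrict
  map_add' v w := by
    rw [AEEqFun.mk_add_mk, AEEqFun.mk_eq_mk]
    exact ae_restrict_of_ae (Lp.coeFn_add v w)
  map_smul' c v := by
    rw [RingHom.id_apply, AEEqFun.smul_mk, AEEqFun.mk_eq_mk]
    exact ae_restrict_of_ae (Lp.coeFn_smul c v)

/-- An element of `S_h` is determined by its restrictions to the simplexes, which range over
finite-dimensional spaces. -/
theorem finiteDimensional_femSpace {d : ℕ} {Ω : Set (Space d)} (hΩ : IsOpen Ω)
    (hb : Bornology.IsBounded Ω) {𝒦 : Finset (Finset (Space d))} (h𝒦 : IsTriangulation Ω 𝒦) :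
    FiniteDimensional ℝ (femSpace Ω 𝒦) := by
  set s : 𝒦 → Set (Space d) := fun K => convexHull ℝ (K.1 : Set (Space d)) with hs
  have hsm : ∀ K, MeasurableSet (s K) := fun K =>
    (Set.Finite.isCompact_convexHull ℝ K.1.finite_toSet).measurableSet
  set A := fun K : 𝒦 => LinearMap.range (affineAE ((volume.restrict Ω).restrict (s K)))
  have hA : ∀ (K : 𝒦) (v : femSpace Ω 𝒦),
      ((restrictAE (s K)).comp (toL2 (femSpace Ω 𝒦)).toLinearMap) v ∈ A K := by
    intro K v
    obtain ⟨a, b, h⟩ := v.2 K.1 K.2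
    refine ⟨(a, b), ?_⟩
    change AEEqFun.mk _ _ = AEEqFun.mk _ _
    rw [AEEqFun.mk_eq_mk, Filter.EventuallyEq, ae_restrict_iff' (hsm K)]
    filter_upwards [h] with x hx hxK
    exact (hx hxK).symm
  set L : femSpace Ω 𝒦 →ₗ[ℝ] (∀ K, A K) := LinearMap.pi fun K =>
    LinearMap.codRestrict (A K) _ (hA K)
  have hL : Function.Injective L := by
    rw [injective_iff_map_eq_zero]
    intro v hv
    have h1 : ∀ K : 𝒦, ∀ᵐ x ∂(volume.restrict Ω), x ∈ s K → H01.val v.1 x = 0 := by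
      intro K
      have h2 : (restrictAE (s K)) (H01.val v.1) = 0 := by
        have := congrArg (fun f => (f K : Space d →ₘ[(volume.restrict Ω).restrict (s K)] ℝ)) hv
        exact this
      rw [← ae_restrict_iff' (hsm K)]
      exact AEEqFun.mk_eq_mk.1 (h2.trans AEEqFun.zero_def)
    have h2 : H01.val v.1 = 0 := by
      refine Lp.ext ?_
      filter_upwards [ae_all_iff.2 h1, Lp.coeFn_zero ℝ 2 (volume.restrict Ω),
        ae_restrict_mem hΩ.measurableSet] with x hx h0 hxΩ
      rw [h0]
      have : x ∈ ⋃ K ∈ 𝒦, convexHull ℝ (K : Set (Space d)) := by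
        rw [h𝒦.2.1]; exact subset_closure hxΩ
      simp only [mem_iUnion] at this
      obtain ⟨K, hK, hxK⟩ := this
      exact hx ⟨K, hK⟩ hxK
    exact Subtype.ext ((injective_iff_map_eq_zero _).1 (H01.val_injective hΩ hb) _ h2)
  exact Module.Finite.of_injective L hL

theorem toL2_injective {d : ℕ} {Ω : Set (Space d)} (hΩ : IsOpen Ω) (hb : Bornology.IsBounded Ω)
    (S : Submodule ℝ (H01 Ω)) : Function.Injective (toL2 S) :=
  (H01.val_injective hΩ hb).comp Subtype.val_injective

theorem gradOn_injective {d : ℕ} (hd : 1 ≤ d) {Ω : Set (Space d)} (hΩ : MeasurableSet Ω)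
    (hb : Bornology.IsBounded Ω) (S : Submodule ℝ (H01 Ω)) : Function.Injective (gradOn S) :=
  (H01.grad_injective hd hΩ hb).comp Subtype.val_injective

/-- On a finite-dimensional space, every functional is represented by the inner product pulled
back along an injective linear map. -/
theorem exists_forall_inner_eq {X H : Type} [NormedAddCommGroup X] [NormedSpace ℝ X]
    [FiniteDimensional ℝ X] [NormedAddCommGroup H] [InnerProductSpace ℝ H] {A : X →L[ℝ] H}
    (hA : Function.Injective A) (l : Module.Dual ℝ X) : ∃ w, ∀ z, ⟪A w, A z⟫_ℝ = l z := by
  set L : X →ₗ[ℝ] Module.Dual ℝ X :=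
    ((innerₗ H).comp A.toLinearMap).compl₂ A.toLinearMap with hL
  have hLa : ∀ w z, L w z = ⟪A w, A z⟫_ℝ := fun w z => rfl
  have hinj : Function.Injective L := by
    rw [injective_iff_map_eq_zero]
    intro w hw
    have : ⟪A w, A w⟫_ℝ = 0 := by rw [← hLa, hw]; rfl
    exact (injective_iff_map_eq_zero _).1 hA _ (inner_self_eq_zero.1 this)
  obtain ⟨w, hw⟩ := (LinearMap.injective_iff_surjective_of_finrank_eq_finrank
    (Subspace.dual_finrank_eq).symm).1 hinj l
  exact ⟨w, fun z => by rw [← hLa, hw]⟩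

theorem exists_isDiscreteInitialValue {d : ℕ} (hd : 1 ≤ d) {Ω : Set (Space d)} (hΩ : IsOpen Ω)
    (hb : Bornology.IsBounded Ω) (S : Submodule ℝ (H01 Ω)) [FiniteDimensional ℝ S]
    (u₀ : L2 Ω ⊕ Module.Dual ℝ S) : ∃ w, IsDiscreteInitialValue S u₀ w := by
  rcases u₀ with u | l
  · by_cases h : ∃ v : H01 Ω, H01.val v = u
    · obtain ⟨v, hv⟩ := h
      obtain ⟨w, hw⟩ := exists_forall_inner_eq (gradOn_injective hd hΩ.measurableSet hb S)
        ((innerSL ℝ (H01.grad v)).comp (gradOn S)).toLinearMap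
      refine ⟨w, Or.inl ⟨v, hv, fun z => ?_⟩⟩
      rw [inner_sub_left, hw z]
      simp
    · obtain ⟨w, hw⟩ := exists_forall_inner_eq (toL2_injective hΩ hb S) (l2Functional S u)
      exact ⟨w, Or.inr ⟨h, hw⟩⟩
  · exact exists_forall_inner_eq (toL2_injective hΩ hb S) l

theorem IsDiscreteInitialValue.unique {d : ℕ} (hd : 1 ≤ d) {Ω : Set (Space d)} (hΩ : IsOpen Ω)
    (hb : Bornology.IsBounded Ω) {S : Submodule ℝ (H01 Ω)} {u₀ : L2 Ω ⊕ Module.Dual ℝ S} {w w' : S}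
    (h : IsDiscreteInitialValue S u₀ w) (h' : IsDiscreteInitialValue S u₀ w') : w = w' := by
  have hL2 : ∀ l : Module.Dual ℝ S, IsL2Projection S l w → IsL2Projection S l w' → w = w' := by
    intro l h1 h2
    refine toL2_injective hΩ hb S (sub_eq_zero.1 (inner_self_eq_zero (𝕜 := ℝ).1 ?_))
    rw [← map_sub, map_sub (toL2 S) w w', inner_sub_left, ← map_sub, h1, h2, sub_self]
  rcases u₀ with u | l
  · rcases h with ⟨v, hv, h⟩ | ⟨hn, h⟩ <;> rcases h' with ⟨v', hv', h'⟩ | ⟨hn', h'⟩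
    · have : v = v' := H01.val_injective hΩ hb (hv.trans hv'.symm)
      subst this
      refine gradOn_injective hd hΩ.measurableSet hb S
        (sub_eq_zero.1 (inner_self_eq_zero (𝕜 := ℝ).1 ?_))
      have h1 := h (w - w')
      have h2 := h' (w - w')
      rw [← map_sub, map_sub (gradOn S) w w', inner_sub_left, ← map_sub]
      rw [inner_sub_left] at h1 h2
      linarith
    · exact absurd ⟨v, hv⟩ hn'
    · exact absurd ⟨v', hv'⟩ hn
    · exact hL2 _ h h'
  · exact hL2 l h h'

theorem IsRitzProjection.norm_le {d : ℕ} {Ω : Set (Space d)} {S : Submodule ℝ (H01 Ω)} {v : H01 Ω}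
    {w : S} (h : IsRitzProjection S v w) : ‖gradOn S w‖ ≤ ‖H01.grad v‖ := by
  have h1 := h w
  rw [inner_sub_left, sub_eq_zero, real_inner_self_eq_norm_mul_norm] at h1
  have h2 := real_inner_le_norm (H01.grad v) (gradOn S w)
  rw [h1] at h2
  rcases (norm_nonneg (gradOn S w)).eq_or_lt with h3 | h3
  · rw [← h3]; exact norm_nonneg _
  · exact le_of_mul_le_mul_right h2 h3

/-! ### Trial and test functions -/

section Partition

variable {T : ℝ} {J : ℕ} {t : Fin (J + 1) → ℝ}

theorem IsPartition.lt (ht : IsPartition T t) (i : Fin J) : t i.castSucc < t i.succ :=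
  ht.1 (Fin.castSucc_lt_succ)

theorem IsPartition.mem_Icc (ht : IsPartition T t) (i : Fin (J + 1)) : t i ∈ Icc 0 T :=
  ⟨ht.2.1 ▸ ht.1.monotone (Fin.zero_le _), ht.2.2 ▸ ht.1.monotone (Fin.le_last _)⟩

theorem IsPartition.Ioo_subset (ht : IsPartition T t) (i : Fin J) :
    Ioo (t i.castSucc) (t i.succ) ⊆ Ioo 0 T :=
  Ioo_subset_Ioo (ht.mem_Icc _).1 (ht.mem_Icc _).2

theorem IsPartition.exists_mem_Ioc (ht : IsPartition T t) {s : ℝ} (hs : s ∈ Ioc 0 T) :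
    ∃ i : Fin J, s ∈ Ioc (t i.castSucc) (t i.succ) := by
  have h : ∀ m : Fin (J + 1), s ≤ t m → ∃ i : Fin J, s ∈ Ioc (t i.castSucc) (t i.succ) := by
    intro m
    induction m using Fin.induction with
    | zero => intro h; rw [ht.2.1] at h; exact absurd hs.1 (not_lt.2 h)
    | succ i ih =>
      intro h
      rcases lt_or_ge (t i.castSucc) s with h' | h'
      · exact ⟨i, h', h⟩
      · exact ih h'
  exact h (Fin.last J) (by rw [ht.2.2]; exact hs.2)

/-- The nodes of a partition are a null set, so that it suffices to argue on its intervals. -/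
theorem IsPartition.ae_of_forall (ht : IsPartition T t) {P : ℝ → Prop}
    (h : ∀ i : Fin J, ∀ᵐ s ∂(volume.restrict (Ioo (t i.castSucc) (t i.succ))), P s) :
    ∀ᵐ s ∂(timeMeasure T), P s := by
  have h0 : ∀ᵐ s ∂(volume : Measure ℝ), s ∉ range t :=
    (finite_range t).countable.ae_notMem _
  have h1 : ∀ᵐ s ∂(volume : Measure ℝ), ∀ i : Fin J, s ∈ Ioo (t i.castSucc) (t i.succ) → P s :=
    ae_all_iff.2 fun i => (ae_restrict_iff' measurableSet_Ioo).1 (h i)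
  rw [ae_restrict_iff' measurableSet_Ioo]
  filter_upwards [h0, h1] with s hs0 hs1 hs
  obtain ⟨i, hi⟩ := ht.exists_mem_Ioc ⟨hs.1, hs.2.le⟩
  exact hs1 i ⟨hi.1, lt_of_le_of_ne hi.2 fun h => hs0 ⟨_, h.symm⟩⟩

end Partition

theorem stepFun_add {X : Type} [AddCommGroup X] {J : ℕ} {t : Fin (J + 1) → ℝ} (a b : Fin J → X) :
    stepFun t (a + b) = stepFun t a + stepFun t b := by
  ext s
  simp only [stepFun, Pi.add_apply, ← Finset.sum_add_distrib]
  refine Finset.sum_congr rfl fun j _ => ?_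
  rw [indicator_add]

section Step

variable {X : Type} [NormedAddCommGroup X] [NormedSpace ℝ X] {T : ℝ} {J : ℕ}
  {t : Fin (J + 1) → ℝ}

theorem map_stepFun {Y : Type} [NormedAddCommGroup Y] [NormedSpace ℝ Y] (L : X →ₗ[ℝ] Y)
    (a : Fin J → X) (s : ℝ) : L (stepFun t a s) = stepFun t (fun j => L (a j)) s := by
  simp only [stepFun, map_sum]
  refine Finset.sum_congr rfl fun j _ => ?_
  by_cases h : s ∈ Ioo (t j.castSucc) (t j.succ)
  · rw [indicator_of_mem h, indicator_of_mem h]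
  · rw [indicator_of_notMem h, indicator_of_notMem h, map_zero]

theorem stepFun_smul (c : ℝ) (a : Fin J → X) : stepFun t (c • a) = c • stepFun t a := by
  ext s
  exact (map_stepFun (LinearMap.lsmul ℝ X c) a s).symm

/-- The step functions as elements of `L²(0, T; X)`. -/
def stepLp (T : ℝ) (t : Fin (J + 1) → ℝ) : (Fin J → X) →ₗ[ℝ] L2Time T X where
  toFun a := ((memLp_stepFun t a 2).restrict (Ioo 0 T)).toLp _
  map_add' a b := by
    rw [← MemLp.toLp_add]
    exact MemLp.toLp_congr _ _ (ae_of_all _ fun s => by rw [stepFun_add])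
  map_smul' c a := by
    rw [RingHom.id_apply, ← MemLp.toLp_const_smul]
    exact MemLp.toLp_congr _ _ (ae_of_all _ fun s => by rw [stepFun_smul])

theorem coeFn_stepLp (a : Fin J → X) : stepLp T t a =ᵐ[timeMeasure T] stepFun t a :=
  ((memLp_stepFun t a 2).restrict (Ioo 0 T)).coeFn_toLp

theorem eq_stepLp_iff {a : Fin J → X} {V : L2Time T X} :
    V = stepLp T t a ↔ V =ᵐ[timeMeasure T] stepFun t a :=
  ⟨fun h => h ▸ coeFn_stepLp a, fun h => Lp.ext (h.trans (coeFn_stepLp a).symm)⟩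

/-- The continuous piecewise linear function with the slopes `a` and the initial value `x₀`. -/
def stepPrim (t : Fin (J + 1) → ℝ) (x₀ : X) (a : Fin J → X) (s : ℝ) : X :=
  x₀ + ∑ j, max (min s (t j.succ) - t j.castSucc) 0 • a j

theorem integral_stepFun [CompleteSpace X] (ht : IsPartition T t) (a : Fin J → X) {s : ℝ}
    (hs : 0 ≤ s) :
    ∫ r in (0 : ℝ)..s, stepFun t a r =
      ∑ j, max (min s (t j.succ) - t j.castSucc) 0 • a j := by
  rw [intervalIntegral.integral_of_le hs, integral_Ioc_eq_integral_Ioo]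
  unfold stepFun
  rw [integral_finsetSum]
  · refine Finset.sum_congr rfl fun j _ => ?_
    rw [integral_indicator measurableSet_Ioo, Measure.restrict_restrict measurableSet_Ioo,
      Ioo_inter_Ioo, setIntegral_const, Real.volume_real_Ioo, sup_eq_left.2 (ht.mem_Icc _).1,
      inf_comm]
  · intro j _
    exact (integrable_const _).indicator measurableSet_Ioo

theorem stepPrim_eq [CompleteSpace X] (ht : IsPartition T t) (x₀ : X) (a : Fin J → X) {s : ℝ}
    (hs : 0 ≤ s) : stepPrim t x₀ a s = x₀ + ∫ r in (0 : ℝ)..s, stepFun t a r := by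
  rw [integral_stepFun ht a hs, stepPrim]

theorem integral_congr_timeMeasure {f g : ℝ → X} (h : f =ᵐ[timeMeasure T] g) {s : ℝ}
    (hs : s ∈ Icc 0 T) : ∫ r in (0 : ℝ)..s, f r = ∫ r in (0 : ℝ)..s, g r := by
  rw [intervalIntegral.integral_of_le hs.1, intervalIntegral.integral_of_le hs.1,
    integral_Ioc_eq_integral_Ioo, integral_Ioc_eq_integral_Ioo]
  exact integral_congr_ae (ae_restrict_of_ae_restrict_of_subset (Ioo_subset_Ioo_right hs.2) h)

theorem stepPrim_zero (ht : IsPartition T t) (x₀ : X) (a : Fin J → X) :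
    stepPrim t x₀ a 0 = x₀ := by
  have : ∀ j : Fin J, max (min 0 (t j.succ) - t j.castSucc) 0 = 0 := fun j =>
    max_eq_right (by linarith [min_le_left 0 (t j.succ), (ht.mem_Icc j.castSucc).1])
  simp [stepPrim, this]

theorem isPrimitive_iff [CompleteSpace X] (ht : IsPartition T t) {a : Fin J → X} {U : ℝ → X}
    {g : L2Time T X} (hg : g =ᵐ[timeMeasure T] stepFun t a) :
    IsPrimitive T U g ↔ ∀ s ∈ Icc 0 T, U s = stepPrim t (U 0) a s := by
  refine forall₂_congr fun s hs => ?_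
  rw [stepPrim_eq ht _ _ hs.1, integral_congr_timeMeasure hg hs]

/-- On each interval of the partition, the piecewise linear function is affine. -/
theorem stepPrim_of_mem [CompleteSpace X] (ht : IsPartition T t) (x₀ : X) (a : Fin J → X)
    {i : Fin J} {s : ℝ} (hs : s ∈ Icc (t i.castSucc) (t i.succ)) :
    stepPrim t x₀ a s = stepPrim t x₀ a (t i.castSucc) + (s - t i.castSucc) • a i := by
  have h0 := (ht.mem_Icc i.castSucc).1
  have hI : ∀ a' b', IntervalIntegrable (stepFun t a) volume a' b' := fun _ _ =>
    (integrable_stepFun t a).intervalIntegrable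
  rw [stepPrim_eq ht _ _ (h0.trans hs.1), stepPrim_eq ht _ _ h0, add_assoc]
  congr 1
  rw [← intervalIntegral.integral_add_adjacent_intervals (hI 0 (t i.castSucc)) (hI _ _)]
  congr 1
  rw [intervalIntegral.integral_of_le hs.1, integral_Ioc_eq_integral_Ioo,
    setIntegral_congr_fun (g := fun _ => a i) measurableSet_Ioo fun r hr =>
      stepFun_apply_of_mem ht.1.monotone a ⟨hr.1, hr.2.trans_le hs.2⟩,
    setIntegral_const, Real.volume_real_Ioo_of_le hs.1]

theorem stepPrim_succ [CompleteSpace X] (ht : IsPartition T t) (x₀ : X) (a : Fin J → X)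
    (i : Fin J) : stepPrim t x₀ a (t i.succ) =
      stepPrim t x₀ a (t i.castSucc) + (t i.succ - t i.castSucc) • a i :=
  stepPrim_of_mem ht x₀ a ⟨(ht.lt i).le, le_rfl⟩

theorem continuous_stepPrim (x₀ : X) (a : Fin J → X) : Continuous (stepPrim t x₀ a) := by
  unfold stepPrim
  fun_prop

/-- The trapezoidal rule is exact on each interval of the partition. -/
theorem integral_stepPrim [CompleteSpace X] (ht : IsPartition T t) (x₀ : X) (a : Fin J → X)
    (i : Fin J) :
    ∫ s in (t i.castSucc)..(t i.succ), stepPrim t x₀ a s = ((t i.succ - t i.castSucc) / 2) •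
      (stepPrim t x₀ a (t i.castSucc) + stepPrim t x₀ a (t i.succ)) := by
  have h : ∫ s in (t i.castSucc)..(t i.succ), stepPrim t x₀ a s =
      ∫ s in (t i.castSucc)..(t i.succ),
        (stepPrim t x₀ a (t i.castSucc) + (s - t i.castSucc) • a i) := by
    refine intervalIntegral.integral_congr fun s hs => ?_
    rw [uIcc_of_le (ht.lt i).le] at hs
    exact stepPrim_of_mem ht x₀ a hs
  have hc : IntervalIntegrable (fun s => (s - t i.castSucc) • a i) volume (t i.castSucc)
      (t i.succ) := (by fun_prop : Continuous _).intervalIntegrable _ _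
  rw [h, intervalIntegral.integral_add (by simp) hc, intervalIntegral.integral_const,
    intervalIntegral.integral_smul_const,
    intervalIntegral.integral_comp_sub_right (fun s => s), stepPrim_succ ht]
  simp only [sub_self, integral_id]
  module

end Step

section Spaces

variable {T : ℝ} {J : ℕ} {t : Fin (J + 1) → ℝ} {d : ℕ} {Ω : Set (Space d)}
  {S : Submodule ℝ (H01 Ω)}

theorem memTest_stepLp (ht : IsPartition T t) (b : Fin J → ℝ) : MemTest t (stepLp T t b) := by
  intro j
  refine ⟨b j, ?_⟩
  filter_upwards [ae_restrict_of_ae_restrict_of_subset (ht.Ioo_subset j)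
    (coeFn_stepLp (T := T) (t := t) b), ae_restrict_mem measurableSet_Ioo] with s h1 h2
  rw [h1, stepFun_apply_of_mem ht.1.monotone b h2]

theorem stepFun_single {X : Type} [NormedAddCommGroup X] [NormedSpace ℝ X] (j : Fin J) (x : X)
    (s : ℝ) : stepFun t (Pi.single j x) s = stepFun t (Pi.single j (1 : ℝ)) s • x := by
  have := map_stepFun (t := t) (LinearMap.toSpanSingleton ℝ X x) (Pi.single j (1 : ℝ)) s
  rw [LinearMap.toSpanSingleton_apply] at this
  rw [this]
  congr 1
  ext i
  by_cases h : i = j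
  · subst h; simp
  · simp [h]

/-- The test functions are the step functions with values in `S`. -/
theorem mem_testSpace_iff (ht : IsPartition T t) {V : L2Time T S} :
    V ∈ testSpace T t S ↔ V ∈ LinearMap.range (stepLp (X := S) T t) := by
  constructor
  · intro hV
    induction hV using Submodule.span_induction with
    | mem V h =>
      obtain ⟨w, v, hw, hV⟩ := h
      choose b hb using hw
      refine ⟨fun j => b j • v, (eq_stepLp_iff.2 (hV.trans ?_)).symm⟩
      refine ht.ae_of_forall fun i => ?_
      filter_upwards [hb i, ae_restrict_mem measurableSet_Ioo] with s h1 h2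
      rw [h1, stepFun_apply_of_mem ht.1.monotone _ h2]
    | zero => exact Submodule.zero_mem _
    | add x y _ _ hx hy => exact Submodule.add_mem _ hx hy
    | smul c x _ hx => exact Submodule.smul_mem _ c hx
  · rintro ⟨z, rfl⟩
    rw [← Finset.univ_sum_single z, map_sum]
    refine Submodule.sum_mem _ fun j _ => Submodule.subset_span ?_
    refine ⟨stepLp T t (Pi.single j 1), z j, memTest_stepLp ht _, ?_⟩
    filter_upwards [coeFn_stepLp (T := T) (t := t) (Pi.single j (z j)),
      coeFn_stepLp (T := T) (t := t) (Pi.single j (1 : ℝ))] with s h1 h2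
    rw [h1, h2, stepFun_single]

/-- The parametrization of the test functions by their values. -/
def stepTest (ht : IsPartition T t) (S : Submodule ℝ (H01 Ω)) :
    (Fin J → S) →ₗ[ℝ] testSpace T t S :=
  (stepLp T t).codRestrict _ fun z => (mem_testSpace_iff ht).2 ⟨z, rfl⟩

theorem memTrial_const (c : ℝ) : MemTrial T t fun _ => c :=
  ⟨⟨0, fun s hs => by
    have h := integral_congr_timeMeasure (T := T) (Lp.coeFn_zero ℝ 2 (timeMeasure T)) hs
    rw [h]; simp⟩, fun j => ⟨c, 0, fun s _ => by simp⟩⟩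

theorem memTrial_stepPrim (ht : IsPartition T t) (b : Fin J → ℝ) :
    MemTrial T t (stepPrim t 0 b) := by
  refine ⟨⟨stepLp T t b, (isPrimitive_iff ht (coeFn_stepLp b)).2 fun s _ => ?_⟩, fun j => ?_⟩
  · rw [stepPrim_zero ht]
  · refine ⟨stepPrim t 0 b (t j.castSucc) - b j * t j.castSucc, b j, fun s hs => ?_⟩
    rw [stepPrim_of_mem ht 0 b (Ioo_subset_Icc_self hs), smul_eq_mul]
    ring

theorem stepPrim_mem_trialSpace (ht : IsPartition T t) (x₀ : S) (a : Fin J → S) :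
    stepPrim t x₀ a ∈ trialSpace T t S := by
  have h : stepPrim t x₀ a = (fun _ => (1 : ℝ) • x₀) +
      ∑ j, fun s => stepPrim t (0 : ℝ) (Pi.single j 1) s • a j := by
    ext1 s
    simp [stepPrim, Finset.sum_apply, Pi.single_apply]
  rw [h]
  refine Submodule.add_mem _ (Submodule.subset_span ⟨_, _, memTrial_const 1, rfl⟩)
    (Submodule.sum_mem _ fun j _ => Submodule.subset_span ⟨_, _, memTrial_stepPrim ht _, rfl⟩)

/-- Trial functions are affine on each interval of the partition. -/
theorem exists_affine_of_mem_trialSpace {U : ℝ → S} (hU : U ∈ trialSpace T t S) (j : Fin J) :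
    ∃ x y : S, ∀ s ∈ Ioo (t j.castSucc) (t j.succ), U s = x + s • y := by
  induction hU using Submodule.span_induction with
  | mem U h =>
    obtain ⟨w, v, hw, rfl⟩ := h
    obtain ⟨a, b, hab⟩ := hw.2 j
    exact ⟨a • v, b • v, fun s hs => by simp only [hab s hs]; module⟩
  | zero => exact ⟨0, 0, fun s _ => by simp⟩
  | add U₁ U₂ _ _ h₁ h₂ =>
    obtain ⟨x₁, y₁, h₁⟩ := h₁
    obtain ⟨x₂, y₂, h₂⟩ := h₂
    exact ⟨x₁ + x₂, y₁ + y₂, fun s hs => by rw [Pi.add_apply, h₁ s hs, h₂ s hs]; module⟩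
  | smul c U _ h =>
    obtain ⟨x, y, h⟩ := h
    exact ⟨c • x, c • y, fun s hs => by rw [Pi.smul_apply, h s hs]; module⟩

/-- The derivative of a trial function is a step function. -/
theorem exists_stepFun_of_mem_trialSpace [CompleteSpace S] (ht : IsPartition T t) {U : ℝ → S}
    (hU : U ∈ trialSpace T t S) {U' : L2Time T S} (hU' : IsPrimitive T U U') :
    ∃ a : Fin J → S, U' =ᵐ[timeMeasure T] stepFun t a := by
  choose x y hxy using exists_affine_of_mem_trialSpace (t := t) hU
  refine ⟨y, ht.ae_of_forall fun i => ?_⟩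
  have hT : 0 ≤ T := (ht.mem_Icc 0).1.trans (ht.mem_Icc 0).2
  have hint : IntervalIntegrable U' volume 0 T := by
    rw [intervalIntegrable_iff_integrableOn_Ioo_of_le hT]
    exact (Lp.memLp U').integrable (by norm_num)
  have hd := hint.ae_hasDerivAt_integral
  filter_upwards [ae_restrict_of_ae hd, ae_restrict_mem measurableSet_Ioo] with s h1 hs
  rw [stepFun_apply_of_mem ht.1.monotone _ hs]
  have hs' := ht.Ioo_subset i hs
  have h2 := h1 (by rw [uIcc_of_le hT]; exact Ioo_subset_Icc_self hs') 0
    (by rw [uIcc_of_le hT]; exact ⟨le_rfl, hT⟩)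
  have h3 : HasDerivAt U (U' s) s := by
    refine (h2.const_add (U 0)).congr_of_eventuallyEq ?_
    filter_upwards [Icc_mem_nhds hs'.1 hs'.2] with r hr
    exact hU' r hr
  have h4 : HasDerivAt U (y i) s := by
    have : HasDerivAt (fun s : ℝ => x i + s • y i) ((1 : ℝ) • y i) s :=
      ((hasDerivAt_id s).smul_const (y i)).const_add (x i)
    rw [one_smul] at this
    refine this.congr_of_eventuallyEq ?_
    filter_upwards [Ioo_mem_nhds hs.1 hs.2] with r hr
    exact hxy i r hr
  exact h3.unique h4

end Spaces

/-! ### The discrete system -/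

theorem integral_inner_stepFun {X H : Type} [NormedAddCommGroup X] [NormedSpace ℝ X]
    [NormedAddCommGroup H] [InnerProductSpace ℝ H] [CompleteSpace H] {T : ℝ} {J : ℕ}
    {t : Fin (J + 1) → ℝ} (ht : IsPartition T t) (A : X →L[ℝ] H) (z : Fin J → X) {g : ℝ → H}
    (hg : IntegrableOn g (Ioo 0 T)) :
    ∫ s in Ioo 0 T, ⟪g s, A (stepFun t z s)⟫_ℝ =
      ∑ i, ⟪∫ s in (t i.castSucc)..(t i.succ), g s, A (z i)⟫_ℝ := by
  have e : ∀ s, ⟪g s, A (stepFun t z s)⟫_ℝ =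
      ∑ i, (Ioo (t i.castSucc) (t i.succ)).indicator (fun s => ⟪A (z i), g s⟫_ℝ) s := by
    intro s
    rw [← ContinuousLinearMap.coe_coe, map_stepFun, stepFun, inner_sum]
    refine Finset.sum_congr rfl fun i _ => ?_
    by_cases h : s ∈ Ioo (t i.castSucc) (t i.succ)
    · rw [indicator_of_mem h, indicator_of_mem h, real_inner_comm]
    · rw [indicator_of_notMem h, indicator_of_notMem h, inner_zero_right]
  have hi : ∀ i : Fin J, IntegrableOn g (Ioo (t i.castSucc) (t i.succ)) := fun i =>
    hg.mono_set (ht.Ioo_subset i)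
  simp only [e]
  rw [integral_finsetSum]
  · refine Finset.sum_congr rfl fun i _ => ?_
    rw [integral_indicator measurableSet_Ioo, Measure.restrict_restrict measurableSet_Ioo,
      inter_eq_self_of_subset_left (ht.Ioo_subset i), integral_inner (hi i), real_inner_comm,
      intervalIntegral.integral_of_le (ht.lt i).le, integral_Ioc_eq_integral_Ioo]
  · intro i _
    exact Integrable.indicator (hg.const_inner _) measurableSet_Ioo

theorem integral_rlStep {X : Type} [NormedAddCommGroup X] [NormedSpace ℝ X] [CompleteSpace X]
    {α : ℝ} (hα₁ : 1 < α) (hα₂ : α < 2) {J : ℕ} (t : Fin (J + 1) → ℝ) (a : Fin J → X)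
    (i : Fin J) :
    ∫ s in (t i.castSucc)..(t i.succ), rlStep α t a s = ∑ j, stepMat α t i j • a j := by
  unfold rlStep
  rw [intervalIntegral.integral_finsetSum]
  · refine Finset.sum_congr rfl fun j _ => ?_
    rw [intervalIntegral.integral_smul_const, intervalIntegral.integral_sub
      (intervalIntegrable_rlKer_sub hα₁ hα₂ _ _ _) (intervalIntegrable_rlKer_sub hα₁ hα₂ _ _ _),
      integral_rlKer_sub hα₁ hα₂, integral_rlKer_sub hα₁ hα₂, stepMat]
    congr 1
    ring
  · intro j _
    have h := intervalIntegrable_rlKer_sub_sub hα₁ hα₂ (t j.castSucc) (t j.succ)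
      (t i.castSucc) (t i.succ)
    exact ⟨h.1.smul_const _, h.2.smul_const _⟩

theorem stepPrim_add {X : Type} [NormedAddCommGroup X] [NormedSpace ℝ X] {J : ℕ}
    (t : Fin (J + 1) → ℝ) (x y : X) (a b : Fin J → X) (s : ℝ) :
    stepPrim t (x + y) (a + b) s = stepPrim t x a s + stepPrim t y b s := by
  simp only [stepPrim, Pi.add_apply, smul_add, Finset.sum_add_distrib]
  abel

theorem stepPrim_smul {X : Type} [NormedAddCommGroup X] [NormedSpace ℝ X] {J : ℕ}
    (t : Fin (J + 1) → ℝ) (c : ℝ) (x : X) (a : Fin J → X) (s : ℝ) :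
    stepPrim t (c • x) (c • a) s = c • stepPrim t x a s := by
  simp only [stepPrim, Pi.smul_apply, smul_add, Finset.smul_sum]
  congr 1
  exact Finset.sum_congr rfl fun j _ => smul_comm _ _ _

/-- The bilinear form of the discrete problem, in terms of the initial value and the slopes of the
trial function and the values of the test function. -/
def discreteForm (α : ℝ) {J : ℕ} (t : Fin (J + 1) → ℝ) {d : ℕ} {Ω : Set (Space d)}
    (S : Submodule ℝ (H01 Ω)) : (S × (Fin J → S)) →ₗ[ℝ] (Fin J → S) →ₗ[ℝ] ℝ :=
  LinearMap.mk₂ ℝ (fun q z =>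
    ∑ i, ⟪∑ j, stepMat α t i j • toL2 S (q.2 j), toL2 S (z i)⟫_ℝ +
    ∑ i, ⟪gradOn S (((t i.succ - t i.castSucc) / 2) •
      (stepPrim t q.1 q.2 (t i.castSucc) + stepPrim t q.1 q.2 (t i.succ))), gradOn S (z i)⟫_ℝ)
    (fun q r z => by
      simp only [Prod.fst_add, Prod.snd_add, Pi.add_apply, map_add, stepPrim_add, smul_add,
        Finset.sum_add_distrib, inner_add_left]
      ring)
    (fun c q z => by
      simp only [Prod.smul_fst, Prod.smul_snd, Pi.smul_apply, map_smul, stepPrim_smul,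
        ← smul_add, smul_comm _ c, ← Finset.smul_sum, real_inner_smul_left, ← Finset.mul_sum,
        smul_eq_mul]
      ring)
    (fun q z w => by
      simp only [Pi.add_apply, map_add, inner_add_right, Finset.sum_add_distrib]
      ring)
    (fun c q z => by
      simp only [Pi.smul_apply, map_smul, real_inner_smul_right, ← Finset.mul_sum, smul_eq_mul,
        ← mul_add])

theorem discreteForm_apply (α : ℝ) {J : ℕ} (t : Fin (J + 1) → ℝ) {d : ℕ} {Ω : Set (Space d)}
    (S : Submodule ℝ (H01 Ω)) (x₀ : S) (a z : Fin J → S) :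
    discreteForm α t S (x₀, a) z = ∑ i, ⟪∑ j, stepMat α t i j • toL2 S (a j), toL2 S (z i)⟫_ℝ +
    ∑ i, ⟪gradOn S (((t i.succ - t i.castSucc) / 2) •
      (stepPrim t x₀ a (t i.castSucc) + stepPrim t x₀ a (t i.succ))), gradOn S (z i)⟫_ℝ :=
  rfl

/-- The linear map `V ↦ ∫₀ᵀ V D_{0+}^α t` on step functions. -/
def rlMoment (α : ℝ) {J : ℕ} (t : Fin (J + 1) → ℝ) (X : Type) [NormedAddCommGroup X]
    [NormedSpace ℝ X] : (Fin J → X) →ₗ[ℝ] X :=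
  ∑ i, (rlKerPrim α (t i.succ) - rlKerPrim α (t i.castSucc)) • LinearMap.proj i

theorem rlMoment_apply (α : ℝ) {J : ℕ} (t : Fin (J + 1) → ℝ) {X : Type} [NormedAddCommGroup X]
    [NormedSpace ℝ X] (z : Fin J → X) : rlMoment α t X z =
      ∑ i, (rlKerPrim α (t i.succ) - rlKerPrim α (t i.castSucc)) • z i := by
  simp [rlMoment, LinearMap.sum_apply]

/-- The Petrov–Galerkin problem is a linear system for the slopes of the solution. -/
theorem isSolution_iff {α T : ℝ} (hα₁ : 1 < α) (hα₂ : α < 2) (hT : 0 < T) {d : ℕ}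
    {Ω : Set (Space d)} {J : ℕ} {t : Fin (J + 1) → ℝ} (ht : IsPartition T t)
    (S : Submodule ℝ (H01 Ω)) [FiniteDimensional ℝ S] (u₀ : L2 Ω ⊕ Module.Dual ℝ S)
    (u₁ : Module.Dual ℝ S) (f : Module.Dual ℝ (testSpace T t S)) (U : ℝ → S) :
    IsSolution α T t S u₀ u₁ f U ↔ U ∈ trialSpace T t S ∧ IsDiscreteInitialValue S u₀ (U 0) ∧
      ∃ a : Fin J → S, (∀ s ∈ Icc 0 T, U s = stepPrim t (U 0) a s) ∧
        ∀ z, discreteForm α t S (U 0, a) z =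
          f (stepTest ht S z) + u₁ (rlMoment α t S z) := by
  have : CompleteSpace S := FiniteDimensional.complete ℝ S
  have hk : IntegrableOn (rlKer α) (Ioo 0 T) :=
    (intervalIntegrable_rlKer hα₁ hα₂ 0 T).1.mono_set Ioo_subset_Ioc_self
  -- the terms of the equation, evaluated for any choice of the almost everywhere defined
  -- representatives `G` and `g` of the fractional derivatives
  have key : ∀ (a z : Fin J → S) (G : ℝ → S) (g : ℝ → ℝ),
      (∀ s ∈ Icc 0 T, U s = stepPrim t (U 0) a s) → G =ᵐ[timeMeasure T] rlStep α t a →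
      g =ᵐ[timeMeasure T] rlKer α →
      (∫ s in Ioo 0 T, ⟪toL2 S (G s), toL2 S (stepLp T t z s)⟫_ℝ) +
        (∫ s in Ioo 0 T, ⟪gradOn S (U s), gradOn S (stepLp T t z s)⟫_ℝ) =
        discreteForm α t S (U 0, a) z ∧
      ∫ s in Ioo 0 T, g s • stepLp T t z s = rlMoment α t S z := by
    intro a z G g hU hG hg
    have hz := coeFn_stepLp (T := T) (t := t) z
    have hGi : IntegrableOn (rlStep α t a) (Ioo 0 T) :=
      (isRLDeriv_stepFun hα₁ hα₂ hT ht a (Filter.EventuallyEq.refl _ _)).1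
    have e1 : ∫ s in Ioo 0 T, ⟪toL2 S (G s), toL2 S (stepLp T t z s)⟫_ℝ =
        ∑ i, ⟪∑ j, stepMat α t i j • toL2 S (a j), toL2 S (z i)⟫_ℝ := by
      have h1 : ∫ s in Ioo 0 T, ⟪toL2 S (G s), toL2 S (stepLp T t z s)⟫_ℝ =
          ∫ s in Ioo 0 T, ⟪toL2 S (rlStep α t a s), toL2 S (stepFun t z s)⟫_ℝ := by
        refine integral_congr_ae ?_
        filter_upwards [hG, hz] with s h1 h2
        rw [h1, h2]
      rw [h1, integral_inner_stepFun ht (toL2 S) z ((toL2 S).integrable_comp hGi)]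
      refine Finset.sum_congr rfl fun i _ => ?_
      rw [ContinuousLinearMap.intervalIntegral_comp_comm, integral_rlStep hα₁ hα₂]
      · simp only [map_sum, map_smul]
      · rw [intervalIntegrable_iff_integrableOn_Ioo_of_le (ht.lt i).le]
        exact hGi.mono_set (ht.Ioo_subset i)
    have e2 : ∫ s in Ioo 0 T, ⟪gradOn S (U s), gradOn S (stepLp T t z s)⟫_ℝ =
        ∑ i, ⟪gradOn S (((t i.succ - t i.castSucc) / 2) •
        (stepPrim t (U 0) a (t i.castSucc) + stepPrim t (U 0) a (t i.succ))),
          gradOn S (z i)⟫_ℝ := by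
      have hc : Continuous (stepPrim t (U 0) a) := continuous_stepPrim _ _
      have h1 : ∫ s in Ioo 0 T, ⟪gradOn S (U s), gradOn S (stepLp T t z s)⟫_ℝ =
          ∫ s in Ioo 0 T, ⟪gradOn S (stepPrim t (U 0) a s), gradOn S (stepFun t z s)⟫_ℝ := by
        refine integral_congr_ae ?_
        filter_upwards [hz, ae_restrict_mem measurableSet_Ioo] with s h1 h2
        rw [h1, hU s (Ioo_subset_Icc_self h2)]
      have hi : IntegrableOn (fun s => gradOn S (stepPrim t (U 0) a s)) (Ioo 0 T) :=
        ((gradOn S).continuous.comp hc).continuousOn.integrableOn_Icc.mono_set Ioo_subset_Icc_self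
      rw [h1, integral_inner_stepFun ht (gradOn S) z hi]
      refine Finset.sum_congr rfl fun i _ => ?_
      rw [ContinuousLinearMap.intervalIntegral_comp_comm _ (hc.intervalIntegrable _ _),
        integral_stepPrim ht]
    refine ⟨by rw [e1, e2, discreteForm_apply], ?_⟩
    have h1 : ∫ s in Ioo 0 T, g s • stepLp T t z s =
        ∫ s in Ioo 0 T, rlKer α s • stepFun t z s := by
      refine integral_congr_ae ?_
      filter_upwards [hg, hz] with s h1 h2
      rw [h1, h2]
    rw [h1, integral_smul_stepFun ht z hk, rlMoment_apply]
    simp only [integral_rlKer hα₁ hα₂]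
  constructor
  · rintro ⟨hU, h0, U', G, g, hU', hG, hg, heq⟩
    obtain ⟨a, ha⟩ := exists_stepFun_of_mem_trialSpace ht hU hU'
    have hUa := (isPrimitive_iff ht ha).1 hU'
    refine ⟨hU, h0, a, hUa, fun z => ?_⟩
    obtain ⟨h1, h2⟩ := key a z G g hUa (hG.ae_eq (isRLDeriv_stepFun hα₁ hα₂ hT ht a ha))
      (hg.ae_eq (isRLDeriv_id hα₁ hα₂ hT))
    rw [← h1, ← h2]
    exact heq (stepTest ht S z)
  · rintro ⟨hU, h0, a, hUa, heq⟩
    refine ⟨hU, h0, stepLp T t a, rlStep α t a, rlKer α,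
      (isPrimitive_iff ht (coeFn_stepLp a)).2 hUa,
      isRLDeriv_stepFun hα₁ hα₂ hT ht a (coeFn_stepLp a), isRLDeriv_id hα₁ hα₂ hT, ?_⟩
    rintro ⟨V, hV⟩
    obtain ⟨z, rfl⟩ := (mem_testSpace_iff ht).1 hV
    obtain ⟨h1, h2⟩ := key a z _ _ hUa (Filter.EventuallyEq.refl _ _) (Filter.EventuallyEq.refl _ _)
    rw [h1, h2]
    exact heq z

/-! ### The energy identity -/

/-- The quadratic form `∫ ⟨D_{0+}^{α-1} w, w⟩` on step functions with values in a Hilbert space. -/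
def stepFormH (α : ℝ) {J : ℕ} (t : Fin (J + 1) → ℝ) {H : Type} [NormedAddCommGroup H]
    [InnerProductSpace ℝ H] (y : Fin J → H) : ℝ :=
  ∑ i, ∑ j, stepMat α t i j * ⟪y j, y i⟫_ℝ

/-- The energy of a vector-valued step function is the sum of the energies of its coefficients in
an orthonormal basis. -/
theorem hasSum_stepForm {ι H : Type} [NormedAddCommGroup H] [InnerProductSpace ℝ H]
    (e : HilbertBasis ι ℝ H) (α : ℝ) {J : ℕ} (t : Fin (J + 1) → ℝ) (y : Fin J → H) :
    HasSum (fun n => stepForm α t fun j => ⟪e n, y j⟫_ℝ) (stepFormH α t y) := by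
  unfold stepForm stepFormH
  refine hasSum_sum fun i _ => hasSum_sum fun j _ => HasSum.mul_left _ ?_
  simpa only [real_inner_comm (y j)] using e.hasSum_inner_mul_inner (y j) (y i)

theorem stepFormH_nonneg {H : Type} [NormedAddCommGroup H] [InnerProductSpace ℝ H]
    [CompleteSpace H] {α : ℝ} (hα₁ : 1 < α) (hα₂ : α < 2) {J : ℕ} {t : Fin (J + 1) → ℝ}
    (ht : Monotone t) (y : Fin J → H) : 0 ≤ stepFormH α t y := by
  obtain ⟨w, e, -⟩ := exists_hilbertBasis ℝ H
  exact (hasSum_stepForm e α t y).nonneg fun n => (gagliardo_stepFun hα₁ hα₂ ht _).1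

/-- The restriction of a step function to `(0, t_m)`. -/
def truncate {X : Type} [Zero X] {J : ℕ} (m : Fin (J + 1)) (a : Fin J → X) (i : Fin J) : X :=
  if i.castSucc < m then a i else 0

/-- A telescoping sum up to the index `m`. -/
theorem sum_truncate_eq_sub {J : ℕ} (D : Fin (J + 1) → ℝ) (m : Fin (J + 1)) :
    ∑ i : Fin J, (if i.castSucc < m then D i.succ - D i.castSucc else 0) = D m - D 0 := by
  induction m using Fin.induction with
  | zero => simp
  | succ k ih =>
    have : ∀ i : Fin J, (if i.castSucc < k.succ then D i.succ - D i.castSucc else 0) =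
        (if i.castSucc < k.castSucc then D i.succ - D i.castSucc else 0) +
          if i = k then D k.succ - D k.castSucc else 0 := by
      intro i
      rcases lt_trichotomy i k with h | h | h
      · have h1 : i.castSucc < k.castSucc := by simpa using h
        have h2 : i.castSucc < k.succ := h1.trans (Fin.castSucc_lt_succ)
        simp [h1, h2, h.ne]
      · subst h
        simp
      · have h1 : ¬ i.castSucc < k.castSucc := by simpa using h.le
        have h2 : ¬ i.castSucc < k.succ := by
          rw [not_lt, Fin.le_def]; simpa using h
        simp [h1, h2, h.ne']
    simp only [this, Finset.sum_add_distrib, ih, Finset.sum_ite_eq', Finset.mem_univ, if_true]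
    ring

/-- The energy identity, from testing with the derivative of the solution on `(0, t_m)`. -/
theorem discreteForm_truncate {α T : ℝ} (hα₂ : α < 2) {d : ℕ}
    {Ω : Set (Space d)} {J : ℕ} {t : Fin (J + 1) → ℝ} (ht : IsPartition T t)
    (S : Submodule ℝ (H01 Ω)) [CompleteSpace S] (x₀ : S) (a : Fin J → S) (m : Fin (J + 1)) :
    discreteForm α t S (x₀, a) (truncate m a) =
      stepFormH α t (fun j => toL2 S (truncate m a j)) +
        (‖gradOn S (stepPrim t x₀ a (t m))‖ ^ 2 - ‖gradOn S x₀‖ ^ 2) / 2 := by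
  rw [discreteForm_apply]
  congr 1
  · rw [stepFormH]
    refine Finset.sum_congr rfl fun i _ => ?_
    rw [sum_inner]
    refine Finset.sum_congr rfl fun j _ => ?_
    rw [real_inner_smul_left]
    -- by causality, the values of `a` after `t_m` do not matter before `t_m`
    rcases lt_or_ge i j with h | h
    · rw [stepMat_eq_zero hα₂ ht.1.monotone h, zero_mul, zero_mul]
    · by_cases hi : i.castSucc < m
      · have hj : j.castSucc < m := lt_of_le_of_lt (by simpa using h) hi
        simp only [truncate, hi, hj, if_true]
      · simp only [truncate, hi, if_false, map_zero, inner_zero_right]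
  · have h := sum_truncate_eq_sub (fun m => ‖gradOn S (stepPrim t x₀ a (t m))‖ ^ 2) m
    rw [ht.2.1, stepPrim_zero ht] at h
    rw [← h, Finset.sum_div]
    refine Finset.sum_congr rfl fun i _ => ?_
    by_cases hi : i.castSucc < m
    · simp only [truncate, hi, if_true]
      have h1 : (t i.succ - t i.castSucc) • gradOn S (a i) =
          gradOn S (stepPrim t x₀ a (t i.succ)) - gradOn S (stepPrim t x₀ a (t i.castSucc)) := by
        rw [stepPrim_succ ht, map_add, map_smul, add_sub_cancel_left]
      rw [map_smul, map_add, div_eq_inv_mul, mul_smul, real_inner_smul_left,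
        real_inner_smul_left, ← real_inner_smul_right, h1]
      simp only [inner_sub_right, inner_add_left, ← real_inner_self_eq_norm_sq]
      rw [real_inner_comm (gradOn S (stepPrim t x₀ a (t i.succ)))]
      ring
    · simp only [truncate, hi, if_false, map_zero, inner_zero_right, zero_div]

/-- The basic stability estimate: control of the right-hand side by the energy bounds the solution
at the nodes. -/
theorem energy_estimate {α T : ℝ} (hα₁ : 1 < α) (hα₂ : α < 2) {d : ℕ}
    {Ω : Set (Space d)} {J : ℕ} {t : Fin (J + 1) → ℝ} (ht : IsPartition T t)
    (S : Submodule ℝ (H01 Ω)) [CompleteSpace S] (x₀ : S) (a : Fin J → S) {K : ℝ}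
    (hK : ∀ z, discreteForm α t S (x₀, a) z ≤ K * √(stepFormH α t fun j => toL2 S (z j)))
    (m : Fin (J + 1)) :
    stepFormH α t (fun j => toL2 S (truncate m a j)) ≤ ‖gradOn S x₀‖ ^ 2 + K ^ 2 ∧
    ‖gradOn S (stepPrim t x₀ a (t m))‖ ^ 2 ≤ ‖gradOn S x₀‖ ^ 2 + K ^ 2 := by
  have h := hK (truncate m a)
  rw [discreteForm_truncate hα₂ ht] at h
  have h0 := stepFormH_nonneg hα₁ hα₂ ht.1.monotone fun j => toL2 S (truncate m a j)
  set x := stepFormH α t fun j => toL2 S (truncate m a j)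
  have hx := Real.sq_sqrt h0
  -- Young: `2 K √x ≤ K² + x`, which absorbs one of the two copies of `x`
  constructor
  · nlinarith [sq_nonneg (K - √x), sq_nonneg ‖gradOn S (stepPrim t x₀ a (t m))‖]
  · nlinarith [sq_nonneg (K - √x)]

/-- With zero data, the energy estimate makes the solution vanish at every node. -/
theorem discreteForm_injective {α T : ℝ} (hα₁ : 1 < α) (hα₂ : α < 2) {d : ℕ}
    {Ω : Set (Space d)} {J : ℕ} {t : Fin (J + 1) → ℝ} (ht : IsPartition T t)
    {S : Submodule ℝ (H01 Ω)} [CompleteSpace S] (hS : Function.Injective (gradOn S))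
    {a : Fin J → S} (ha : ∀ z, discreteForm α t S (0, a) z = 0) : a = 0 := by
  have h0 : ∀ m, stepPrim t 0 a (t m) = 0 := by
    intro m
    have h := (energy_estimate hα₁ hα₂ ht S 0 a (K := 0) (fun z => by rw [ha, zero_mul]) m).2
    rw [map_zero, norm_zero] at h
    have h1 : ‖gradOn S (stepPrim t 0 a (t m))‖ = 0 := by
      nlinarith [norm_nonneg (gradOn S (stepPrim t 0 a (t m)))]
    exact (injective_iff_map_eq_zero _).1 hS _ (norm_eq_zero.1 h1)
  ext1 i
  have h := stepPrim_succ ht 0 a i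
  rw [h0, h0, zero_add] at h
  exact (smul_eq_zero.1 h.symm).resolve_left (sub_pos.2 (ht.lt i)).ne'

theorem discreteForm_prod {α : ℝ} {d : ℕ} {Ω : Set (Space d)} {J : ℕ} {t : Fin (J + 1) → ℝ}
    {S : Submodule ℝ (H01 Ω)} (x₀ : S) (a z : Fin J → S) : discreteForm α t S (x₀, a) z =
      discreteForm α t S (x₀, 0) z + discreteForm α t S (0, a) z := by
  rw [← LinearMap.add_apply, ← map_add, Prod.mk_add_mk, add_zero, zero_add]

/-- Given the initial value, the system for the slopes is square, so that injectivity yields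
solvability. -/
theorem exists_discreteForm_eq {α T : ℝ} (hα₁ : 1 < α) (hα₂ : α < 2) {d : ℕ}
    {Ω : Set (Space d)} {J : ℕ} {t : Fin (J + 1) → ℝ} (ht : IsPartition T t)
    {S : Submodule ℝ (H01 Ω)} [FiniteDimensional ℝ S] (hS : Function.Injective (gradOn S))
    (x₀ : S) (l : Module.Dual ℝ (Fin J → S)) :
    ∃ a, ∀ z, discreteForm α t S (x₀, a) z = l z := by
  have : CompleteSpace S := FiniteDimensional.complete ℝ S
  have hinj : Function.Injective ((discreteForm α t S).comp (LinearMap.inr ℝ S (Fin J → S))) := by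
    rw [injective_iff_map_eq_zero]
    intro a ha
    exact discreteForm_injective hα₁ hα₂ ht hS fun z => LinearMap.congr_fun ha z
  obtain ⟨a, ha⟩ := (LinearMap.injective_iff_surjective_of_finrank_eq_finrank
    (Subspace.dual_finrank_eq (K := ℝ) (V := Fin J → S)).symm).1 hinj
      (l - discreteForm α t S (x₀, 0))
  refine ⟨a, fun z => ?_⟩
  have h := LinearMap.congr_fun ha z
  rw [LinearMap.sub_apply] at h
  rw [discreteForm_prod]
  change discreteForm α t S (0, a) z = _ at h
  rw [h]
  ring

theorem exists_isSolution {α T : ℝ} (hα₁ : 1 < α) (hα₂ : α < 2) (hT : 0 < T) {d : ℕ}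
    (hd : 1 ≤ d) {Ω : Set (Space d)} (hΩ : IsOpen Ω) (hb : Bornology.IsBounded Ω) {J : ℕ}
    {t : Fin (J + 1) → ℝ} (ht : IsPartition T t)
    (S : Submodule ℝ (H01 Ω)) [FiniteDimensional ℝ S] (u₀ : L2 Ω ⊕ Module.Dual ℝ S)
    (u₁ : Module.Dual ℝ S) (f : Module.Dual ℝ (testSpace T t S)) :
    ∃ U, IsSolution α T t S u₀ u₁ f U := by
  obtain ⟨x₀, hx₀⟩ := exists_isDiscreteInitialValue hd hΩ hb S u₀
  obtain ⟨a, ha⟩ := exists_discreteForm_eq hα₁ hα₂ ht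
    (gradOn_injective hd hΩ.measurableSet hb S) x₀
    (f.comp (stepTest ht S) + u₁.comp (rlMoment α t S))
  refine ⟨stepPrim t x₀ a, (isSolution_iff hα₁ hα₂ hT ht S u₀ u₁ f _).2 ?_⟩
  rw [stepPrim_zero ht]
  exact ⟨stepPrim_mem_trialSpace ht x₀ a, hx₀, a, fun s _ => rfl, ha⟩

theorem IsSolution.eqOn {α T : ℝ} (hα₁ : 1 < α) (hα₂ : α < 2) (hT : 0 < T) {d : ℕ}
    (hd : 1 ≤ d) {Ω : Set (Space d)} (hΩ : IsOpen Ω) (hb : Bornology.IsBounded Ω) {J : ℕ}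
    {t : Fin (J + 1) → ℝ} (ht : IsPartition T t)
    {S : Submodule ℝ (H01 Ω)} [FiniteDimensional ℝ S] {u₀ : L2 Ω ⊕ Module.Dual ℝ S}
    {u₁ : Module.Dual ℝ S} {f : Module.Dual ℝ (testSpace T t S)} {U V : ℝ → S}
    (hU : IsSolution α T t S u₀ u₁ f U) (hV : IsSolution α T t S u₀ u₁ f V) :
    EqOn U V (Icc 0 T) := by
  have : CompleteSpace S := FiniteDimensional.complete ℝ S
  rw [isSolution_iff hα₁ hα₂ hT ht] at hU hV
  obtain ⟨-, hU0, a, ha, hUa⟩ := hU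
  obtain ⟨-, hV0, b, hb', hVb⟩ := hV
  have h0 : U 0 = V 0 := hU0.unique hd hΩ hb hV0
  have hab : a - b = 0 := by
    refine discreteForm_injective (α := α) hα₁ hα₂ ht (gradOn_injective hd hΩ.measurableSet hb S)
      fun z => ?_
    have h1 : ((0 : S), a - b) = (U 0, a) - (V 0, b) := by
      rw [Prod.mk_sub_mk, h0, sub_self]
    rw [h1, map_sub, LinearMap.sub_apply, hUa, hVb, sub_self]
  intro s hs
  rw [ha s hs, hb' s hs, h0, sub_eq_zero.1 hab]

/-! ### The duality pairing and stability -/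

theorem fracNorm_smul_le (T p s c : ℝ) (v : L2Time T ℝ) :
    fracNorm T p s (c • v) ≤ ‖c‖ₑ * fracNorm T p s v := by
  unfold fracNorm
  have h : ∀ x : ℝ≥0∞, ‖c‖ₑ * x ^ (1 / 2 : ℝ) = (‖c‖ₑ ^ 2 * x) ^ (1 / 2 : ℝ) := by
    intro x
    rw [ENNReal.mul_rpow_of_nonneg _ _ (by norm_num), ← ENNReal.rpow_natCast, ← ENNReal.rpow_mul]
    norm_num
  rw [h, ← lintegral_const_mul' _ _ (by finiteness)]
  gcongr with r
  calc (ENNReal.ofReal (r ^ (-s)) * kFunctional T p (c • v) r) ^ 2 / ENNReal.ofReal r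
      ≤ (ENNReal.ofReal (r ^ (-s)) * (‖c‖ₑ * kFunctional T p v r)) ^ 2 / ENNReal.ofReal r := by
        gcongr
        exact kFunctional_smul_le T p c v r
    _ = _ := by
        simp only [div_eq_mul_inv]
        ring

theorem enorm_apply_le_dualNorm_mul {T s : ℝ} {c : Module.Dual ℝ (fracSpace T T s)}
    (hc : dualNorm T s c ≠ ⊤) (v : fracSpace T T s) :
    ‖c v‖ₑ ≤ dualNorm T s c * fracNorm T T s v := by
  have hv : fracNorm T T s v ≠ ⊤ := ne_of_lt v.2
  -- the norm of `v` may vanish, so `v` is scaled by numbers `q > 0` above it, which then decrease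
  have h1 : ∀ q : ℝ, 0 < q → fracNorm T T s v ≤ ENNReal.ofReal q →
      ‖c v‖ₑ ≤ dualNorm T s c * ENNReal.ofReal q := by
    intro q hq h
    have hq' : ENNReal.ofReal q ≠ 0 := by simpa using hq
    have e : ‖q⁻¹‖ₑ = (ENNReal.ofReal q)⁻¹ := by
      rw [Real.enorm_eq_ofReal (by positivity), ENNReal.ofReal_inv_of_pos hq]
    have h2 : fracNorm T T s (q⁻¹ • v : fracSpace T T s) ≤ 1 := by
      refine (fracNorm_smul_le T T s q⁻¹ v).trans ?_
      rw [e]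
      calc _ ≤ (ENNReal.ofReal q)⁻¹ * ENNReal.ofReal q := by gcongr
        _ = 1 := ENNReal.inv_mul_cancel hq' ENNReal.ofReal_ne_top
    have h3 : ‖c (q⁻¹ • v)‖ₑ ≤ dualNorm T s c :=
      le_iSup₂ (f := fun (v : fracSpace T T s) (_ : fracNorm T T s v ≤ 1) => ‖c v‖ₑ) _ h2
    rw [map_smul, smul_eq_mul, enorm_mul, e] at h3
    calc ‖c v‖ₑ = (ENNReal.ofReal q)⁻¹ * ‖c v‖ₑ * ENNReal.ofReal q := by
          rw [mul_comm, ← mul_assoc, ENNReal.mul_inv_cancel hq' ENNReal.ofReal_ne_top, one_mul]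
      _ ≤ _ := by gcongr
  have ht : Tendsto (fun ε : ℝ => dualNorm T s c *
      ENNReal.ofReal ((fracNorm T T s v).toReal + ε)) (𝓝[>] 0)
      (𝓝 (dualNorm T s c * fracNorm T T s v)) := by
    refine ENNReal.Tendsto.const_mul ?_ (Or.inr hc)
    have : Tendsto (fun ε : ℝ => (fracNorm T T s v).toReal + ε) (𝓝[>] 0)
        (𝓝 ((fracNorm T T s v).toReal + 0)) :=
      (by fun_prop : Continuous fun ε : ℝ => (fracNorm T T s v).toReal + ε).continuousWithinAt
    have h4 := ENNReal.tendsto_ofReal this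
    rwa [add_zero, ENNReal.ofReal_toReal hv] at h4
  refine ge_of_tendsto ht ?_
  filter_upwards [self_mem_nhdsWithin] with ε hε
  have hε : 0 < ε := hε
  refine h1 _ (by positivity) ?_
  rw [ENNReal.le_ofReal_iff_toReal_le hv (by positivity)]
  linarith

/-- The Cauchy–Schwarz inequality for series. -/
theorem tsum_mul_le_rpow_mul_rpow (a b : ℕ → ℝ≥0∞) :
    ∑' n, a n * b n ≤ (∑' n, a n ^ 2) ^ (1 / 2 : ℝ) * (∑' n, b n ^ 2) ^ (1 / 2 : ℝ) := by
  have := ENNReal.lintegral_mul_le_Lp_mul_Lq (Measure.count : Measure ℕ)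
    Real.HolderConjugate.two_two (f := a) (g := b) (by fun_prop) (by fun_prop)
  simpa [lintegral_count] using this

section Coefficients

variable {T : ℝ} {J : ℕ} {t : Fin (J + 1) → ℝ} {d : ℕ} {Ω : Set (Space d)}
  {S : Submodule ℝ (H01 Ω)}

theorem coeff_ae_eq (e : HilbertBasis ℕ ℝ (L2 Ω)) (n : ℕ) {V : L2Time T S} {z : Fin J → S}
    (hV : V =ᵐ[timeMeasure T] stepFun t z) : coeff e (timeToL2 S V) n =ᵐ[timeMeasure T]
      stepFun t fun j => ⟪e n, toL2 S (z j)⟫_ℝ := by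
  filter_upwards [hV, ContinuousLinearMap.coeFn_compLp (toL2 S) V,
    ContinuousLinearMap.coeFn_compLp (innerSL ℝ (e n)) (timeToL2 S V)] with s h1 h2 h3
  rw [coeff, h3, timeToL2, h2, h1]
  exact map_stepFun ((innerSL ℝ (e n)).comp (toL2 S)).toLinearMap z s

/-- The constant in the bound of the squared fractional norms of step functions by the energy. -/
def energyConst (α : ℝ) : ℝ := 8 * (Real.Gamma (2 - α) / (α - 1))

theorem energyConst_pos {α : ℝ} (hα₁ : 1 < α) (hα₂ : α < 2) : 0 < energyConst α :=
  mul_pos (by norm_num) (div_pos (Real.Gamma_pos_of_pos (by linarith)) (by linarith))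

/-- The energy of a test or trial function bounds its fractional norm, for both boundary
conditions. -/
theorem tsum_fracNorm_sq_le {α p : ℝ} (hα₁ : 1 < α) (hα₂ : α < 2) (hT : 0 < T)
    (hp : p = T ∨ p = 0) (ht : IsPartition T t) (e : HilbertBasis ℕ ℝ (L2 Ω)) {V : L2Time T S}
    {z : Fin J → S} (hV : V =ᵐ[timeMeasure T] stepFun t z) :
    (∑' n, fracNorm T p ((α - 1) / 2) (coeff e (timeToL2 S V) n) ^ 2) ^ (1 / 2 : ℝ) ≤
      ENNReal.ofReal (√(energyConst α) * √(stepFormH α t fun j => toL2 S (z j))) := by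
  have hc := (energyConst_pos hα₁ hα₂).le
  have hs := hasSum_stepForm e α t fun j => toL2 S (z j)
  have h0 : ∀ n, 0 ≤ stepForm α t fun j => ⟪e n, toL2 S (z j)⟫_ℝ := fun n =>
    (gagliardo_stepFun hα₁ hα₂ ht.1.monotone _).1
  have h1 : ∑' n, fracNorm T p ((α - 1) / 2) (coeff e (timeToL2 S V) n) ^ 2 ≤
      ENNReal.ofReal (energyConst α * stepFormH α t fun j => toL2 S (z j)) := by
    rw [← (hs.mul_left (energyConst α)).tsum_eq, ENNReal.ofReal_tsum_of_nonneg
      (fun n => mul_nonneg hc (h0 n)) (hs.mul_left _).summable]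
    exact ENNReal.tsum_le_tsum fun n =>
      fracNorm_stepFun_sq_le hα₁ hα₂ hT hp ht _ (coeff_ae_eq e n hV)
  have h2 := hs.nonneg h0
  calc _ ≤ ENNReal.ofReal (energyConst α * stepFormH α t fun j => toL2 S (z j)) ^ (1 / 2 : ℝ) := by
        gcongr
    _ = _ := by
        rw [ENNReal.ofReal_rpow_of_nonneg (by positivity) (by norm_num), ← Real.sqrt_eq_rpow,
          Real.sqrt_mul hc]

/-- The moment with the weight `D_{0+}^α t` is bounded by the energy; this controls the term with
the initial velocity. -/
theorem norm_rlMoment_le {α : ℝ} (hα₁ : 1 < α) (hα₂ : α < 2) (hT : 0 < T) (ht : IsPartition T t)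
    (e : HilbertBasis ℕ ℝ (L2 Ω)) (z : Fin J → S) :
    ‖toL2 S (rlMoment α t S z)‖ ≤
      √(2 * rlKerPrim α T) * √(stepFormH α t fun j => toL2 S (z j)) := by
  set y := toL2 S (rlMoment α t S z)
  have hk := (rlKerPrim_pos hα₂ hT).le
  have hs := hasSum_stepForm e α t fun j => toL2 S (z j)
  have h1 : HasSum (fun n => ⟪e n, y⟫_ℝ ^ 2) (‖y‖ ^ 2) := by
    have := e.hasSum_inner_mul_inner y y
    rw [real_inner_self_eq_norm_sq] at this
    simpa only [real_inner_comm y, ← sq] using this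
  have h2 : ‖y‖ ^ 2 ≤ 2 * rlKerPrim α T * stepFormH α t fun j => toL2 S (z j) := by
    refine hasSum_le (fun n => ?_) h1 (hs.mul_left _)
    have := sq_sum_rlKerPrim_le hα₁ hα₂ hT ht fun j => ⟪e n, toL2 S (z j)⟫_ℝ
    refine le_of_eq_of_le ?_ this
    simp only [y, rlMoment_apply, map_sum, map_smul, inner_sum, real_inner_smul_right]
  rw [← Real.sqrt_mul (by positivity)]
  exact Real.le_sqrt_of_sq_le h2

/-- The coefficients of test functions, as elements of `⁰H^s(0, T)`. -/
def coeffTest {α : ℝ} (hα₁ : 1 < α) (hα₂ : α < 2) (hT : 0 < T) (ht : IsPartition T t)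
    (S : Submodule ℝ (H01 Ω)) (e : HilbertBasis ℕ ℝ (L2 Ω)) (n : ℕ) :
    testSpace T t S →ₗ[ℝ] fracSpace T T ((α - 1) / 2) :=
  (((innerSL ℝ (e n)).compLpₗ 2 (timeMeasure T)).comp
    (((toL2 S).compLpₗ 2 (timeMeasure T)).comp (testSpace T t S).subtype)).codRestrict _ fun V => by
      obtain ⟨z, hz⟩ := (mem_testSpace_iff ht).1 V.2
      have h := fracNorm_stepFun_sq_le hα₁ hα₂ hT (Or.inl rfl) ht _
        (coeff_ae_eq e n (eq_stepLp_iff.1 hz.symm))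
      have h2 := h.trans_lt ENNReal.ofReal_lt_top
      exact lt_top_iff_ne_top.2 fun h3 => by
        change fracNorm T T ((α - 1) / 2) (coeff e (timeToL2 S V) n) = ⊤ at h3
        rw [h3] at h2
        simp at h2

/-- The duality pairing with an element of `₀H^{-s}(0, T; L²(Ω))` is a functional on the test
functions, and it is bounded by the energy. -/
theorem exists_pairing {α : ℝ} (hα₁ : 1 < α) (hα₂ : α < 2) (hT : 0 < T) (ht : IsPartition T t)
    (S : Submodule ℝ (H01 Ω)) (e : HilbertBasis ℕ ℝ (L2 Ω))
    (f : ℕ → Module.Dual ℝ (fracSpace T T ((α - 1) / 2))) (hf : dualNormL2 f < ⊤) :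
    ∃ F : Module.Dual ℝ (testSpace T t S),
      (∀ V : testSpace T t S, HasPairing e f (timeToL2 S V) (F V)) ∧
      ∀ z, |F (stepTest ht S z)| ≤ (dualNormL2 f).toReal *
        (√(energyConst α) * √(stepFormH α t fun j => toL2 S (z j))) := by
  have hf' : ∀ n, dualNorm T ((α - 1) / 2) (f n) ≠ ⊤ := by
    intro n h
    rw [dualNormL2, ENNReal.rpow_lt_top_iff_of_pos (by norm_num)] at hf
    have := (ENNReal.le_tsum (f := fun n => dualNorm T ((α - 1) / 2) (f n) ^ 2) n).trans_lt hf
    simp [h] at this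
  set c := fun n => coeffTest hα₁ hα₂ hT ht S e n with hc
  have hb : ∀ z, ∑' n, ‖f n (c n (stepTest ht S z))‖ₑ ≤ dualNormL2 f *
      ENNReal.ofReal (√(energyConst α) * √(stepFormH α t fun j => toL2 S (z j))) := by
    intro z
    calc _ ≤ ∑' n, dualNorm T ((α - 1) / 2) (f n) *
          fracNorm T T ((α - 1) / 2) (c n (stepTest ht S z)) :=
          ENNReal.tsum_le_tsum fun n => enorm_apply_le_dualNorm_mul (hf' n) _
      _ ≤ _ := tsum_mul_le_rpow_mul_rpow _ _
      _ ≤ _ := by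
          rw [dualNormL2]
          gcongr
          exact tsum_fracNorm_sq_le hα₁ hα₂ hT (Or.inl rfl) ht e
            (coeFn_stepLp (T := T) (t := t) z)
  have hsum : ∀ V, Summable fun n => f n (c n V) := by
    rintro ⟨V, hV⟩
    obtain ⟨z, rfl⟩ := (mem_testSpace_iff ht).1 hV
    have h1 := (hb z).trans_lt (ENNReal.mul_lt_top hf ENNReal.ofReal_lt_top)
    exact Summable.of_nnnorm (ENNReal.tsum_coe_ne_top_iff_summable.1 h1.ne)
  refine ⟨{ toFun := fun V => ∑' n, f n (c n V)
            map_add' := fun V W => ?_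
            map_smul' := fun r V => ?_ }, fun V => ⟨fun n => c n V, fun n => rfl, ?_⟩, fun z => ?_⟩
  · simp only [map_add]
    exact (hsum V).tsum_add (hsum W)
  · simp only [map_smul, smul_eq_mul, RingHom.id_apply]
    exact tsum_mul_left
  · exact (hsum V).hasSum
  · have h1 := (enorm_tsum_le_tsum_enorm (f := fun n => f n (c n (stepTest ht S z)))).trans (hb z)
    rw [← ENNReal.ofReal_toReal hf.ne, ← ENNReal.ofReal_mul ENNReal.toReal_nonneg,
      Real.enorm_eq_ofReal_abs] at h1
    exact (ENNReal.ofReal_le_ofReal_iff (by positivity)).1 h1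

end Coefficients

theorem dotHNorm_toL2_le {d : ℕ} {Ω : Set (Space d)} (Φ : DirichletEigenbasis Ω)
    (S : Submodule ℝ (H01 Ω)) (x : S) : dotHNorm Φ 1 (toL2 S x) ≤ ‖gradOn S x‖ₑ :=
  dotHNorm_le Φ x.1

/-- The gradient of a piecewise linear function attains its largest norm at a node. -/
theorem norm_gradOn_stepPrim_le {T : ℝ} {J : ℕ} {t : Fin (J + 1) → ℝ} (ht : IsPartition T t)
    {d : ℕ} {Ω : Set (Space d)} (S : Submodule ℝ (H01 Ω)) [CompleteSpace S] (x₀ : S)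
    (a : Fin J → S) {M : ℝ} (hM : ∀ m, ‖gradOn S (stepPrim t x₀ a (t m))‖ ≤ M) {s : ℝ}
    (hs : s ∈ Icc 0 T) : ‖gradOn S (stepPrim t x₀ a s)‖ ≤ M := by
  rcases hs.1.eq_or_lt with h | h
  · rw [← h, ← ht.2.1]; exact hM 0
  · obtain ⟨i, hi⟩ := ht.exists_mem_Ioc ⟨h, hs.2⟩
    have hlt := sub_pos.2 (ht.lt i)
    set θ := (s - t i.castSucc) / (t i.succ - t i.castSucc) with hθ
    have h0 : 0 ≤ θ := div_nonneg (by linarith [hi.1]) hlt.le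
    have h1 : θ ≤ 1 := (div_le_one hlt).2 (by linarith [hi.2])
    have h2 : stepPrim t x₀ a s = (1 - θ) • stepPrim t x₀ a (t i.castSucc) +
        θ • stepPrim t x₀ a (t i.succ) := by
      have h3 : s - t i.castSucc = θ * (t i.succ - t i.castSucc) := by
        rw [hθ]; field_simp
      rw [stepPrim_succ ht, stepPrim_of_mem ht x₀ a (Ioc_subset_Icc_self hi), h3]
      module
    rw [h2, map_add, map_smul, map_smul]
    calc _ ≤ ‖(1 - θ) • gradOn S (stepPrim t x₀ a (t i.castSucc))‖ +
          ‖θ • gradOn S (stepPrim t x₀ a (t i.succ))‖ := norm_add_le _ _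
      _ ≤ (1 - θ) * M + θ * M := by
          rw [norm_smul, norm_smul, Real.norm_of_nonneg h0, Real.norm_of_nonneg (by linarith)]
          gcongr
          · exact hM _
          · exact hM _
      _ = M := by ring

theorem isContinuousDotH1_of_eqOn {T : ℝ} {d : ℕ} {Ω : Set (Space d)} (Φ : DirichletEigenbasis Ω)
    (S : Submodule ℝ (H01 Ω)) {U W : ℝ → S} (hW : Continuous W) (hUW : EqOn U W (Icc 0 T)) :
    IsContinuousDotH1 Φ T fun s => toL2 S (U s) := by
  refine ⟨fun s _ => (dotHNorm_toL2_le Φ S _).trans_lt enorm_lt_top, fun s hs => ?_⟩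
  have h1 : Tendsto (fun r => ‖gradOn S (W r - W s)‖ₑ) (𝓝[Icc 0 T] s) (𝓝 0) := by
    have hc : Continuous fun r => ‖gradOn S (W r - W s)‖ₑ := by fun_prop
    have := (hc.tendsto s).mono_left (nhdsWithin_le_nhds (s := Icc 0 T))
    simpa using this
  refine tendsto_of_tendsto_of_tendsto_of_le_of_le' tendsto_const_nhds h1
    (Eventually.of_forall fun _ => zero_le) ?_
  filter_upwards [self_mem_nhdsWithin] with r hr
  rw [← map_sub, hUW hr, hUW hs]
  exact dotHNorm_toL2_le Φ S _

/-- For `u₀ ∈ Ḣ¹(Ω)`, the discrete initial value is a Ritz projection, which does not increase the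
norm of the gradient. -/
theorem norm_gradOn_initialValue_le {d : ℕ} {Ω : Set (Space d)} (hΩ : IsOpen Ω)
    (hb : Bornology.IsBounded Ω) (Φ : DirichletEigenbasis Ω) {S : Submodule ℝ (H01 Ω)} {u₀ : L2 Ω}
    (hu : dotHNorm Φ 1 u₀ < ⊤) {w : S} (hw : IsDiscreteInitialValue S (Sum.inl u₀) w) :
    ‖gradOn S w‖ ≤ (dotHNorm Φ 1 u₀).toReal := by
  obtain ⟨v, hv, hv'⟩ := exists_H01_of_dotHNorm Φ u₀ hu
  rcases hw with ⟨v', h1, h2⟩ | ⟨h, -⟩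
  · have : v' = v := H01.val_injective hΩ hb (h1.trans hv.symm)
    subst this
    refine h2.norm_le.trans ?_
    rw [← toReal_enorm]
    exact ENNReal.toReal_mono hu.ne hv'
  · exact absurd ⟨v, hv⟩ h

/-- The constant of the stability estimate. -/
def stabilityConst (α T : ℝ) : ℝ :=
  (√(energyConst α) + 1) * (1 + √(energyConst α) + √(2 * rlKerPrim α T))

theorem stabilityConst_pos (α T : ℝ) : 0 < stabilityConst α T := by
  unfold stabilityConst
  positivity

/-- The stability estimate, for data `F` that are bounded by the energy. -/
theorem stability {α T : ℝ} (hα₁ : 1 < α) (hα₂ : α < 2) (hT : 0 < T) {d : ℕ}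
    {Ω : Set (Space d)} (hΩ : IsOpen Ω) (hb : Bornology.IsBounded Ω) {J : ℕ}
    {t : Fin (J + 1) → ℝ} (ht : IsPartition T t) (S : Submodule ℝ (H01 Ω)) [FiniteDimensional ℝ S]
    (Φ : DirichletEigenbasis Ω) (e : HilbertBasis ℕ ℝ (L2 Ω)) {u₀ : L2 Ω}
    (hu : dotHNorm Φ 1 u₀ < ⊤) (u₁ : L2 Ω) {D : ℝ} (hD : 0 ≤ D)
    {F : Module.Dual ℝ (testSpace T t S)}
    (hF : ∀ z, |F (stepTest ht S z)| ≤
      D * (√(energyConst α) * √(stepFormH α t fun j => toL2 S (z j))))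
    {U : ℝ → S} (hU : IsSolution α T t S (Sum.inl u₀) (l2Functional S u₁) F U) :
    IsContinuousDotH1 Φ T (fun s => toL2 S (U s)) ∧
      ∃ U' : L2Time T S, IsPrimitive T U U' ∧
        fracNormL2 e ((α - 1) / 2) (timeToL2 S U') + supDotH1Norm Φ T (fun s => toL2 S (U s)) ≤
          ENNReal.ofReal (stabilityConst α T) *
            (dotHNorm Φ 1 u₀ + ‖u₁‖ₑ + ENNReal.ofReal D) := by
  have : CompleteSpace S := FiniteDimensional.complete ℝ S
  obtain ⟨-, h0, a, ha, heq⟩ := (isSolution_iff hα₁ hα₂ hT ht S _ _ _ _).1 hU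
  set N := (dotHNorm Φ 1 u₀).toReal with hN
  have hN0 : 0 ≤ N := ENNReal.toReal_nonneg
  have hg0 : ‖gradOn S (U 0)‖ ≤ N := norm_gradOn_initialValue_le hΩ hb Φ hu h0
  set K := D * √(energyConst α) + ‖u₁‖ * √(2 * rlKerPrim α T) with hK
  have hK0 : 0 ≤ K := by positivity
  have hform : ∀ z, discreteForm α t S (U 0, a) z ≤
      K * √(stepFormH α t fun j => toL2 S (z j)) := by
    intro z
    rw [heq]
    have h1 := (le_abs_self _).trans (hF z)
    have h2 : l2Functional S u₁ (rlMoment α t S z) ≤ ‖u₁‖ *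
        (√(2 * rlKerPrim α T) * √(stepFormH α t fun j => toL2 S (z j))) :=
      (real_inner_le_norm u₁ (toL2 S (rlMoment α t S z))).trans
        (mul_le_mul_of_nonneg_left (norm_rlMoment_le hα₁ hα₂ hT ht e z) (norm_nonneg _))
    calc _ ≤ _ := add_le_add h1 h2
      _ = _ := by rw [hK]; ring
  -- the square of `N + K` dominates the right-hand side of the energy estimate
  have hsq : ‖gradOn S (U 0)‖ ^ 2 + K ^ 2 ≤ (N + K) ^ 2 := by
    nlinarith [norm_nonneg (gradOn S (U 0)), mul_nonneg hN0 hK0]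
  have hen := energy_estimate hα₁ hα₂ ht S (U 0) a hform
  have hnode : ∀ m, ‖gradOn S (stepPrim t (U 0) a (t m))‖ ≤ N + K := fun m =>
    abs_le_of_sq_le_sq' ((hen m).2.trans hsq) (by positivity) |>.2
  have hQ : √(stepFormH α t fun j => toL2 S (a j)) ≤ N + K := by
    have h1 : truncate (Fin.last J) a = a := by
      ext1 i; simp [truncate, Fin.castSucc_lt_last]
    have h2 := (hen (Fin.last J)).1
    rw [h1] at h2
    exact Real.sqrt_le_iff.2 ⟨by positivity, h2.trans hsq⟩
  refine ⟨isContinuousDotH1_of_eqOn Φ S (continuous_stepPrim (U 0) a) ha, stepLp T t a,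
    (isPrimitive_iff ht (coeFn_stepLp a)).2 ha, ?_⟩
  have e1 : fracNormL2 e ((α - 1) / 2) (timeToL2 S (stepLp T t a)) ≤
      ENNReal.ofReal (√(energyConst α) * (N + K)) := by
    refine (tsum_fracNorm_sq_le hα₁ hα₂ hT (Or.inr rfl) ht e (coeFn_stepLp a)).trans ?_
    exact ENNReal.ofReal_le_ofReal (mul_le_mul_of_nonneg_left hQ (Real.sqrt_nonneg _))
  have e2 : supDotH1Norm Φ T (fun s => toL2 S (U s)) ≤ ENNReal.ofReal (N + K) := by
    refine iSup₂_le fun s hs => (dotHNorm_toL2_le Φ S _).trans ?_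
    rw [ha s hs, ← ofReal_norm]
    exact ENNReal.ofReal_le_ofReal (norm_gradOn_stepPrim_le ht S _ _ hnode hs)
  have e3 : dotHNorm Φ 1 u₀ + ‖u₁‖ₑ + ENNReal.ofReal D = ENNReal.ofReal (N + ‖u₁‖ + D) := by
    rw [ENNReal.ofReal_add (by positivity) hD, ENNReal.ofReal_add hN0 (norm_nonneg _), hN,
      ENNReal.ofReal_toReal hu.ne, ofReal_norm]
  rw [e3, ← ENNReal.ofReal_mul (stabilityConst_pos α T).le]
  calc _ ≤ ENNReal.ofReal (√(energyConst α) * (N + K)) + ENNReal.ofReal (N + K) :=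
        add_le_add e1 e2
    _ = ENNReal.ofReal ((√(energyConst α) + 1) * (N + K)) := by
        rw [← ENNReal.ofReal_add (by positivity) (by positivity)]
        congr 1; ring
    _ ≤ _ := by
        refine ENNReal.ofReal_le_ofReal ?_
        rw [stabilityConst, mul_assoc]
        refine mul_le_mul_of_nonneg_left ?_ (by positivity)
        have p1 := Real.sqrt_nonneg (energyConst α)
        have p2 := Real.sqrt_nonneg (2 * rlKerPrim α T)
        have p3 := norm_nonneg u₁
        rw [hK]
        nlinarith [mul_nonneg p1 hN0, mul_nonneg p1 p3, mul_nonneg p2 hN0, mul_nonneg p2 hD]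

end FracWave

end

open FracWave

/-- Unique solvability and stability of the Petrov–Galerkin method; the constant `C` depends only on
`α` and `T`. -/
theorem mainTheorem5 (α T : ℝ) (hα₁ : 1 < α) (hα₂ : α < 2) (hT : 0 < T) :
    -- unique solvability for all data `u₀, u₁ ∈ S_h*`, `f ∈ (Ŵ_τ ⊗ S_h)*`
    (∀ (d : ℕ), 1 ≤ d → d ≤ 3 → ∀ (Ω : Set (Space d)), IsConvexPolytope Ω →
      ∀ (𝒦 : Finset (Finset (Space d))), IsTriangulation Ω 𝒦 →
      ∀ (J : ℕ) (t : Fin (J + 1) → ℝ), IsPartition T t →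
      ∀ (u₀ : L2 Ω ⊕ Module.Dual ℝ (femSpace Ω 𝒦)) (u₁ : Module.Dual ℝ (femSpace Ω 𝒦))
        (f : Module.Dual ℝ (testSpace T t (femSpace Ω 𝒦))),
        (∃ U : ℝ → femSpace Ω 𝒦, IsSolution α T t (femSpace Ω 𝒦) u₀ u₁ f U) ∧
        ∀ U₁ U₂ : ℝ → femSpace Ω 𝒦, IsSolution α T t (femSpace Ω 𝒦) u₀ u₁ f U₁ →
          IsSolution α T t (femSpace Ω 𝒦) u₀ u₁ f U₂ → Set.EqOn U₁ U₂ (Set.Icc 0 T)) ∧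
    -- stability
    ∃ C : ℝ, 0 < C ∧
      ∀ (d : ℕ), 1 ≤ d → d ≤ 3 → ∀ (Ω : Set (Space d)), IsConvexPolytope Ω →
      ∀ (Φ : DirichletEigenbasis Ω) (e : HilbertBasis ℕ ℝ (L2 Ω)),
      ∀ (𝒦 : Finset (Finset (Space d))), IsTriangulation Ω 𝒦 →
      ∀ (J : ℕ) (t : Fin (J + 1) → ℝ), IsPartition T t →
      ∀ (u₀ : L2 Ω), dotHNorm Φ 1 u₀ < ⊤ → ∀ (u₁ : L2 Ω),
      ∀ (f : ℕ → Module.Dual ℝ (fracSpace T T ((α - 1) / 2))), dualNormL2 f < ⊤ →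
        -- `f` acts on `Ŵ_τ ⊗ S_h` by the duality pairing
        ∃ F : Module.Dual ℝ (testSpace T t (femSpace Ω 𝒦)),
          (∀ V : testSpace T t (femSpace Ω 𝒦),
            HasPairing e f (timeToL2 (femSpace Ω 𝒦) V) (F V)) ∧
          ∀ U : ℝ → femSpace Ω 𝒦, IsSolution α T t (femSpace Ω 𝒦) (Sum.inl u₀)
              (l2Functional (femSpace Ω 𝒦) u₁) F U →
            IsContinuousDotH1 Φ T (fun s => toL2 (femSpace Ω 𝒦) (U s)) ∧
            ∃ U' : L2Time T (femSpace Ω 𝒦), IsPrimitive T U U' ∧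
              fracNormL2 e ((α - 1) / 2) (timeToL2 (femSpace Ω 𝒦) U') +
                  supDotH1Norm Φ T (fun s => toL2 (femSpace Ω 𝒦) (U s)) ≤
                ENNReal.ofReal C * (dotHNorm Φ 1 u₀ + ‖u₁‖ₑ + dualNormL2 f) := by
  refine ⟨?_, stabilityConst α T, stabilityConst_pos α T, ?_⟩
  · intro d hd _ Ω hΩ 𝒦 h𝒦 J t ht u₀ u₁ f
    have := finiteDimensional_femSpace hΩ.isOpen hΩ.isBounded h𝒦
    exact ⟨exists_isSolution hα₁ hα₂ hT hd hΩ.isOpen hΩ.isBounded ht _ u₀ u₁ f,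
      fun U₁ U₂ h₁ h₂ => h₁.eqOn hα₁ hα₂ hT hd hΩ.isOpen hΩ.isBounded ht h₂⟩
  · intro d _ _ Ω hΩ Φ e 𝒦 h𝒦 J t ht u₀ hu u₁ f hf
    have := finiteDimensional_femSpace hΩ.isOpen hΩ.isBounded h𝒦
    obtain ⟨F, hF, hF'⟩ := exists_pairing hα₁ hα₂ hT ht (femSpace Ω 𝒦) e f hf
    refine ⟨F, hF, fun U hU => ?_⟩
    have h := stability hα₁ hα₂ hT hΩ.isOpen hΩ.isBounded ht _ Φ e hu u₁
      ENNReal.toReal_nonneg hF' hU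
    rwa [ENNReal.ofReal_toReal hf.ne] at h
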